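/- **Setting.** Let $k$ be an algebraically closed field and $R$ a finite-dimensional $k$-algebra; "module" means finitely generated left $R$-module, $\mathrm{pd}$ is projective dimension (with $\mathrm{pd}\,0=0$), $\coprod$ is direct sum, and $\mathrm{pfd}\,\mathcal C=\sup\{\mathrm{pd}\,C : C\in\mathcal C,\ \mathrm{pd}\,C<\infty\}$ for a class $\mathcal C$ of modules. Let $\Omega M$ be the kernel of the projective cover of $M$, $\Omega^0M=M$, $\Omega^{n+1}M=\Omega(\Omega^nM)$. *Igusa–Todorov function.* Let $\mathcal K$ be the abelian group generated by symbols $[M]$, $M$ a module, with relations $[C]=[A]+[B]$ if $C\simeq A\coprod B$ and $[P]=0$ if $P$ is projective; $\Omega$ induces an endomorphism $\Omega$ of $\mathcal K$ with $\Omega[M]=[\Omega M]$. Let $\langle M\rangle\subseteq\mathcal K$ be the subgroup generated by the classes of the indecomposable direct summands of $M$, let $\Phi(M)$ be the smallest $n\ge 0$ such that $\Omega:\Omega^m\langle M\rangle\to\Omega^{m+1}\langle M\rangle$ is an isomorphism for all $m\ge n$, and let $\Psi(M)=\Phi(M)+\mathrm{pfd}\,\mathcal C_M\in\mathbb N$,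 where $\mathcal C_M$ is the class of direct summands of $\Omega^{\Phi(M)}M$. *Stratifying systems.* A stratifying system $(\theta,\le)$ of size $t\geq 1$ is a family $\theta(1),\dots,\theta(t)$ of indecomposable modules with $\mathrm{Hom}_R(\theta(j),\theta(i))=0$ for $j>i$ and $\mathrm{Ext}^1_R(\theta(j),\theta(i))=0$ for $j\ge i$. $\mathcal F(\theta)$ is the class of modules $M$ having a finite chain $0=M_0\subseteq M_1\subseteq\dots\subseteq M_m=M$ of submodules with each $M_l/M_{l-1}$ isomorphic to some $\theta(i)$ (so $0\in\mathcal F(\theta)$); the number $[M:\theta(i)]$ of factors isomorphic to $\theta(i)$ does not depend on the chain, and $\mathrm{Supp}_\theta(M)=\{i:[M:\theta(i)]\ne 0\}$. Let $\infty_\theta=\{i:\mathrm{pd}\,\theta(i)=\infty\}$, and let $\mathcal P(\theta)$ be the class of modules $X$ with $\mathrm{Ext}^1_R(X,Y)=0$ for all $Y\in\mathcal F(\theta)$. An Ext-projective cover of $M\in\mathcal F(\theta)$ is a morphism $\varepsilon_M:Q_0(M)\to M$ in $\mathcal F(\theta)$ that is a right minimal $\mathcal P(\theta)$-approximation of $M$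 and has $\mathrm{Ker}\,\varepsilon_M\in\mathcal F(\theta)$; every $M\in\mathcal F(\theta)$ has one, unique up to isomorphism. Suppose $\infty_\theta=\{i_0,i_1,i_2\}$ with $i_0<i_1<i_2$. $\mathcal F(\theta)$ satisfies the *3-finitistic property* if for every $M\in\mathcal F(\theta)$: if $i_1,i_2\in\mathrm{Supp}_\theta(\mathrm{Ker}\,\varepsilon_M)$ and $\mathrm{pd}\,M<\infty$, then $\mathrm{pd}\,\mathrm{Ker}\,\varepsilon_M<\infty$. It satisfies the *3-cardinal property* if for every $M\in\mathcal F(\theta)$: if $\mathrm{Supp}_\theta(M)\cap\infty_\theta=\{i_0,i_1\}$, then $\mathrm{card}(\mathrm{Supp}_\theta(\mathrm{Ker}\,\varepsilon_M)\cap\infty_\theta)\le 1$. **Theorem.** Let $(\theta,\le)$ be a stratifying system of size $t$ with $\infty_\theta=\{i_0,i_1,i_2\}$, $i_0<i_1<i_2$. Put $s=\max\{\mathrm{pd}\,\theta(j): j\notin\infty_\theta\}$ if $t>3$ and $s=0$ otherwise, $\varepsilon_0=\Psi(\Omega^{s+1}\theta(i_2)\coprod\Omega^{s+2}\theta(i_1))$,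 $\theta_{1,2}=\theta(i_1)\coprod\theta(i_2)$, $\theta_{0,1}=\theta(i_0)\coprod\theta(i_1)$, and let $Q=Q_0(\coprod_{i=1}^t\theta(i))$. Then: (a) if $\mathcal F(\theta)$ satisfies the 3-finitistic property, then $$\mathrm{pfd}\,\mathcal F(\theta)\le s+4+\varepsilon_0+\Psi\bigl(\Omega^{s+\varepsilon_0+3}(\theta_{1,2}\coprod Q)\coprod\Omega^{s+\varepsilon_0+4}\theta_{0,1}\bigr);$$ (b) if $\mathcal F(\theta)$ satisfies the 3-cardinal property, then $$\mathrm{pfd}\,\mathcal F(\theta)\le s+2+\max\Bigl(\Psi\bigl(\Omega^{s+1}\theta(i_2)\coprod\Omega^{s+2}Q\bigr),\ \Psi\bigl(\Omega^{s+1}(\theta_{1,2}\coprod Q)\coprod\Omega^{s+2}\theta_{0,1}\bigr)\Bigr).$$ In particular, in both cases $\mathrm{pfd}\,\mathcal F(\theta)$ is finite. -/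

import Mathlib

universe v u

namespace StratSys

section Dimensions

variable (R : Type u) [Ring R]

/-- The projective dimension of a module, with values in `ℕ∞`. Mathlib's `projectiveDimension`
takes the value `⊥` exactly at zero modules, for which the convention here is `pd 0 = 0`. -/
noncomputable def pd (M : Type u) [AddCommGroup M] [Module R M] : ℕ∞ :=
  (CategoryTheory.projectiveDimension (ModuleCat.of R M)).unbotD 0

/-- The projective finitistic dimension of a class of finitely generated modules:
`sup {pd C : C ∈ 𝒞, pd C < ∞}`. -/
noncomputable def pfd (𝒞 : Set (FGModuleCat.{u} R)) : ℕ∞ :=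
  ⨆ M ∈ {M : FGModuleCat.{u} R | M ∈ 𝒞 ∧ pd R M < ⊤}, pd R M

/-- A nonzero module that is not the direct sum of two nonzero submodules. -/
def IsIndecomposable (M : Type u) [AddCommGroup M] [Module R M] : Prop :=
  Nontrivial M ∧ ∀ A B : Submodule R M, IsCompl A B → A = ⊥ ∨ B = ⊥

variable {R}

/-- `X` is (isomorphic to) a direct summand of `M`. -/
def IsSummand (X M : FGModuleCat.{u} R) : Prop :=
  ∃ Y : FGModuleCat.{u} R, Nonempty (M ≃ₗ[R] X × Y)

/-- The direct sum of two finitely generated modules. -/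
abbrev dsum (M N : FGModuleCat.{u} R) : FGModuleCat.{u} R := FGModuleCat.of R (M × N)

end Dimensions

/-! ### Projective covers -/

section Covers

variable {R : Type u} [Ring R]

/-- `f : P → M` is a projective cover: `P` is projective, `f` is surjective and `ker f` is a
superfluous submodule of `P`. -/
structure IsProjCover {P M : Type u} [AddCommGroup P] [Module R P] [AddCommGroup M] [Module R M]
    (f : P →ₗ[R] M) : Prop where
  projective : Module.Projective R P
  surjective : Function.Surjective f
  superfluous : ∀ N : Submodule R P, N ⊔ LinearMap.ker f = ⊤ → N = ⊤

theorem exists_projCover [IsArtinianRing R] (M : FGModuleCat.{u} R) :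
    ∃ (P : FGModuleCat.{u} R) (f : P →ₗ[R] M), IsProjCover f := by
  obtain ⟨n, f₀, hf₀⟩ := Module.Finite.exists_fin' R M
  let S : Set (Submodule R (Fin n → R)) :=
    {N | Module.Projective R N ∧ Function.Surjective (f₀.domRestrict N)}
  have hS : S.Nonempty := by
    refine ⟨⊤, ?_, ?_⟩
    · exact Module.Projective.of_equiv (Submodule.topEquiv (R := R) (M := Fin n → R)).symm
    · intro m
      obtain ⟨x, hx⟩ := hf₀ m
      exact ⟨⟨x, trivial⟩, hx⟩
  obtain ⟨N, ⟨hNp, hNs⟩, hmin⟩ := WellFounded.has_min (wellFounded_lt (α := Submodule R (Fin n → R))) S hS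
  refine ⟨FGModuleCat.of R N, f₀.domRestrict N, hNp, hNs, ?_⟩
  intro L hL
  by_contra hne
  set f : N →ₗ[R] M := f₀.domRestrict N with hf
  have hLs : Function.Surjective (f ∘ₗ L.subtype) := by
    intro m
    obtain ⟨x, rfl⟩ := hNs m
    have hx : x ∈ L ⊔ LinearMap.ker f := by rw [hL]; trivial
    obtain ⟨a, ha, b, hb, rfl⟩ := Submodule.mem_sup.1 hx
    refine ⟨⟨a, ha⟩, ?_⟩
    have : f b = 0 := hb
    simp [this]
  obtain ⟨g, hg⟩ := Module.projective_lifting_property (f ∘ₗ L.subtype) f hLs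
  let e : Module.End R N := L.subtype ∘ₗ g
  have hfe : f ∘ₗ e = f := hg
  have hpow : ∀ k : ℕ, f ∘ₗ (e ^ k) = f := by
    intro k
    induction k with
    | zero => rfl
    | succ k ih =>
      rw [pow_succ']
      change (f ∘ₗ e) ∘ₗ (e ^ k) = f
      rw [hfe, ih]
  obtain ⟨k, hk⟩ := Filter.eventually_atTop.1 (LinearMap.eventually_isCompl_ker_pow_range_pow e)
  have hc := hk (k + 1) (Nat.le_succ k)
  set I := LinearMap.range (e ^ (k + 1)) with hI
  have hIL : I ≤ L := by
    rintro _ ⟨x, rfl⟩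
    rw [pow_succ']
    exact (g ((e ^ k) x)).2
  have hIp : Module.Projective R I :=
    Module.Projective.of_split I.subtype (I.projectionOnto _ hc.symm)
      (by ext x; simp)
  have hmem : I.map N.subtype ∈ S := by
    refine ⟨?_, ?_⟩
    · exact Module.Projective.of_equiv
        (Submodule.equivMapOfInjective N.subtype N.injective_subtype I)
    · intro m
      obtain ⟨x, hx⟩ := hNs m
      refine ⟨⟨N.subtype ((e ^ (k + 1)) x), ⟨_, ⟨x, rfl⟩, rfl⟩⟩, ?_⟩
      change (f ∘ₗ (e ^ (k + 1))) x = m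
      rw [hpow]; exact hx
  refine hmin _ hmem (lt_of_le_of_ne (Submodule.map_subtype_le _ _) fun h => hne ?_)
  rw [eq_top_iff]
  intro x _
  have hx : (x : Fin n → R) ∈ I.map N.subtype := by rw [h]; exact x.2
  obtain ⟨y, hy, hyx⟩ := hx
  have : y = x := Subtype.ext hyx
  exact this ▸ hIL hy

theorem IsProjCover.ker_equiv {P P' M M' : Type u} [AddCommGroup P] [Module R P]
    [AddCommGroup P'] [Module R P'] [AddCommGroup M] [Module R M] [AddCommGroup M'] [Module R M']
    {f : P →ₗ[R] M} {f' : P' →ₗ[R] M'} (hf : IsProjCover f) (hf' : IsProjCover f')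
    (e : M ≃ₗ[R] M') : Nonempty (LinearMap.ker f ≃ₗ[R] LinearMap.ker f') := by
  have := hf.projective
  have := hf'.projective
  obtain ⟨g, hg⟩ := Module.projective_lifting_property f' (e.toLinearMap ∘ₗ f) hf'.surjective
  have hgx : ∀ x, f' (g x) = e (f x) := fun x => LinearMap.congr_fun hg x
  have hsurj : Function.Surjective g := by
    rw [← LinearMap.range_eq_top]
    apply hf'.superfluous
    rw [eq_top_iff]
    intro y _
    obtain ⟨x, hx⟩ := hf.surjective (e.symm (f' y))
    refine Submodule.mem_sup.2 ⟨g x, ⟨x, rfl⟩, y - g x, ?_, by abel⟩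
    simp [hgx, hx]
  obtain ⟨h, hh⟩ := Module.projective_lifting_property g LinearMap.id hsurj
  have hhx : ∀ y, g (h y) = y := fun y => LinearMap.congr_fun hh y
  have hr : LinearMap.range h = ⊤ := by
    apply hf.superfluous
    rw [eq_top_iff]
    intro x _
    refine Submodule.mem_sup.2 ⟨h (g x), ⟨g x, rfl⟩, x - h (g x), ?_, by abel⟩
    have : e (f (x - h (g x))) = 0 := by rw [← hgx, map_sub, hhx, sub_self, map_zero]
    exact (map_eq_zero_iff e e.injective).1 this
  have hinj : Function.Injective g := by
    intro a b hab
    obtain ⟨a', rfl⟩ := LinearMap.range_eq_top.1 hr a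
    obtain ⟨b', rfl⟩ := LinearMap.range_eq_top.1 hr b
    rw [hhx, hhx] at hab
    rw [hab]
  let E : P ≃ₗ[R] P' := LinearEquiv.ofBijective g ⟨hinj, hsurj⟩
  have hmap : (LinearMap.ker f).map (E : P →ₗ[R] P') = LinearMap.ker f' := by
    ext y
    constructor
    · rintro ⟨x, hx, rfl⟩
      have hx' : f x = 0 := hx
      change f' (g x) = 0
      rw [hgx, hx', map_zero]
    · intro hy
      obtain ⟨x, rfl⟩ := hsurj y
      refine ⟨x, ?_, rfl⟩
      have hy' : f' (g x) = 0 := hy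
      rw [hgx] at hy'
      simpa using hy'
  exact ⟨E.ofSubmodules _ _ hmap⟩

theorem IsProjCover.prodMap {P P' M M' : Type u} [AddCommGroup P] [Module R P]
    [AddCommGroup P'] [Module R P'] [AddCommGroup M] [Module R M] [AddCommGroup M'] [Module R M']
    {f : P →ₗ[R] M} {f' : P' →ₗ[R] M'} (hf : IsProjCover f) (hf' : IsProjCover f') :
    IsProjCover (f.prodMap f') := by
  have := hf.projective
  have := hf'.projective
  refine ⟨inferInstance, ?_, ?_⟩
  · exact Function.Surjective.prodMap hf.surjective hf'.surjective
  · intro N hN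
    have key : ∀ x y, f x = 0 → f' y = 0 → ∀ p q, ∃ n ∈ N, ∃ a b, f a = 0 ∧ f' b = 0 ∧
        (p, q) = n + (a, b) := by
      intro _ _ _ _ p q
      have hpq : (p, q) ∈ N ⊔ LinearMap.ker (f.prodMap f') := by rw [hN]; trivial
      obtain ⟨n, hn, ⟨a, b⟩, hab, h⟩ := Submodule.mem_sup.1 hpq
      have hab' : (f a, f' b) = (0, 0) := hab
      exact ⟨n, hn, a, b, congrArg Prod.fst hab', congrArg Prod.snd hab', h.symm⟩
    have key := key 0 0 (map_zero f) (map_zero f')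
    let N₁ : Submodule R (P × P') := N ⊔ (LinearMap.ker f').map (LinearMap.inr R P P')
    have h₁ : N₁.comap (LinearMap.inl R P P') = ⊤ := by
      apply hf.superfluous
      rw [eq_top_iff]
      intro p _
      obtain ⟨n, hn, a, b, ha, hb, h⟩ := key p 0
      refine Submodule.mem_sup.2 ⟨p - a, ?_, a, ha, by abel⟩
      refine Submodule.mem_sup.2 ⟨n, hn, (0, b), ⟨b, hb, rfl⟩, ?_⟩
      have : n = (p, 0) - (a, b) := by rw [h]; abel
      rw [this]
      simp
    have h₁' : ∀ p, (p, (0 : P')) ∈ N₁ := by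
      intro p
      have : p ∈ N₁.comap (LinearMap.inl R P P') := by rw [h₁]; trivial
      exact this
    have h₂ : N.comap (LinearMap.inr R P P') = ⊤ := by
      apply hf'.superfluous
      rw [eq_top_iff]
      intro q _
      obtain ⟨n, hn, a, b, ha, hb, h⟩ := key 0 q
      obtain ⟨n', hn', _, ⟨c, hc, rfl⟩, h'⟩ := Submodule.mem_sup.1 (h₁' a)
      refine Submodule.mem_sup.2 ⟨q - (b + c), ?_, b + c, add_mem hb hc, by abel⟩
      have e : (0, q - (b + c)) = n + n' := by
        have h1 : n = (0, q) - (a, b) := by rw [h]; abel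
        have h2 : n' = (a, 0) - LinearMap.inr R P P' c := by rw [← h']; abel
        rw [h1, h2]
        ext <;> simp
        abel
      change (0, q - (b + c)) ∈ N
      rw [e]
      exact add_mem hn hn'
    have h₂' : ∀ q, ((0 : P), q) ∈ N := by
      intro q
      have : q ∈ N.comap (LinearMap.inr R P P') := by rw [h₂]; trivial
      exact this
    rw [eq_top_iff]
    rintro ⟨p, q⟩ _
    obtain ⟨n, hn, _, ⟨c, -, rfl⟩, h⟩ := Submodule.mem_sup.1 (h₁' p)
    have e : (p, q) = n + (0, c) + (0, q) := by
      have : n = (p, 0) - LinearMap.inr R P P' c := by rw [← h]; abel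
      rw [this]
      ext <;> simp
    rw [e]
    exact add_mem (add_mem hn (h₂' c)) (h₂' q)

theorem ker_prodMap_equiv {P P' M M' : Type u} [AddCommGroup P] [Module R P]
    [AddCommGroup P'] [Module R P'] [AddCommGroup M] [Module R M] [AddCommGroup M'] [Module R M']
    (f : P →ₗ[R] M) (f' : P' →ₗ[R] M') :
    Nonempty (LinearMap.ker (f.prodMap f') ≃ₗ[R] LinearMap.ker f × LinearMap.ker f') :=
  ⟨{ toFun := fun x => (⟨x.1.1, congrArg Prod.fst x.2⟩, ⟨x.1.2, congrArg Prod.snd x.2⟩)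
     invFun := fun y => ⟨(y.1.1, y.2.1), Prod.ext y.1.2 y.2.2⟩
     map_add' := fun _ _ => rfl
     map_smul' := fun _ _ => rfl
     left_inv := fun _ => rfl
     right_inv := fun _ => rfl }⟩

theorem IsProjCover.id {P : Type u} [AddCommGroup P] [Module R P] [Module.Projective R P] :
    IsProjCover (LinearMap.id : P →ₗ[R] P) :=
  ⟨inferInstance, Function.surjective_id, fun N h => by simpa using h⟩

end Covers

/-! ### Syzygies, the group `𝒦` and the Igusa–Todorov function -/

section KGroup

variable {R : Type u} [Ring R]

/-- The defining relations of `𝒦`: `[C] = [A] + [B]` if `C ≃ A ⨿ B`, and `[P] = 0` if `P` is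
projective. -/
def kRel (R : Type u) [Ring R] : Set (FreeAbelianGroup (FGModuleCat.{u} R)) :=
  {x | ∃ A B C : FGModuleCat.{u} R, Nonempty (C ≃ₗ[R] A × B) ∧
    x = FreeAbelianGroup.of C - (FreeAbelianGroup.of A + FreeAbelianGroup.of B)} ∪
  {x | ∃ P : FGModuleCat.{u} R, Module.Projective R P ∧ x = FreeAbelianGroup.of P}

/-- The group `𝒦`: the free abelian group on the finitely generated modules modulo `kRel`. -/
abbrev K (R : Type u) [Ring R] : Type (u + 1) :=
  FreeAbelianGroup (FGModuleCat.{u} R) ⧸ AddSubgroup.closure (kRel R)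

/-- The class `[M]` in `𝒦`. -/
def kClass (M : FGModuleCat.{u} R) : K R :=
  QuotientAddGroup.mk (FreeAbelianGroup.of M)

theorem kClass_of_equiv_prod {A B C : FGModuleCat.{u} R} (e : C ≃ₗ[R] A × B) :
    kClass C = kClass A + kClass B := by
  have h : (FreeAbelianGroup.of C - (FreeAbelianGroup.of A + FreeAbelianGroup.of B)) ∈
      AddSubgroup.closure (kRel R) :=
    AddSubgroup.subset_closure (Or.inl ⟨A, B, C, ⟨e⟩, rfl⟩)
  have h' := (QuotientAddGroup.eq_zero_iff _).2 h
  rw [QuotientAddGroup.mk_sub, QuotientAddGroup.mk_add, sub_eq_zero] at h'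
  exact h'

theorem kClass_of_projective (P : FGModuleCat.{u} R) (hP : Module.Projective R P) :
    kClass P = 0 :=
  (QuotientAddGroup.eq_zero_iff _).2 (AddSubgroup.subset_closure (Or.inr ⟨P, hP, rfl⟩))

end KGroup

section IgusaTodorov

variable {R : Type u} [Ring R] [IsArtinianRing R]

/-- The source of a chosen projective cover of `M`. -/
noncomputable def coverObj (M : FGModuleCat.{u} R) : FGModuleCat.{u} R :=
  (exists_projCover M).choose

/-- A chosen projective cover of `M`. -/
noncomputable def coverMap (M : FGModuleCat.{u} R) : coverObj M →ₗ[R] M :=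
  (exists_projCover M).choose_spec.choose

theorem isProjCover_coverMap (M : FGModuleCat.{u} R) : IsProjCover (coverMap M) :=
  (exists_projCover M).choose_spec.choose_spec

/-- The first syzygy `Ω M`: the kernel of the projective cover of `M`. -/
noncomputable def syz (M : FGModuleCat.{u} R) : FGModuleCat.{u} R :=
  FGModuleCat.of R (LinearMap.ker (coverMap M))

/-- The `n`-th syzygy `Ωⁿ M`, with `Ω⁰ M = M`. -/
noncomputable def Syz (n : ℕ) (M : FGModuleCat.{u} R) : FGModuleCat.{u} R := syz^[n] M

/-- The endomorphism of `𝒦` induced by the syzygy: `[M] ↦ [Ω M]`. -/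
noncomputable def kSyz : K R →+ K R :=
  QuotientAddGroup.lift (AddSubgroup.closure (kRel R))
    (FreeAbelianGroup.lift fun M => kClass (syz M)) (by
      rw [AddSubgroup.closure_le]
      rintro x (⟨A, B, C, ⟨e⟩, rfl⟩ | ⟨P, hP, rfl⟩)
      · have h := (isProjCover_coverMap C).ker_equiv
          ((isProjCover_coverMap A).prodMap (isProjCover_coverMap B)) e
        obtain ⟨e₁⟩ := h
        obtain ⟨e₂⟩ := ker_prodMap_equiv (coverMap A) (coverMap B)
        have h2 : kClass (syz C) = kClass (syz A) + kClass (syz B) :=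
          kClass_of_equiv_prod (e₁.trans e₂)
        simp [h2]
      · obtain ⟨e₁⟩ := (isProjCover_coverMap P).ker_equiv IsProjCover.id (LinearEquiv.refl R P)
        have h2 : kClass (syz P) = 0 := by
          have hsub : Subsingleton (LinearMap.ker (LinearMap.id : P →ₗ[R] P)) := by
            rw [LinearMap.ker_id]; infer_instance
          have : Subsingleton (syz P) := e₁.toEquiv.subsingleton
          exact kClass_of_projective _ inferInstance
        simpa using h2)

theorem kSyz_kClass (M : FGModuleCat.{u} R) : kSyz (kClass M) = kClass (syz M) := by
  simp [kSyz, kClass]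

/-- `⟨M⟩`: the subgroup of `𝒦` generated by the indecomposable direct summands of `M`. -/
def span (M : FGModuleCat.{u} R) : AddSubgroup (K R) :=
  AddSubgroup.closure {x | ∃ X : FGModuleCat.{u} R,
    IsIndecomposable R X ∧ IsSummand X M ∧ x = kClass X}

/-- `Ωᵐ⟨M⟩`: the image of `⟨M⟩` under the `m`-th power of the endomorphism `Ω` of `𝒦`. -/
noncomputable def syzSpan (m : ℕ) (M : FGModuleCat.{u} R) : AddSubgroup (K R) :=
  (AddSubgroup.map kSyz)^[m] (span M)

/-- `Φ(M)`: the smallest `n` such that `Ω : Ωᵐ⟨M⟩ → Ωᵐ⁺¹⟨M⟩` is an isomorphism for all `m ≥ n`. -/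
noncomputable def Phi (M : FGModuleCat.{u} R) : ℕ :=
  sInf {n : ℕ | ∀ m ≥ n,
    Set.BijOn kSyz (syzSpan m M : Set (K R)) (syzSpan (m + 1) M : Set (K R))}

/-- The Igusa–Todorov function `Ψ(M) = Φ(M) + pfd 𝒞_M`, where `𝒞_M` is the class of direct summands
of `Ω^Φ(M) M`. (As `𝒞_M` has finitely many members up to isomorphism, `pfd 𝒞_M` is finite.) -/
noncomputable def Psi (M : FGModuleCat.{u} R) : ℕ :=
  Phi M + (pfd R {X | IsSummand X (Syz (Phi M) M)}).toNat

end IgusaTodorov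

/-! ### Filtered modules and stratifying systems -/

section Stratifying

variable {R : Type u} [Ring R] {t : ℕ}

/-- A finite chain `0 = M₀ ≤ M₁ ≤ ⋯ ≤ Mₘ = M` of submodules such that `Mⱼ₊₁ / Mⱼ ≃ θ (idx j)`. -/
structure Filtration (θ : Fin t → FGModuleCat.{u} R) (M : Type u) [AddCommGroup M]
    [Module R M] where
  length : ℕ
  chain : Fin (length + 1) → Submodule R M
  idx : Fin length → Fin t
  bot : chain 0 = ⊥
  top : chain (Fin.last length) = ⊤
  le : ∀ j : Fin length, chain j.castSucc ≤ chain j.succ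
  factor : ∀ j : Fin length,
    Nonempty ((chain j.succ ⧸ (chain j.castSucc).submoduleOf (chain j.succ)) ≃ₗ[R] θ (idx j))

/-- The number of factors of a filtration with index `i`. -/
def Filtration.count {θ : Fin t → FGModuleCat.{u} R} {M : Type u} [AddCommGroup M]
    [Module R M] (F : Filtration θ M) (i : Fin t) : ℕ :=
  (Finset.univ.filter fun j => F.idx j = i).card

/-- The class `ℱ(θ)` of `θ`-filtered modules. -/
def filtered (θ : Fin t → FGModuleCat.{u} R) : Set (FGModuleCat.{u} R) :=
  {M | Nonempty (Filtration θ M)}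

open Classical in
/-- The filtration multiplicity `[M : θ(i)]` of a `θ`-filtered module, computed in a chosen
filtration. (For stratifying systems it does not depend on the filtration.) -/
noncomputable def mult (θ : Fin t → FGModuleCat.{u} R) (M : Type u) [AddCommGroup M]
    [Module R M] (i : Fin t) : ℕ :=
  if h : Nonempty (Filtration θ M) then h.some.count i else 0

/-- The `θ`-support `{i : [M : θ(i)] ≠ 0}`. -/
def supp (θ : Fin t → FGModuleCat.{u} R) (M : Type u) [AddCommGroup M] [Module R M] :
    Set (Fin t) :=
  {i | mult θ M i ≠ 0}

/-- Vanishing of `Ext¹_R(X, Y)`. -/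
def ExtOneVanishes (X Y : FGModuleCat.{u} R) : Prop :=
  Subsingleton (CategoryTheory.Abelian.Ext.{u} X.obj Y.obj 1)

/-- Stratifying systems of size `t`, indexed by `Fin t` in place of `[1,t]`. -/
structure IsStratifyingSystem (θ : Fin t → FGModuleCat.{u} R) : Prop where
  indecomposable : ∀ i, IsIndecomposable R (θ i)
  hom_zero : ∀ i j, i < j → ∀ f : θ j →ₗ[R] θ i, f = 0
  ext_zero : ∀ i j, i ≤ j → ExtOneVanishes (θ j) (θ i)

/-- The class `𝒫(θ)` of `θ`-projective modules: `Ext¹(X, -)` vanishes on `ℱ(θ)`. -/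
def thetaProjective (θ : Fin t → FGModuleCat.{u} R) : Set (FGModuleCat.{u} R) :=
  {X | ∀ Y ∈ filtered θ, ExtOneVanishes X Y}

/-- `f : Q → M` is an Ext-projective cover of `M` in `ℱ(θ)`: a morphism of `ℱ(θ)` which is a right
minimal `𝒫(θ)`-approximation of `M` and has kernel in `ℱ(θ)`. -/
structure IsExtProjCover (θ : Fin t → FGModuleCat.{u} R) {Q M : FGModuleCat.{u} R}
    (f : Q →ₗ[R] M) : Prop where
  target_mem : M ∈ filtered θ
  source_mem : Q ∈ filtered θ
  projective : Q ∈ thetaProjective θ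
  approximation : ∀ X ∈ thetaProjective θ, ∀ g : X →ₗ[R] M, ∃ h : X →ₗ[R] Q, f ∘ₗ h = g
  minimal : ∀ h : Q →ₗ[R] Q, f ∘ₗ h = f → Function.Bijective h
  ker_mem : Nonempty (Filtration θ (LinearMap.ker f))

/-- `∞_θ`: the indices `i` with `pd θ(i) = ∞`. -/
def inftySet (θ : Fin t → FGModuleCat.{u} R) : Set (Fin t) :=
  {i | pd R (θ i) = ⊤}

open Classical in
/-- `max {pd θ(j) : j ∉ ∞_θ}`, or `0` if there is no such `j`. -/
noncomputable def finPd (θ : Fin t → FGModuleCat.{u} R) : ℕ :=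
  (Finset.univ.filter fun j => j ∉ inftySet θ).sup fun j => (pd R (θ j)).toNat

/-- The 3-finitistic property of `ℱ(θ)`, for `∞_θ = {i₀, i₁, i₂}` with `i₀ < i₁ < i₂`. -/
def ThreeFinitistic (θ : Fin t → FGModuleCat.{u} R) (i₁ i₂ : Fin t) : Prop :=
  ∀ (M Q : FGModuleCat.{u} R) (ε : Q →ₗ[R] M), IsExtProjCover θ ε →
    i₁ ∈ supp θ (LinearMap.ker ε) → i₂ ∈ supp θ (LinearMap.ker ε) → pd R M < ⊤ →
    pd R (LinearMap.ker ε) < ⊤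

/-- The 3-cardinal property of `ℱ(θ)`, for `∞_θ = {i₀, i₁, i₂}` with `i₀ < i₁ < i₂`. -/
def ThreeCardinal (θ : Fin t → FGModuleCat.{u} R) (i₀ i₁ : Fin t) : Prop :=
  ∀ (M Q : FGModuleCat.{u} R) (ε : Q →ₗ[R] M), IsExtProjCover θ ε →
    supp θ M ∩ inftySet θ = {i₀, i₁} →
    (supp θ (LinearMap.ker ε) ∩ inftySet θ).ncard ≤ 1

end Stratifying

end StratSys

open StratSys

/-! The engine is the Igusa–Todorov inequality `StabSES.pd_le_Psi`: if `0 → A → B → C → 0` is exact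
up to projective summands, `A` and `B` lie in the additive closure of `N` up to projectives, and `pd
C < ∞`, then `pd C ≤ Ψ(N) + 1`. Indeed, high syzygies of `C` are projective, so some power of `Ω`
kills `[A] - [B]` in `𝒦`; since `Ω` is injective on `Ωᵐ⟨N⟩` for `m ≥ Φ(N)`, the power `Ω^Φ(N)`
already does. By Krull–Schmidt cancellation, equality in `𝒦` is stable isomorphism
(`stabEq_of_kClass_eq`), so `Ω^Φ(N)` of the sequence becomes, after adding projectives, a sequence
`X → X ⨿ P → C'`. Fitting's lemma for the component `X → X` replaces `X` by the summand `Z` on which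
that component is nilpotent. Nilpotency forces `pd Z < ∞` (`pd_lt_top_of_nilpotent`), and the `pfd`
term of `Ψ(N)` then bounds `pd Z`.

To apply this, a filtered module must appear in an exact sequence whose other terms have controlled
syzygies. Vanishing of `Ext¹(θ(j), θ(i))` for `j ≥ i` lets the factors of a filtration be sorted,
the small indices forming a quotient and the large ones a submodule (`ListFiltered.split_lt`).
Factors of finite projective dimension become invisible after `s + 1` syzygies, so if `θ(b)` is the
only factor of infinite projective dimension, then `Ωⁿ M` lies in the additive closure of `Ωⁿ θ(b)`
for `n ≥ s + 1`. If two such indices `a < b` occur, sorting gives `A → M → B`, and rotating it to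
`ΩB → A → M` bounds `pd M`.

For three indices, the factors below `i₀` split off as a quotient of projective dimension at most
`s`. The kernel `K` of the Ext-projective cover of a module with indices at least `i₀` only has
indices above `i₀` (`exists_cover`), and every such cover lies in the additive closure of `Q`. In
(a), either `K` has at most one infinite index, or the hypothesis gives `pd K < ∞` and the two-index
bound makes a fixed syzygy of `K` projective; the inequality is applied to `K → Q₀ → M`. In (b),
when `i₀` and `i₁` both occur, `M` is an extension of its part `B` below `i₂` by a submodule `A`;
pulling back along the cover of `B` gives `K → A ⨿ Q₀ → M`, where `K` has at most one infinite
index. Otherwise the two-index bound applies. -/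

namespace StratSys

/-! ### Short exact sequences, `Ext¹` and projective dimension -/

section ShortExactSequences

open CategoryTheory Abelian

/-- `0 → A → B → C → 0` is exact. -/
structure IsSES {R : Type u} [Ring R] {A B C : Type u} [AddCommGroup A] [Module R A]
    [AddCommGroup B] [Module R B] [AddCommGroup C] [Module R C]
    (f : A →ₗ[R] B) (g : B →ₗ[R] C) : Prop where
  inj : Function.Injective f
  exact : Function.Exact f g
  surj : Function.Surjective g

variable {R : Type u} [Ring R]

section Unbundled

variable {A B C : Type u} [AddCommGroup A] [Module R A]
    [AddCommGroup B] [Module R B] [AddCommGroup C] [Module R C]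

theorem IsSES.shortExact {f : A →ₗ[R] B} {g : B →ₗ[R] C} (h : IsSES f g) :
    (ModuleCat.shortComplexOfCompEqZero f g h.exact.linearMap_comp_eq_zero).ShortExact :=
  ModuleCat.shortComplex_shortExact _ h.exact h.inj h.surj

theorem IsSES.apply_apply_eq_zero {f : A →ₗ[R] B} {g : B →ₗ[R] C} (h : IsSES f g) (a : A) :
    g (f a) = 0 := h.exact.apply_apply_eq_zero a

theorem IsSES.of_ker {g : B →ₗ[R] C} (hg : Function.Surjective g) :
    IsSES (LinearMap.ker g).subtype g :=
  ⟨(LinearMap.ker g).injective_subtype, fun x => by simp, hg⟩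

theorem IsSES.mkQ (p : Submodule R B) : IsSES p.subtype p.mkQ :=
  ⟨p.injective_subtype, fun x => by simp, p.mkQ_surjective⟩

theorem IsSES.inl_snd (A B : Type u) [AddCommGroup A] [Module R A] [AddCommGroup B] [Module R B] :
    IsSES (LinearMap.inl R A B) (LinearMap.snd R A B) :=
  ⟨LinearMap.inl_injective, fun x => by
    constructor
    · rintro hx
      exact ⟨x.1, Prod.ext rfl hx.symm⟩
    · rintro ⟨a, rfl⟩; rfl, LinearMap.snd_surjective⟩

theorem IsSES.congr {f : A →ₗ[R] B} {g : B →ₗ[R] C} (h : IsSES f g) {A' B' C' : Type u}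
    [AddCommGroup A'] [Module R A'] [AddCommGroup B'] [Module R B'] [AddCommGroup C'] [Module R C']
    (eA : A' ≃ₗ[R] A) (eB : B ≃ₗ[R] B') (eC : C ≃ₗ[R] C') :
    IsSES (eB.toLinearMap ∘ₗ f ∘ₗ eA.toLinearMap) (eC.toLinearMap ∘ₗ g ∘ₗ eB.symm.toLinearMap) := by
  refine ⟨eB.injective.comp (h.inj.comp eA.injective), fun x => ?_,
    eC.surjective.comp (h.surj.comp eB.symm.surjective)⟩
  constructor
  · intro hx
    have hx' : g (eB.symm x) = 0 := eC.injective (by simpa using hx)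
    obtain ⟨a, ha⟩ := (h.exact _).1 hx'
    exact ⟨eA.symm a, by simp [ha]⟩
  · rintro ⟨a, rfl⟩
    simp [h.apply_apply_eq_zero]

theorem IsSES.prod {f : A →ₗ[R] B} {g : B →ₗ[R] C} (h : IsSES f g) {A' B' C' : Type u}
    [AddCommGroup A'] [Module R A'] [AddCommGroup B'] [Module R B'] [AddCommGroup C'] [Module R C']
    {f' : A' →ₗ[R] B'} {g' : B' →ₗ[R] C'} (h' : IsSES f' g') :
    IsSES (f.prodMap f') (g.prodMap g') := by
  refine ⟨Function.Injective.prodMap h.inj h'.inj, fun x => ?_,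
    Function.Surjective.prodMap h.surj h'.surj⟩
  obtain ⟨x, y⟩ := x
  constructor
  · intro hx
    obtain ⟨a, ha⟩ := (h.exact x).1 (congrArg Prod.fst hx)
    obtain ⟨b, hb⟩ := (h'.exact y).1 (congrArg Prod.snd hx)
    exact ⟨(a, b), by simp [ha, hb]⟩
  · rintro ⟨⟨a, b⟩, h3⟩
    rw [← h3]
    simp [h.apply_apply_eq_zero, h'.apply_apply_eq_zero]

end Unbundled

/-! ### Vanishing of `Ext¹` along short exact sequences -/

section Extensions

variable {A B C X Y : FGModuleCat.{u} R}

/-- In the long exact sequence, `Ext¹(B, Y) = 0` makes every class on `C` a connecting image of some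
map `A → Y`. A map that extends to `B` has zero connecting image. -/
theorem IsSES.extOneVanishes_right {f : A →ₗ[R] B} {g : B →ₗ[R] C} (h : IsSES f g)
    (hB : ExtOneVanishes B Y) (hA : ∀ a : A →ₗ[R] Y, ∃ b : B →ₗ[R] Y, b ∘ₗ f = a) :
    ExtOneVanishes C Y := by
  suffices H : ∀ x : Ext.{u} (ModuleCat.of R C) (ModuleCat.of R Y) 1, x = 0 from
    ⟨fun x y => (H x).trans (H y).symm⟩
  intro x
  obtain ⟨y, rfl⟩ := Ext.contravariant_sequence_exact₃ h.shortExact (ModuleCat.of R Y) x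
    (@Subsingleton.elim _ hB _ _) (n₀ := 0) rfl
  obtain ⟨a, rfl⟩ := Ext.homEquiv₀.symm.surjective y
  obtain ⟨b, hb⟩ := hA a.hom
  have h2 : a = ModuleCat.ofHom f ≫ ModuleCat.ofHom b := by
    ext1
    exact hb.symm
  subst h2
  rw [Ext.homEquiv₀_symm_apply, ← Ext.mk₀_comp_mk₀]
  exact h.shortExact.extClass_comp_assoc _

theorem IsSES.extOneVanishes_middle {f : A →ₗ[R] B} {g : B →ₗ[R] C} (h : IsSES f g)
    (hA : ExtOneVanishes A Y) (hC : ExtOneVanishes C Y) : ExtOneVanishes B Y := by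
  suffices H : ∀ x : Ext.{u} (ModuleCat.of R B) (ModuleCat.of R Y) 1, x = 0 from
    ⟨fun x y => (H x).trans (H y).symm⟩
  intro x
  obtain ⟨y, rfl⟩ := Ext.contravariant_sequence_exact₂ h.shortExact (Y := ModuleCat.of R Y) x
    (@Subsingleton.elim _ hA _ _)
  rw [show y = 0 from @Subsingleton.elim _ hC _ _, Ext.comp_zero]

theorem IsSES.extOneVanishes_covariant {f : A →ₗ[R] B} {g : B →ₗ[R] C} (h : IsSES f g)
    (hA : ExtOneVanishes X A) (hC : ExtOneVanishes X C) : ExtOneVanishes X B := by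
  suffices H : ∀ x : Ext.{u} (ModuleCat.of R X) (ModuleCat.of R B) 1, x = 0 from
    ⟨fun x y => (H x).trans (H y).symm⟩
  intro x
  obtain ⟨y, rfl⟩ := Ext.covariant_sequence_exact₂ (ModuleCat.of R X) h.shortExact x
    (@Subsingleton.elim _ hC _ _)
  rw [show y = 0 from @Subsingleton.elim _ hA _ _, Ext.zero_comp]

/-- The obstruction to lifting `c` is its connecting image in `Ext¹(X, A)`. -/
theorem IsSES.lift {f : A →ₗ[R] B} {g : B →ₗ[R] C} (h : IsSES f g) (hX : ExtOneVanishes X A)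
    (c : X →ₗ[R] C) : ∃ b : X →ₗ[R] B, g ∘ₗ b = c := by
  let x : Ext.{u} (ModuleCat.of R X) (ModuleCat.of R C) 0 := Ext.mk₀ (ModuleCat.ofHom c)
  obtain ⟨y, hy⟩ := Ext.covariant_sequence_exact₃ (ModuleCat.of R X) h.shortExact x
    (n₁ := 1) rfl (@Subsingleton.elim _ hX _ _)
  obtain ⟨b, rfl⟩ := Ext.homEquiv₀.symm.surjective y
  refine ⟨b.hom, ?_⟩
  have h2 : b ≫ ModuleCat.ofHom g = ModuleCat.ofHom c :=
    Ext.homEquiv₀.symm.injective (by simpa using hy)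
  exact congrArg ModuleCat.Hom.hom h2

theorem ExtOneVanishes.of_projective (hX : Module.Projective R X) : ExtOneVanishes X Y := by
  have : Projective (ModuleCat.of R X) := (IsProjective.iff_projective (R := R) X).1 hX
  exact ⟨fun x y => (Ext.eq_zero_of_projective x).trans (Ext.eq_zero_of_projective y).symm⟩

theorem ExtOneVanishes.of_retract (i : X →ₗ[R] A) (p : A →ₗ[R] X) (hp : p ∘ₗ i = LinearMap.id)
    (hA : ExtOneVanishes A Y) : ExtOneVanishes X Y := by
  suffices H : ∀ x : Ext.{u} (ModuleCat.of R X) (ModuleCat.of R Y) 1, x = 0 from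
    ⟨fun x y => (H x).trans (H y).symm⟩
  intro x
  have h1 : ModuleCat.ofHom i ≫ ModuleCat.ofHom p = 𝟙 (ModuleCat.of R X) := by
    ext1; exact hp
  rw [← Ext.mk₀_id_comp x, ← h1, ← Ext.mk₀_comp_mk₀, Ext.comp_assoc_of_second_deg_zero,
    show (Ext.mk₀ (ModuleCat.ofHom p)).comp x (zero_add 1) = 0 from @Subsingleton.elim _ hA _ _,
    Ext.comp_zero]

theorem ExtOneVanishes.of_subsingleton [Subsingleton Y] : ExtOneVanishes X Y := by
  suffices H : ∀ x : Ext.{u} (ModuleCat.of R X) (ModuleCat.of R Y) 1, x = 0 from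
    ⟨fun x y => (H x).trans (H y).symm⟩
  intro x
  have h1 : 𝟙 (ModuleCat.of R Y) = 0 := by
    ext y; exact Subsingleton.elim (α := Y) _ _
  rw [← Ext.comp_mk₀_id x, h1, Ext.mk₀_zero, Ext.comp_zero]

end Extensions

/-! ### Projective dimension along short exact sequences -/

section ProjectiveDimension

variable {A B C : Type u} [AddCommGroup A] [Module R A]
    [AddCommGroup B] [Module R B] [AddCommGroup C] [Module R C]

theorem pd_le_iff {n : ℕ} : pd R A ≤ n ↔ HasProjectiveDimensionLE (ModuleCat.of R A) n := by
  rw [← projectiveDimension_le_iff, pd]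
  generalize projectiveDimension (ModuleCat.of R A) = d
  induction d with
  | bot => simp
  | coe d =>
    rw [WithBot.unbotD_coe]
    exact WithBot.coe_le_coe.symm

theorem pd_lt_top_iff : pd R A < ⊤ ↔ ∃ n : ℕ, pd R A ≤ n := by
  constructor
  · intro h
    obtain ⟨n, hn⟩ := ENat.ne_top_iff_exists.1 h.ne
    exact ⟨n, hn.ge⟩
  · rintro ⟨n, hn⟩
    exact hn.trans_lt (ENat.natCast_lt_top n)

theorem pd_le_zero_iff : pd R A ≤ (0 : ℕ) ↔ Module.Projective R A := by
  rw [pd_le_iff, ← projective_iff_hasProjectiveDimensionLE_zero]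
  exact (IsProjective.iff_projective (R := R) A).symm

theorem pd_le_of_retract (i : A →ₗ[R] B) (p : B →ₗ[R] A) (hp : p ∘ₗ i = LinearMap.id) {n : ℕ}
    (hB : pd R B ≤ n) : pd R A ≤ n := by
  rw [pd_le_iff] at *
  let r : Retract (ModuleCat.of R A) (ModuleCat.of R B) :=
    ⟨ModuleCat.ofHom i, ModuleCat.ofHom p, by ext1; exact hp⟩
  exact r.hasProjectiveDimensionLT _

theorem pd_le_of_equiv (e : A ≃ₗ[R] B) {n : ℕ} (hB : pd R B ≤ n) : pd R A ≤ n :=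
  pd_le_of_retract e.toLinearMap e.symm.toLinearMap (by ext; simp) hB

theorem IsSES.pd_middle_le {f : A →ₗ[R] B} {g : B →ₗ[R] C} (h : IsSES f g) {n : ℕ}
    (hA : pd R A ≤ n) (hC : pd R C ≤ n) : pd R B ≤ n := by
  rw [pd_le_iff] at *
  exact h.shortExact.hasProjectiveDimensionLT_X₂ _ hA hC

theorem IsSES.pd_right_le {f : A →ₗ[R] B} {g : B →ₗ[R] C} (h : IsSES f g) {n : ℕ}
    (hA : pd R A ≤ n) (hB : pd R B ≤ (n + 1 : ℕ)) : pd R C ≤ (n + 1 : ℕ) := by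
  rw [pd_le_iff] at *
  exact h.shortExact.hasProjectiveDimensionLT_X₃ _ hA hB

theorem IsSES.pd_left_le {f : A →ₗ[R] B} {g : B →ₗ[R] C} (h : IsSES f g) {n : ℕ}
    (hB : pd R B ≤ n) (hC : pd R C ≤ (n + 1 : ℕ)) : pd R A ≤ n := by
  rw [pd_le_iff] at *
  exact h.shortExact.hasProjectiveDimensionLT_X₁ _ hB hC

theorem pd_prod_le {n : ℕ} (hA : pd R A ≤ n) (hB : pd R B ≤ n) : pd R (A × B) ≤ n :=
  (IsSES.inl_snd A B).pd_middle_le hA hB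

theorem IsSES.pd_le_iff_of_projective {f : A →ₗ[R] B} {g : B →ₗ[R] C} (h : IsSES f g)
    (hB : Module.Projective R B) {n : ℕ} : pd R A ≤ n ↔ pd R C ≤ (n + 1 : ℕ) := by
  have hB' := pd_le_zero_iff.2 hB
  have hn (m : ℕ) : pd R B ≤ m := hB'.trans (by simp)
  exact ⟨fun hA => h.pd_right_le hA (hn _), fun hC => h.pd_left_le (hn _) hC⟩

theorem pd_le_of_le {n m : ℕ} (h : pd R A ≤ n) (hnm : n ≤ m) : pd R A ≤ m :=
  h.trans (by exact_mod_cast hnm)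

/-- A module `Z` with an injection `(h, g) : Z → Z × P` with `h` nilpotent, `P` projective and
cokernel of finite projective dimension has finite projective dimension. -/
theorem pd_lt_top_of_nilpotent {f : A →ₗ[R] A × B} {g : A × B →ₗ[R] C} (h : IsSES f g)
    (hB : Module.Projective R B) (hC : pd R C < ⊤)
    (hf : IsNilpotent (LinearMap.fst R A B ∘ₗ f : Module.End R A)) : pd R A < ⊤ := by
  obtain ⟨n, hn⟩ := pd_lt_top_iff.1 hC
  rw [pd_le_iff] at hn
  refine pd_lt_top_iff.2 ⟨n, ?_⟩
  rw [pd_le_iff]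
  have hBp : Projective (ModuleCat.of R B) := (IsProjective.iff_projective (R := R) B).1 hB
  refine HasProjectiveDimensionLT.mk.{u} ?_
  intro i hi Y e
  set φ : Module.End R A := LinearMap.fst R A B ∘ₗ f with hφ
  -- Here `i > n`. Since `Ext^(i+1)(C, Y) = 0`, every class on `A` is a pullback along `f`; the
  -- `B`-component contributes nothing because `B` is projective and `i > 0`. So pullback along `φ`
  -- is surjective on `Extⁱ(A, Y)`.
  have key : ∀ e : Ext.{u} (ModuleCat.of R A) Y i,
      ∃ e' : Ext.{u} (ModuleCat.of R A) Y i,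
        (Ext.mk₀ (ModuleCat.ofHom φ)).comp e' (zero_add i) = e := by
    intro e
    obtain ⟨y, hy⟩ := Ext.contravariant_sequence_exact₁ h.shortExact Y e
      (n₁ := 1 + i) rfl
      (Ext.eq_zero_of_hasProjectiveDimensionLT _ (n + 1) (by omega))
    refine ⟨(Ext.mk₀ (ModuleCat.ofHom (LinearMap.inl R A B))).comp y (zero_add i), ?_⟩
    rw [← hy]
    have h0 : (Ext.mk₀ (ModuleCat.ofHom (LinearMap.inr R A B))).comp y (zero_add i) = 0 :=
      Ext.eq_zero_of_hasProjectiveDimensionLT _ 1 (by omega)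
    have h1 : ModuleCat.ofHom f = ModuleCat.ofHom φ ≫ ModuleCat.ofHom (LinearMap.inl R A B) +
        ModuleCat.ofHom (LinearMap.snd R A B ∘ₗ f) ≫ ModuleCat.ofHom (LinearMap.inr R A B) := by
      ext x
      · simp [φ]
      · simp [φ]
    change _ = (Ext.mk₀ (ModuleCat.ofHom f)).comp y _
    rw [h1, Ext.mk₀_add, Ext.add_comp, ← Ext.mk₀_comp_mk₀_assoc, ← Ext.mk₀_comp_mk₀_assoc, h0,
      Ext.comp_zero, add_zero]
  obtain ⟨N, hN⟩ := hf
  -- Iterating, every class is a pullback along each power of `φ`, in particular along a power that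
  -- vanishes.
  have key2 : ∀ k : ℕ, ∃ e' : Ext.{u} (ModuleCat.of R A) Y i,
      (Ext.mk₀ (ModuleCat.ofHom (φ ^ k))).comp e' (zero_add i) = e := by
    intro k
    induction k with
    | zero => exact ⟨e, Ext.mk₀_id_comp e⟩
    | succ k ih =>
      obtain ⟨e', he'⟩ := ih
      obtain ⟨e'', rfl⟩ := key e'
      refine ⟨e'', ?_⟩
      rw [Ext.mk₀_comp_mk₀_assoc] at he'
      rw [← he', pow_succ']
      rfl
  obtain ⟨e', rfl⟩ := key2 N
  rw [hN]
  change (Ext.mk₀ 0).comp e' _ = 0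
  rw [Ext.mk₀_zero, Ext.zero_comp]

end ProjectiveDimension

end ShortExactSequences

/-! ### Indecomposable modules, exchange and cancellation -/

section KrullSchmidt

section Unbundled

variable {R : Type u} [Ring R] {M : Type u} [AddCommGroup M] [Module R M]

theorem IsIndecomposable.of_equiv {N : Type u} [AddCommGroup N] [Module R N]
    (h : IsIndecomposable R M) (e : M ≃ₗ[R] N) : IsIndecomposable R N := by
  have := h.1
  refine ⟨e.symm.toEquiv.nontrivial, fun A B hAB => ?_⟩
  have h1 : IsCompl (A.map (e.symm : N →ₗ[R] M)) (B.map (e.symm : N →ₗ[R] M)) :=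
    hAB.map (Submodule.orderIsoMapComap e.symm)
  refine (h.2 _ _ h1).imp (fun h => ?_) (fun h => ?_)
  · exact (Submodule.map_eq_bot_iff (e := e.symm)).1 h
  · exact (Submodule.map_eq_bot_iff (e := e.symm)).1 h

theorem isUnit_left_of_isUnit_mul [IsNoetherian R M] {f g : Module.End R M} (h : IsUnit (f * g)) :
    IsUnit f := by
  rw [Module.End.isUnit_iff] at *
  exact IsNoetherian.bijective_of_surjective_endomorphism _
    (Function.Surjective.of_comp (f := f) (g := g) h.2)

theorem isUnit_right_of_isUnit_mul [IsArtinian R M] {f g : Module.End R M} (h : IsUnit (f * g)) :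
    IsUnit g := by
  rw [Module.End.isUnit_iff] at *
  exact IsArtinian.bijective_of_injective_endomorphism _
    (Function.Injective.of_comp (f := f) (g := g) h.1)

variable [IsArtinian R M] [IsNoetherian R M]

/-- Fitting's lemma: kernel and range of a high power of `f` are complementary, so one of them is
zero. -/
theorem IsIndecomposable.isUnit_or_isNilpotent (h : IsIndecomposable R M) (f : Module.End R M) :
    IsUnit f ∨ IsNilpotent f := by
  obtain ⟨n, hn⟩ := Filter.eventually_atTop.1 (LinearMap.eventually_isCompl_ker_pow_range_pow f)
  have hc := hn (n + 1) n.le_succ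
  rcases h.2 _ _ hc with h0 | h0
  · left
    rw [← isUnit_pow_iff n.succ_ne_zero, Module.End.isUnit_iff]
    exact IsArtinian.bijective_of_injective_endomorphism _ (LinearMap.ker_eq_bot.1 h0)
  · right
    exact ⟨n + 1, LinearMap.range_eq_bot.1 h0⟩

theorem IsIndecomposable.isLocalRing (h : IsIndecomposable R M) : IsLocalRing (Module.End R M) := by
  have := h.1
  refine IsLocalRing.of_isUnit_or_isUnit_one_sub_self fun a => ?_
  exact (h.isUnit_or_isNilpotent a).imp_right fun h => h.isUnit_one_sub

end Unbundled

/-! ### Cancelling a common direct summand -/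

section Cancellation

variable {R : Type u} [Ring R] {A B D : Type u} [AddCommGroup A] [Module R A]
  [AddCommGroup B] [Module R B] [AddCommGroup D] [Module R D]

/-- Gaussian elimination: when the corner `u : D → D` is invertible, the graph of `a ↦ -u⁻¹(φ(a,
0)).2` is a copy of `A` that `φ` carries isomorphically onto `B × 0`. -/
theorem cancel_of_bijective (φ : (A × D) ≃ₗ[R] (B × D))
    (hu : Function.Bijective (LinearMap.snd R B D ∘ₗ φ.toLinearMap ∘ₗ LinearMap.inr R A D)) :
    Nonempty (A ≃ₗ[R] B) := by
  let u : D ≃ₗ[R] D := LinearEquiv.ofBijective _ hu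
  have hux : ∀ x, u x = (φ (0, x)).2 := fun x => rfl
  let s : A →ₗ[R] A × D := LinearMap.prod LinearMap.id
    (-(u.symm.toLinearMap ∘ₗ LinearMap.snd R B D ∘ₗ φ.toLinearMap ∘ₗ LinearMap.inl R A D))
  have hs : ∀ a, s a = (a, -u.symm (φ (a, 0)).2) := fun a => rfl
  have hadd : ∀ a x, φ (a, x) = φ (a, 0) + φ (0, x) := fun a x => by
    rw [← map_add]; simp
  have h0 : ∀ a, (φ (s a)).2 = 0 := by
    intro a
    rw [hs, hadd, Prod.snd_add, ← hux, map_neg, LinearEquiv.apply_symm_apply, add_neg_cancel]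
  refine ⟨LinearEquiv.ofBijective (LinearMap.fst R B D ∘ₗ φ.toLinearMap ∘ₗ s) ⟨?_, ?_⟩⟩
  · rw [← LinearMap.ker_eq_bot, LinearMap.ker_eq_bot']
    intro a ha
    have h1 : φ (s a) = 0 := Prod.ext ha (h0 a)
    have h2 : s a = 0 := by simpa using h1
    exact congrArg Prod.fst h2
  · intro y
    obtain ⟨⟨x, z⟩, hx⟩ := φ.surjective (y, 0)
    have h1 : (φ (x, 0)).2 + u z = 0 := by
      rw [hux, ← Prod.snd_add, ← hadd, hx]
    have h2 : z = -u.symm (φ (x, 0)).2 := by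
      apply u.injective
      rw [map_neg, LinearEquiv.apply_symm_apply]
      exact (neg_eq_of_add_eq_zero_right h1).symm
    refine ⟨x, ?_⟩
    change (φ (s x)).1 = y
    rw [hs, ← h2, hx]

/-- If the `D`-corner of `φ` is invertible, eliminate directly. Otherwise precompose `φ` with a
shear of `A × D` that makes the corner invertible; locality of `End D` shows that one exists. -/
theorem IsIndecomposable.cancel [IsArtinian R D] [IsNoetherian R D] (hD : IsIndecomposable R D)
    (φ : (A × D) ≃ₗ[R] (B × D)) : Nonempty (A ≃ₗ[R] B) := by
  have := hD.isLocalRing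
  let c : A →ₗ[R] D := LinearMap.snd R B D ∘ₗ φ.toLinearMap ∘ₗ LinearMap.inl R A D
  let d : Module.End R D := LinearMap.snd R B D ∘ₗ φ.toLinearMap ∘ₗ LinearMap.inr R A D
  let b' : D →ₗ[R] A := LinearMap.fst R A D ∘ₗ φ.symm.toLinearMap ∘ₗ LinearMap.inr R B D
  let d' : Module.End R D := LinearMap.snd R A D ∘ₗ φ.symm.toLinearMap ∘ₗ LinearMap.inr R B D
  have h1 : d * d' + (c ∘ₗ b' : Module.End R D) = 1 := by
    ext x
    change (φ (0, (φ.symm (0, x)).2)).2 + (φ ((φ.symm (0, x)).1, 0)).2 = x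
    rw [← Prod.snd_add, ← map_add]
    simp
  rcases hD.isUnit_or_isNilpotent d with hd | hd
  · exact cancel_of_bijective φ ((Module.End.isUnit_iff _).1 hd)
  · have hd' : ¬ IsUnit d := fun h => by
      have := hD.1
      exact not_isUnit_zero (M₀ := Module.End R D) (by
        obtain ⟨n, hn⟩ := hd
        rw [← hn]; exact h.pow n)
    have hcb : IsUnit (c ∘ₗ b' : Module.End R D) :=
      (IsLocalRing.isUnit_or_isUnit_of_add_one h1).resolve_left
        fun h => hd' (isUnit_left_of_isUnit_mul h)
    obtain ⟨w, hw⟩ := hcb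
    -- The sheared corner is a unit plus the non-unit `d`. Factoring out the unit `w` leaves `1 +
    -- w⁻¹d`, and `w⁻¹d` is nilpotent because it is not a unit.
    have hv : IsUnit (c ∘ₗ b' + d : Module.End R D) := by
      rw [← hw]
      have h2 : (w : Module.End R D) + d = w * (1 + (↑w⁻¹ : Module.End R D) * d) := by
        rw [mul_add, mul_one, Units.mul_inv_cancel_left]
      rw [h2]
      refine w.isUnit.mul (IsNilpotent.isUnit_one_add ?_)
      exact (hD.isUnit_or_isNilpotent _).resolve_left fun h => hd' (isUnit_right_of_isUnit_mul h)
    let σ : (A × D) ≃ₗ[R] (A × D) :=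
      { toFun := fun x => (x.1 + b' x.2, x.2)
        invFun := fun x => (x.1 - b' x.2, x.2)
        map_add' := fun x y => by ext <;> simp [add_add_add_comm]
        map_smul' := fun r x => by ext <;> simp
        left_inv := fun x => by ext <;> simp
        right_inv := fun x => by ext <;> simp }
    refine cancel_of_bijective (σ.trans φ) ?_
    have h3 : LinearMap.snd R B D ∘ₗ (σ.trans φ).toLinearMap ∘ₗ LinearMap.inr R A D =
        c ∘ₗ b' + d := by
      ext x
      change (φ (0 + b' x, x)).2 = (φ (b' x, 0)).2 + (φ (0, x)).2
      rw [← Prod.snd_add, ← map_add]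
      simp
    rw [h3]
    exact (Module.End.isUnit_iff _).1 hv

end Cancellation

variable {R : Type u} [Ring R]

theorem IsSummand.of_retract [IsArtinianRing R] {X M : FGModuleCat.{u} R} (i : X →ₗ[R] M)
    (p : M →ₗ[R] X) (h : p ∘ₗ i = LinearMap.id) : IsSummand X M := by
  have hp : ∀ x, p (i x) = x := fun x => LinearMap.congr_fun h x
  refine ⟨FGModuleCat.of R (LinearMap.ker p), ⟨LinearEquiv.symm
    { toFun := fun x => i x.1 + x.2.1
      invFun := fun m => (p m, ⟨m - i (p m), by simp [hp]⟩)
      map_add' := fun x y => by simp; abel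
      map_smul' := fun r x => by simp
      left_inv := fun x => ?_
      right_inv := fun m => by simp }⟩⟩
  have : p x.2.1 = 0 := x.2.2
  ext <;> simp [hp, this]

theorem IsSummand.exists_retract {X M : FGModuleCat.{u} R} (h : IsSummand X M) :
    ∃ (i : X →ₗ[R] M) (p : M →ₗ[R] X), p ∘ₗ i = LinearMap.id := by
  obtain ⟨Y, ⟨e⟩⟩ := h
  exact ⟨e.symm.toLinearMap ∘ₗ LinearMap.inl R X Y, LinearMap.fst R X Y ∘ₗ e.toLinearMap, by
    ext; simp⟩

theorem IsSummand.subsingleton {X M : FGModuleCat.{u} R} (h : IsSummand X M) [Subsingleton M] :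
    Subsingleton X := by
  obtain ⟨i, p, hp⟩ := h.exists_retract
  have hp' : Function.LeftInverse p i := fun x => LinearMap.congr_fun hp x
  exact hp'.injective.subsingleton

theorem IsSummand.of_equiv {X M : FGModuleCat.{u} R} (e : M ≃ₗ[R] X) : IsSummand X M :=
  ⟨FGModuleCat.of R PUnit, ⟨e.trans
    { toFun := fun x => (x, 0)
      invFun := fun x => x.1
      map_add' := fun _ _ => rfl
      map_smul' := fun _ _ => Prod.ext rfl (smul_zero _).symm
      left_inv := fun _ => rfl
      right_inv := fun _ => rfl }⟩⟩

theorem IsSummand.refl (M : FGModuleCat.{u} R) : IsSummand M M := .of_equiv (LinearEquiv.refl R M)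

theorem isSummand_dsum_left (A B : FGModuleCat.{u} R) : IsSummand A (dsum A B) :=
  ⟨B, ⟨LinearEquiv.refl R _⟩⟩

theorem isSummand_dsum_right (A B : FGModuleCat.{u} R) : IsSummand B (dsum A B) :=
  ⟨A, ⟨LinearEquiv.prodComm R A B⟩⟩

theorem IsSummand.pd_le {X M : FGModuleCat.{u} R} (h : IsSummand X M) {n : ℕ}
    (hM : pd R M ≤ n) : pd R X ≤ n := by
  obtain ⟨i, p, hp⟩ := h.exists_retract
  exact pd_le_of_retract i p hp hM

theorem IsSummand.pd_lt_top {X M : FGModuleCat.{u} R} (h : IsSummand X M)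
    (hM : pd R M < ⊤) : pd R X < ⊤ := by
  obtain ⟨n, hn⟩ := pd_lt_top_iff.1 hM
  exact pd_lt_top_iff.2 ⟨n, h.pd_le hn⟩

theorem IsSummand.projective {X M : FGModuleCat.{u} R} (h : IsSummand X M)
    (hM : Module.Projective R M) : Module.Projective R X := by
  obtain ⟨i, p, hp⟩ := h.exists_retract
  exact Module.Projective.of_split i p hp

theorem IsIndecomposable.subsingleton_of_prod {X A B : FGModuleCat.{u} R}
    (hX : IsIndecomposable R X) (e : X ≃ₗ[R] A × B) : Subsingleton A ∨ Subsingleton B := by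
  have hc : IsCompl (LinearMap.range (LinearMap.inl R A B)) (LinearMap.range (LinearMap.inr R A B)) :=
    LinearMap.isCompl_range_inl_inr
  have key : ∀ {A' : Type u} [AddCommGroup A'] [Module R A'] (f : A' →ₗ[R] A × B),
      Function.Injective f → LinearMap.range f = ⊥ → Subsingleton A' := by
    intro A' _ _ f hf h
    refine ⟨fun x y => hf ?_⟩
    rw [LinearMap.range_eq_bot.1 h]; rfl
  refine ((hX.of_equiv e).2 _ _ hc).imp (key _ LinearMap.inl_injective)
    (key _ LinearMap.inr_injective)

theorem IsIndecomposable.equiv_of_summand {X M : FGModuleCat.{u} R} (hM : IsIndecomposable R M)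
    [Nontrivial X] (h : IsSummand X M) : Nonempty (M ≃ₗ[R] X) := by
  obtain ⟨Y, ⟨e⟩⟩ := h
  rcases hM.subsingleton_of_prod e with h | h
  · exact (not_subsingleton X h).elim
  · let : Unique Y := ⟨⟨0⟩, fun _ => Subsingleton.elim _ _⟩
    exact ⟨e.trans LinearEquiv.prodUnique⟩

variable [IsArtinianRing R]

theorem IsSummand.trans {X M N : FGModuleCat.{u} R} (h : IsSummand X M) (h' : IsSummand M N) :
    IsSummand X N := by
  obtain ⟨i, p, hp⟩ := h.exists_retract
  obtain ⟨i', p', hp'⟩ := h'.exists_retract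
  refine .of_retract (i' ∘ₗ i) (p ∘ₗ p') ?_
  ext x
  have h1 := LinearMap.congr_fun hp' (i x)
  have h2 := LinearMap.congr_fun hp x
  simp at h1 h2 ⊢
  rw [h1, h2]

/-- The exchange property of indecomposable modules. -/
theorem IsIndecomposable.summand_prod {X A B M : FGModuleCat.{u} R} (hX : IsIndecomposable R X)
    (e : M ≃ₗ[R] A × B) (h : IsSummand X M) : IsSummand X A ∨ IsSummand X B := by
  have := hX.isLocalRing
  obtain ⟨i, p, hp⟩ := h.exists_retract
  let iA : X →ₗ[R] A := LinearMap.fst R A B ∘ₗ e.toLinearMap ∘ₗ i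
  let iB : X →ₗ[R] B := LinearMap.snd R A B ∘ₗ e.toLinearMap ∘ₗ i
  let pA : A →ₗ[R] X := p ∘ₗ e.symm.toLinearMap ∘ₗ LinearMap.inl R A B
  let pB : B →ₗ[R] X := p ∘ₗ e.symm.toLinearMap ∘ₗ LinearMap.inr R A B
  have h1 : (pA ∘ₗ iA : Module.End R X) + pB ∘ₗ iB = 1 := by
    ext x
    change p (e.symm ((e (i x)).1, 0)) + p (e.symm (0, (e (i x)).2)) = x
    rw [← map_add, ← map_add]
    simpa using LinearMap.congr_fun hp x
  refine (IsLocalRing.isUnit_or_isUnit_of_add_one h1).imp ?_ ?_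
  · rintro ⟨w, hw⟩
    refine .of_retract iA ((↑w⁻¹ : Module.End R X) ∘ₗ pA) ?_
    have := w.inv_mul
    rw [hw] at this
    exact this
  · rintro ⟨w, hw⟩
    refine .of_retract iB ((↑w⁻¹ : Module.End R X) ∘ₗ pB) ?_
    have := w.inv_mul
    rw [hw] at this
    exact this

/-- Induction along a decomposition into indecomposable modules. -/
theorem indecomposable_induction {P : FGModuleCat.{u} R → Prop}
    (zero : ∀ M : FGModuleCat.{u} R, Subsingleton M → P M)
    (indecomposable : ∀ M : FGModuleCat.{u} R, IsIndecomposable R M → P M)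
    (prod : ∀ A B M : FGModuleCat.{u} R, (M ≃ₗ[R] A × B) → P A → P B → P M)
    (M : FGModuleCat.{u} R) : P M := by
  obtain ⟨n, hn⟩ : ∃ n : ℕ, Module.length R M < n := by
    obtain ⟨n, hn⟩ := ENat.ne_top_iff_exists.1 (Module.length_ne_top (R := R) (M := M))
    exact ⟨n + 1, by rw [← hn]; exact_mod_cast n.lt_succ_self⟩
  induction n generalizing M with
  | zero => simp at hn
  | succ n ih =>
    rcases subsingleton_or_nontrivial M with h | h
    · exact zero M h
    by_cases hM : IsIndecomposable R M
    · exact indecomposable M hM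
    have hM' : ∃ A B : Submodule R M, IsCompl A B ∧ A ≠ ⊥ ∧ B ≠ ⊥ := by
      by_contra hc
      push Not at hc
      exact hM ⟨h, fun A B hAB => or_iff_not_imp_left.2 (hc A B hAB)⟩
    obtain ⟨A, B, hAB, hA, hB⟩ := hM'
    have hlt : ∀ {A B : Submodule R M}, IsCompl A B → B ≠ ⊥ → Module.length R A < n := by
      intro A B hAB hB
      have h1 : A ≠ ⊤ := by
        rintro rfl
        exact hB (by simpa using hAB.inf_eq_bot)
      have h2 := Submodule.length_lt h1
      have h3 : Module.length R M ≤ n := Order.le_of_lt_add_one (by exact_mod_cast hn)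
      exact h2.trans_le h3
    exact prod (FGModuleCat.of R A) (FGModuleCat.of R B) M (A.prodEquivOfIsCompl B hAB).symm
      (ih _ (hlt hAB hB)) (ih _ (hlt hAB.symm hA))

/-- Indecomposable summands of `D` are cancelled one at a time; no uniqueness of decompositions is
needed. -/
theorem cancel {A B D : FGModuleCat.{u} R} (φ : (A × D) ≃ₗ[R] (B × D)) :
    Nonempty (A ≃ₗ[R] B) := by
  induction D using indecomposable_induction generalizing A B with
  | zero D hD =>
    let : Unique D := ⟨⟨0⟩, fun _ => Subsingleton.elim _ _⟩
    exact ⟨LinearEquiv.prodUnique.symm.trans (φ.trans LinearEquiv.prodUnique)⟩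
  | indecomposable D hD => exact hD.cancel φ
  | prod D₁ D₂ D e h₁ h₂ =>
    let φ' : ((A × D₁) × D₂) ≃ₗ[R] ((B × D₁) × D₂) :=
      (LinearEquiv.prodAssoc R A D₁ D₂).trans
        (((LinearEquiv.refl R A).prodCongr e.symm).trans (φ.trans
          (((LinearEquiv.refl R B).prodCongr e).trans (LinearEquiv.prodAssoc R B D₁ D₂).symm)))
    obtain ⟨ψ⟩ := h₂ (A := dsum A D₁) (B := dsum B D₁) φ'
    exact h₁ ψ

end KrullSchmidt

/-! ### Exact sequences of finitely generated modules and stable equivalence -/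

section Sequences

variable {R : Type u} [Ring R]

/-- There is an exact sequence `0 → A → B → C → 0`. -/
def SES (A B C : FGModuleCat.{u} R) : Prop :=
  ∃ (f : A →ₗ[R] B) (g : B →ₗ[R] C), IsSES f g

theorem IsSES.ses {A B C : FGModuleCat.{u} R} {f : A →ₗ[R] B} {g : B →ₗ[R] C}
    (h : IsSES f g) : SES A B C := ⟨f, g, h⟩

theorem SES.congr {A B C A' B' C' : FGModuleCat.{u} R} (h : SES A B C) (eA : A ≃ₗ[R] A')
    (eB : B ≃ₗ[R] B') (eC : C ≃ₗ[R] C') : SES A' B' C' := by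
  obtain ⟨f, g, h⟩ := h
  exact (h.congr eA.symm eB eC).ses

theorem SES.prod {A B C A' B' C' : FGModuleCat.{u} R} (h : SES A B C) (h' : SES A' B' C') :
    SES (dsum A A') (dsum B B') (dsum C C') := by
  obtain ⟨f, g, h⟩ := h
  obtain ⟨f', g', h'⟩ := h'
  exact (h.prod h').ses

theorem ses_dsum (A B : FGModuleCat.{u} R) : SES A (dsum A B) B := (IsSES.inl_snd A B).ses

theorem ses_of_equiv_of_subsingleton {A B C : FGModuleCat.{u} R} (e : B ≃ₗ[R] C)
    [Subsingleton A] : SES A B C :=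
  IsSES.ses (f := 0) (g := e.toLinearMap) ⟨fun _ _ _ => Subsingleton.elim _ _, fun x => by
    constructor
    · intro h
      exact ⟨0, by rw [(map_eq_zero_iff e e.injective).1 h, map_zero]⟩
    · rintro ⟨a, rfl⟩
      simp, e.surjective⟩

theorem ses_of_equiv_of_subsingleton_right {A B C : FGModuleCat.{u} R} (e : A ≃ₗ[R] B)
    [Subsingleton C] : SES A B C :=
  IsSES.ses (f := e.toLinearMap) (g := 0) ⟨e.injective, fun x => by
    refine ⟨fun _ => e.surjective x, fun _ => rfl⟩, fun _ => ⟨0, Subsingleton.elim _ _⟩⟩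

theorem IsSES.split {A B C : FGModuleCat.{u} R} {f : A →ₗ[R] B} {g : B →ₗ[R] C}
    (h : IsSES f g) {s : C →ₗ[R] B} (hs : g ∘ₗ s = LinearMap.id) :
    Nonempty (B ≃ₗ[R] A × C) := by
  have hs' : ∀ x, g (s x) = x := fun x => LinearMap.congr_fun hs x
  refine ⟨(LinearEquiv.ofBijective (f.coprod s) ⟨?_, ?_⟩).symm⟩
  · rw [← LinearMap.ker_eq_bot, LinearMap.ker_eq_bot']
    rintro ⟨a, c⟩ hac
    rw [LinearMap.coprod_apply] at hac
    have h1 : g (f a + s c) = 0 := by rw [hac, map_zero]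
    rw [map_add, h.apply_apply_eq_zero, zero_add, hs'] at h1
    subst h1
    rw [map_zero, add_zero] at hac
    exact Prod.ext ((map_eq_zero_iff f h.inj).1 hac) rfl
  · intro b
    obtain ⟨a, ha⟩ := (h.exact (b - s (g b))).1 (by rw [map_sub, hs', sub_self])
    exact ⟨(a, g b), by rw [LinearMap.coprod_apply, ha, sub_add_cancel]⟩

theorem SES.split {A B C : FGModuleCat.{u} R} (h : SES A B C) (hC : Module.Projective R C) :
    Nonempty (B ≃ₗ[R] A × C) := by
  obtain ⟨f, g, h⟩ := h
  obtain ⟨s, hs⟩ := Module.projective_lifting_property g LinearMap.id h.surj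
  exact h.split hs

theorem SES.split_of_extOneVanishes {A B C : FGModuleCat.{u} R} (h : SES A B C)
    (hC : ExtOneVanishes C A) : Nonempty (B ≃ₗ[R] A × C) := by
  obtain ⟨f, g, h⟩ := h
  obtain ⟨s, hs⟩ := h.lift hC LinearMap.id
  exact h.split hs

variable [IsArtinianRing R]

theorem ses_of_surjective {B C : FGModuleCat.{u} R} {g : B →ₗ[R] C}
    (hg : Function.Surjective g) : SES (FGModuleCat.of R (LinearMap.ker g)) B C :=
  (IsSES.of_ker hg).ses

/-- The pullback of two short exact sequences with the same cokernel. -/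
theorem SES.pullback {A B C D E : FGModuleCat.{u} R} (h : SES A B C) (h' : SES D E C) :
    ∃ Z : FGModuleCat.{u} R, SES A Z E ∧ SES D Z B := by
  obtain ⟨f, g, h⟩ := h
  obtain ⟨f', g', h'⟩ := h'
  let φ : (B × E) →ₗ[R] C := g ∘ₗ LinearMap.fst R B E - g' ∘ₗ LinearMap.snd R B E
  have hφ : ∀ x, x ∈ LinearMap.ker φ ↔ g x.1 = g' x.2 := fun x => by
    simp [φ, sub_eq_zero]
  let Z := FGModuleCat.of R (LinearMap.ker φ)
  refine ⟨Z, ?_, ?_⟩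
  · let i : A →ₗ[R] Z := LinearMap.codRestrict _ (LinearMap.inl R B E ∘ₗ f) fun a => by
      rw [hφ]; simp [h.apply_apply_eq_zero]
    let p : Z →ₗ[R] E := LinearMap.snd R B E ∘ₗ (LinearMap.ker φ).subtype
    refine IsSES.ses (f := i) (g := p) ⟨?_, ?_, ?_⟩
    · intro a a' haa
      exact h.inj (congrArg (fun z : Z => z.1.1) haa)
    · intro z
      constructor
      · intro hz
        have hz' : z.1.2 = 0 := hz
        have h1 := (hφ _).1 z.2
        rw [hz', map_zero] at h1
        obtain ⟨a, ha⟩ := (h.exact _).1 h1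
        exact ⟨a, Subtype.ext (Prod.ext ha hz'.symm)⟩
      · rintro ⟨a, rfl⟩; rfl
    · intro e
      obtain ⟨b, hb⟩ := h.surj (g' e)
      exact ⟨⟨(b, e), (hφ _).2 hb⟩, rfl⟩
  · let i : D →ₗ[R] Z := LinearMap.codRestrict _ (LinearMap.inr R B E ∘ₗ f') fun a => by
      rw [hφ]; simp [h'.apply_apply_eq_zero]
    let p : Z →ₗ[R] B := LinearMap.fst R B E ∘ₗ (LinearMap.ker φ).subtype
    refine IsSES.ses (f := i) (g := p) ⟨?_, ?_, ?_⟩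
    · intro a a' haa
      exact h'.inj (congrArg (fun z : Z => z.1.2) haa)
    · intro z
      constructor
      · intro hz
        have hz' : z.1.1 = 0 := hz
        have h1 := (hφ _).1 z.2
        rw [hz', map_zero] at h1
        obtain ⟨a, ha⟩ := (h'.exact _).1 h1.symm
        exact ⟨a, Subtype.ext (Prod.ext hz'.symm ha)⟩
      · rintro ⟨a, rfl⟩; rfl
    · intro e
      obtain ⟨b, hb⟩ := h'.surj (g e)
      exact ⟨⟨(e, b), (hφ _).2 hb.symm⟩, rfl⟩

/-- The horseshoe lemma for epimorphisms onto the outer terms of a short exact sequence, one of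
which lifts to the middle term. -/
theorem IsSES.horseshoe {A B C K₁ Q₁ K₂ Q₂ : FGModuleCat.{u} R} {f : A →ₗ[R] B} {g : B →ₗ[R] C}
    (h : IsSES f g) {f₁ : K₁ →ₗ[R] Q₁} {g₁ : Q₁ →ₗ[R] A} (h₁ : IsSES f₁ g₁)
    {f₂ : K₂ →ₗ[R] Q₂} {g₂ : Q₂ →ₗ[R] C} (h₂ : IsSES f₂ g₂) {s : Q₂ →ₗ[R] B}
    (hs : g ∘ₗ s = g₂) :
    ∃ K : FGModuleCat.{u} R, SES K₁ K K₂ ∧ SES K (dsum Q₁ Q₂) B := by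
  have hs' : ∀ x, g (s x) = g₂ x := fun x => LinearMap.congr_fun hs x
  let φ : (Q₁ × Q₂) →ₗ[R] B := (f ∘ₗ g₁).coprod s
  have hφ : ∀ x, φ x = f (g₁ x.1) + s x.2 := fun x => rfl
  have hsurj : Function.Surjective φ := by
    intro b
    obtain ⟨y, hy⟩ := h₂.surj (g b)
    obtain ⟨a, ha⟩ := (h.exact (b - s y)).1 (by rw [map_sub, hs', hy, sub_self])
    obtain ⟨x, rfl⟩ := h₁.surj a
    exact ⟨(x, y), by rw [hφ, ha, sub_add_cancel]⟩
  let K := FGModuleCat.of R (LinearMap.ker φ)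
  refine ⟨K, ?_, ses_of_surjective (B := dsum Q₁ Q₂) hsurj⟩
  let i : K₁ →ₗ[R] K := LinearMap.codRestrict _ (LinearMap.inl R Q₁ Q₂ ∘ₗ f₁) fun a => by
    rw [LinearMap.mem_ker, hφ]; simp [h₁.apply_apply_eq_zero]
  have hker : ∀ x ∈ LinearMap.ker φ, g₂ x.2 = 0 := by
    intro x hx
    have : g (φ x) = 0 := by rw [LinearMap.mem_ker.1 hx, map_zero]
    rwa [hφ, map_add, h.apply_apply_eq_zero, zero_add, hs'] at this
  let e : K₂ ≃ₗ[R] LinearMap.ker g₂ := LinearEquiv.ofBijective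
    (f₂.codRestrict (LinearMap.ker g₂) h₂.apply_apply_eq_zero)
    ⟨fun x y hxy => h₂.inj (congrArg Subtype.val hxy), fun z => by
      obtain ⟨x, hx⟩ := (h₂.exact z.1).1 z.2
      exact ⟨x, Subtype.ext hx⟩⟩
  let q : K →ₗ[R] LinearMap.ker g₂ :=
    LinearMap.codRestrict _ (LinearMap.snd R Q₁ Q₂ ∘ₗ (LinearMap.ker φ).subtype)
      fun x => hker x.1 x.2
  have hq : IsSES i q := by
    refine ⟨?_, ?_, ?_⟩
    · intro a a' haa
      exact h₁.inj (congrArg (fun z : K => z.1.1) haa)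
    · intro z
      constructor
      · intro hz
        have hz' : z.1.2 = 0 := congrArg Subtype.val hz
        have h3 : φ z.1 = 0 := z.2
        rw [hφ, hz', map_zero, add_zero] at h3
        obtain ⟨a, ha⟩ := (h₁.exact _).1 ((map_eq_zero_iff f h.inj).1 h3)
        exact ⟨a, Subtype.ext (Prod.ext ha hz'.symm)⟩
      · rintro ⟨a, rfl⟩; rfl
    · rintro ⟨y, hy⟩
      have hy' : g₂ y = 0 := hy
      obtain ⟨a, ha⟩ := (h.exact (s y)).1 (by rw [hs', hy'])
      obtain ⟨x, rfl⟩ := h₁.surj a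
      exact ⟨⟨(-x, y), by rw [LinearMap.mem_ker, hφ]; simp [ha]⟩, rfl⟩
  exact (hq.congr (LinearEquiv.refl R K₁) (LinearEquiv.refl R K) e.symm).ses

end Sequences

/-! ### Stable equivalence and exact sequences up to projective summands -/

section Stable

variable {R : Type u} [Ring R]

/-- Stable equivalence: `A ⨿ P ≃ B ⨿ P'` for some finitely generated projective modules. -/
def StabEq (A B : FGModuleCat.{u} R) : Prop :=
  ∃ P P' : FGModuleCat.{u} R, Module.Projective R P ∧ Module.Projective R P' ∧
    Nonempty ((A × P) ≃ₗ[R] (B × P'))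

theorem StabEq.of_equiv {A B : FGModuleCat.{u} R} (e : A ≃ₗ[R] B) : StabEq A B :=
  ⟨FGModuleCat.of R PUnit, FGModuleCat.of R PUnit, inferInstanceAs (Module.Projective R PUnit.{u + 1}),
    inferInstanceAs (Module.Projective R PUnit.{u + 1}), ⟨e.prodCongr (LinearEquiv.refl R _)⟩⟩

theorem StabEq.refl (A : FGModuleCat.{u} R) : StabEq A A := .of_equiv (LinearEquiv.refl R A)

theorem StabEq.symm {A B : FGModuleCat.{u} R} (h : StabEq A B) : StabEq B A := by
  obtain ⟨P, P', hP, hP', ⟨e⟩⟩ := h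
  exact ⟨P', P, hP', hP, ⟨e.symm⟩⟩

theorem StabEq.trans {A B C : FGModuleCat.{u} R} (h : StabEq A B) (h' : StabEq B C) :
    StabEq A C := by
  obtain ⟨P, P', hP, hP', ⟨e⟩⟩ := h
  obtain ⟨Q, Q', hQ, hQ', ⟨e'⟩⟩ := h'
  refine ⟨dsum P Q, dsum Q' P', inferInstanceAs (Module.Projective R (P × Q)),
    inferInstanceAs (Module.Projective R (Q' × P')), ⟨?_⟩⟩
  exact (LinearEquiv.prodAssoc R A P Q).symm.trans <|
    (e.prodCongr (LinearEquiv.refl R Q)).trans <|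
    (LinearEquiv.prodAssoc R B P' Q).trans <|
    ((LinearEquiv.refl R B).prodCongr (LinearEquiv.prodComm R P' Q)).trans <|
    (LinearEquiv.prodAssoc R B Q P').symm.trans <|
    (e'.prodCongr (LinearEquiv.refl R P')).trans (LinearEquiv.prodAssoc R C Q' P')

theorem StabEq.prod {A B A' B' : FGModuleCat.{u} R} (h : StabEq A A') (h' : StabEq B B') :
    StabEq (dsum A B) (dsum A' B') := by
  obtain ⟨P, P', hP, hP', ⟨e⟩⟩ := h
  obtain ⟨Q, Q', hQ, hQ', ⟨e'⟩⟩ := h'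
  exact ⟨dsum P Q, dsum P' Q', inferInstanceAs (Module.Projective R (P × Q)),
    inferInstanceAs (Module.Projective R (P' × Q')),
    ⟨(LinearEquiv.prodProdProdComm R A B P Q).trans <|
      (e.prodCongr e').trans (LinearEquiv.prodProdProdComm R A' B' P' Q').symm⟩⟩

theorem stabEq_dsum_projective (A : FGModuleCat.{u} R) {P : FGModuleCat.{u} R}
    (hP : Module.Projective R P) : StabEq (dsum A P) A :=
  ⟨FGModuleCat.of R PUnit, P, inferInstanceAs (Module.Projective R PUnit.{u + 1}), hP,
    ⟨LinearEquiv.prodUnique⟩⟩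

theorem StabEq.of_projective {P Q : FGModuleCat.{u} R} (hP : Module.Projective R P)
    (hQ : Module.Projective R Q) : StabEq P Q := ⟨Q, P, hQ, hP, ⟨LinearEquiv.prodComm R P Q⟩⟩

theorem StabEq.pd_le {A B : FGModuleCat.{u} R} (h : StabEq A B) {n : ℕ} (hA : pd R A ≤ n) :
    pd R B ≤ n := by
  obtain ⟨P, P', hP, hP', ⟨e⟩⟩ := h
  have h1 : pd R (A × P) ≤ n :=
    pd_prod_le hA (pd_le_of_le (pd_le_zero_iff.2 hP) n.zero_le)
  have h2 : pd R (B × P') ≤ n := pd_le_of_equiv e.symm h1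
  exact (isSummand_dsum_left B P').pd_le h2

theorem StabEq.kClass_eq {A B : FGModuleCat.{u} R} (h : StabEq A B) : kClass A = kClass B := by
  obtain ⟨P, P', hP, hP', ⟨e⟩⟩ := h
  have h1 := kClass_of_equiv_prod (C := dsum A P) (LinearEquiv.refl R (A × P))
  have h2 := kClass_of_equiv_prod (C := dsum A P) e
  rw [h1, kClass_of_projective P hP, kClass_of_projective P' hP', add_zero, add_zero] at h2
  exact h2

/-- An exact sequence `0 → A → B → C → 0` exists up to stable equivalence. -/
def StabSES (A B C : FGModuleCat.{u} R) : Prop :=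
  ∃ A' B' C' : FGModuleCat.{u} R, StabEq A A' ∧ StabEq B B' ∧ StabEq C C' ∧ SES A' B' C'

theorem SES.stab {A B C : FGModuleCat.{u} R} (h : SES A B C) : StabSES A B C :=
  ⟨A, B, C, .refl _, .refl _, .refl _, h⟩

theorem StabSES.congr {A B C A' B' C' : FGModuleCat.{u} R} (h : StabSES A B C)
    (hA : StabEq A A') (hB : StabEq B B') (hC : StabEq C C') : StabSES A' B' C' := by
  obtain ⟨A₁, B₁, C₁, h1, h2, h3, h⟩ := h
  exact ⟨A₁, B₁, C₁, hA.symm.trans h1, hB.symm.trans h2, hC.symm.trans h3, h⟩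

theorem StabSES.stabEq_left {A B C : FGModuleCat.{u} R} (h : StabSES A B C)
    (hC : Module.Projective R C) : StabEq A B := by
  obtain ⟨A', B', C', hA, hB, hC', h⟩ := h
  have hCp : Module.Projective R C' := pd_le_zero_iff.1 (hC'.pd_le (pd_le_zero_iff.2 hC))
  obtain ⟨e⟩ := h.split hCp
  exact hA.trans (((StabEq.of_equiv (B := dsum A' C') e).trans
    (stabEq_dsum_projective _ hCp)).symm.trans hB.symm)

theorem StabSES.pd_middle_le {A B C : FGModuleCat.{u} R} (h : StabSES A B C) {n : ℕ}
    (hA : pd R A ≤ n) (hC : pd R C ≤ n) : pd R B ≤ n := by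
  obtain ⟨A', B', C', hA', hB', hC', ⟨f, g, h⟩⟩ := h
  exact hB'.symm.pd_le (h.pd_middle_le (hA'.pd_le hA) (hC'.pd_le hC))

theorem StabSES.pd_left_lt_top {A B C : FGModuleCat.{u} R} (h : StabSES A B C)
    (hB : pd R B < ⊤) (hC : pd R C < ⊤) : pd R A < ⊤ := by
  obtain ⟨m, hm⟩ := pd_lt_top_iff.1 hB
  obtain ⟨n, hn⟩ := pd_lt_top_iff.1 hC
  obtain ⟨A', B', C', hA', hB', hC', ⟨f, g, h⟩⟩ := h
  exact pd_lt_top_iff.2 ⟨max m n, hA'.symm.pd_le (h.pd_left_le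
    (pd_le_of_le (hB'.pd_le hm) (by omega)) (pd_le_of_le (hC'.pd_le hn) (by omega)))⟩

variable [IsArtinianRing R]

/-- Schanuel's lemma: the pullback of the two presentations splits over `P` and over `P'`. -/
theorem schanuel {K P K' P' M : FGModuleCat.{u} R} (h : SES K P M) (hP : Module.Projective R P)
    (h' : SES K' P' M) (hP' : Module.Projective R P') : StabEq K K' := by
  obtain ⟨Z, h1, h2⟩ := h.pullback h'
  obtain ⟨e⟩ := h1.split hP'
  obtain ⟨e'⟩ := h2.split hP
  exact ⟨P', P, hP', hP, ⟨e.symm.trans e'⟩⟩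

theorem ses_syz (M : FGModuleCat.{u} R) : SES (syz M) (coverObj M) M :=
  ses_of_surjective (isProjCover_coverMap M).surjective

theorem stabEq_syz {K P M : FGModuleCat.{u} R} (h : SES K P M) (hP : Module.Projective R P) :
    StabEq K (syz M) :=
  schanuel h hP (ses_syz M) (isProjCover_coverMap M).projective

theorem syz_projective {P : FGModuleCat.{u} R} (hP : Module.Projective R P) :
    Module.Projective R (syz P) := by
  obtain ⟨e⟩ := (ses_syz P).split hP
  have := (isProjCover_coverMap P).projective
  exact (isSummand_dsum_left (syz P) P).projective (Module.Projective.of_equiv e)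

theorem stabEq_syz_dsum (A B : FGModuleCat.{u} R) :
    StabEq (syz (dsum A B)) (dsum (syz A) (syz B)) := by
  have h1 := (isProjCover_coverMap A).projective
  have h2 := (isProjCover_coverMap B).projective
  exact (stabEq_syz ((ses_syz A).prod (ses_syz B))
    (inferInstanceAs (Module.Projective R (coverObj A × coverObj B)))).symm

theorem StabEq.of_equiv_syz {A B : FGModuleCat.{u} R} (e : A ≃ₗ[R] B) : StabEq (syz A) (syz B) :=
  stabEq_syz ((ses_syz A).congr (LinearEquiv.refl R _) (LinearEquiv.refl R _) e)
    (isProjCover_coverMap A).projective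

theorem StabEq.syz {A B : FGModuleCat.{u} R} (h : StabEq A B) : StabEq (syz A) (syz B) := by
  obtain ⟨P, P', hP, hP', ⟨e⟩⟩ := h
  have h1 := (stabEq_syz_dsum A P).symm.trans
    ((StabEq.of_equiv_syz (A := dsum A P) (B := dsum B P') e).trans (stabEq_syz_dsum B P'))
  exact (stabEq_dsum_projective _ (syz_projective hP)).symm.trans
    (h1.trans (stabEq_dsum_projective _ (syz_projective hP')))

theorem Syz_succ (n : ℕ) (M : FGModuleCat.{u} R) : Syz (n + 1) M = syz (Syz n M) :=
  Function.iterate_succ_apply' _ _ _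

theorem StabEq.Syz {A B : FGModuleCat.{u} R} (h : StabEq A B) (n : ℕ) :
    StabEq (Syz n A) (Syz n B) := by
  induction n with
  | zero => exact h
  | succ n ih => rw [Syz_succ, Syz_succ]; exact ih.syz

theorem stabEq_Syz_dsum (n : ℕ) (A B : FGModuleCat.{u} R) :
    StabEq (Syz n (dsum A B)) (dsum (Syz n A) (Syz n B)) := by
  induction n with
  | zero => exact .refl _
  | succ n ih =>
    simp only [Syz_succ]
    exact ih.syz.trans (stabEq_syz_dsum _ _)

theorem pd_Syz_le_iff {n m : ℕ} {M : FGModuleCat.{u} R} :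
    pd R (Syz n M) ≤ m ↔ pd R M ≤ (m + n : ℕ) := by
  induction n generalizing m with
  | zero => rfl
  | succ n ih =>
    rw [Syz_succ]
    obtain ⟨f, g, h⟩ := ses_syz (Syz n M)
    rw [h.pd_le_iff_of_projective (isProjCover_coverMap (Syz n M)).projective, ih]
    rw [add_right_comm, add_assoc]

theorem Syz_projective {n : ℕ} {M : FGModuleCat.{u} R} (h : pd R M ≤ n) :
    Module.Projective R (Syz n M) := by
  rw [← pd_le_zero_iff, pd_Syz_le_iff, zero_add]
  exact h

/-- The horseshoe presentation of the middle term need not be a projective cover, so its kernel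
agrees with `syz B` only up to projective summands. -/
theorem SES.syz {A B C : FGModuleCat.{u} R} (h : SES A B C) :
    StabSES (syz A) (syz B) (syz C) := by
  obtain ⟨f, g, h⟩ := h
  have hA := (isProjCover_coverMap A).projective
  have hC := (isProjCover_coverMap C).projective
  obtain ⟨f₁, g₁, h₁⟩ := ses_syz A
  obtain ⟨f₂, g₂, h₂⟩ := ses_syz C
  obtain ⟨s, hs⟩ := Module.projective_lifting_property g g₂ h.surj
  obtain ⟨K, hK, hK'⟩ := h.horseshoe h₁ h₂ hs
  exact hK.stab.congr (.refl _) (stabEq_syz hK'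
    (inferInstanceAs (Module.Projective R (coverObj A × coverObj C)))) (.refl _)

theorem StabSES.syz {A B C : FGModuleCat.{u} R} (h : StabSES A B C) :
    StabSES (syz A) (syz B) (syz C) := by
  obtain ⟨A', B', C', hA, hB, hC, h⟩ := h
  exact h.syz.congr hA.symm.syz hB.symm.syz hC.symm.syz

theorem StabSES.Syz {A B C : FGModuleCat.{u} R} (h : StabSES A B C) (n : ℕ) :
    StabSES (Syz n A) (Syz n B) (Syz n C) := by
  induction n with
  | zero => exact h
  | succ n ih => simp only [Syz_succ]; exact ih.syz

/-- Pull the sequence back along the projective cover of `C`. The pullback is an extension of a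
projective by `A`, hence stably `A`, and it maps onto `B` with kernel `ΩC`. -/
theorem StabSES.rotate {A B C : FGModuleCat.{u} R} (h : StabSES A B C) :
    StabSES (StratSys.syz C) A B := by
  obtain ⟨A', B', C', hA, hB, hC, h⟩ := h
  obtain ⟨Z, h1, h2⟩ := h.pullback (ses_syz C')
  have hp := (isProjCover_coverMap C').projective
  obtain ⟨e⟩ := h1.split hp
  refine h2.stab.congr hC.symm.syz ?_ hB.symm
  exact ((StabEq.of_equiv (B := dsum A' (coverObj C')) e).trans
    (stabEq_dsum_projective _ hp)).trans hA.symm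

theorem StabSES.stabEq_syz {A B C : FGModuleCat.{u} R} (h : StabSES A B C)
    (hB : Module.Projective R B) : StabEq A (StratSys.syz C) := by
  obtain ⟨A', B', C', hA, hB', hC, h⟩ := h
  have hBp : Module.Projective R B' := pd_le_zero_iff.1 (hB'.pd_le (pd_le_zero_iff.2 hB))
  exact hA.trans ((StratSys.stabEq_syz h hBp).trans hC.symm.syz)

/-- After `n` syzygies the left term is projective; rotating makes it the middle term, at the price
of one further syzygy. This is the source of the `+ 1` in the thresholds `s + 1` below. -/
theorem StabSES.stabEq_Syz_right {A B C : FGModuleCat.{u} R} (h : StabSES A B C) {n : ℕ}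
    (hA : pd R A ≤ n) : StabEq (StratSys.Syz (n + 1) C) (StratSys.Syz (n + 1) B) := by
  rw [Syz_succ, Syz_succ]
  exact (h.Syz n).rotate.stabEq_syz (Syz_projective hA)

theorem StabSES.stabEq_Syz_left {A B C : FGModuleCat.{u} R} (h : StabSES A B C) {n : ℕ}
    (hC : pd R C ≤ n) : StabEq (StratSys.Syz n A) (StratSys.Syz n B) :=
  (h.Syz n).stabEq_left (Syz_projective hC)

end Stable

/-! ### The group `𝒦` detects stable equivalence -/

section StableMonoid

variable {R : Type u} [Ring R]

/-- Stable equivalence as a setoid. -/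
def stabSetoid (R : Type u) [Ring R] : Setoid (FGModuleCat.{u} R) :=
  ⟨StabEq, StabEq.refl, StabEq.symm, StabEq.trans⟩

/-- Stable equivalence classes of finitely generated modules. -/
def StableClass (R : Type u) [Ring R] : Type (u + 1) := Quotient (stabSetoid R)

/-- The stable equivalence class of a module. -/
def stableClass (M : FGModuleCat.{u} R) : StableClass R := Quotient.mk (stabSetoid R) M

theorem stableClass_eq_iff {A B : FGModuleCat.{u} R} :
    stableClass A = stableClass B ↔ StabEq A B := Quotient.eq (r := stabSetoid R)

/-- Stable equivalence classes form a commutative monoid under direct sums. -/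
instance : AddCommMonoid (StableClass R) where
  add := Quotient.map₂ dsum fun _ _ h _ _ h' => h.prod h'
  zero := stableClass (FGModuleCat.of R PUnit)
  add_assoc := by
    rintro ⟨A⟩ ⟨B⟩ ⟨C⟩
    exact Quotient.sound (StabEq.of_equiv (A := dsum (dsum A B) C) (B := dsum A (dsum B C))
      (LinearEquiv.prodAssoc R A B C))
  zero_add := by
    rintro ⟨A⟩
    exact Quotient.sound (StabEq.of_equiv (A := dsum (FGModuleCat.of R PUnit) A)
      (LinearEquiv.uniqueProd (R := R) (M := A) (M₂ := PUnit.{u + 1})))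
  add_zero := by
    rintro ⟨A⟩
    exact Quotient.sound (StabEq.of_equiv (A := dsum A (FGModuleCat.of R PUnit))
      (LinearEquiv.prodUnique (R := R) (M := A) (M₂ := PUnit.{u + 1})))
  add_comm := by
    rintro ⟨A⟩ ⟨B⟩
    exact Quotient.sound (StabEq.of_equiv (A := dsum A B) (B := dsum B A)
      (LinearEquiv.prodComm R A B))
  nsmul := @nsmulRec _ ⟨stableClass (FGModuleCat.of R PUnit)⟩ ⟨Quotient.map₂ dsum fun _ _ h _ _ h' => h.prod h'⟩

theorem stableClass_projective {P : FGModuleCat.{u} R} (hP : Module.Projective R P) :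
    stableClass P = 0 :=
  stableClass_eq_iff.2 (.of_projective hP (inferInstanceAs (Module.Projective R PUnit.{u + 1})))

variable [IsArtinianRing R]

theorem StabEq.cancel {A B D : FGModuleCat.{u} R} (h : StabEq (dsum A D) (dsum B D)) :
    StabEq A B := by
  obtain ⟨P, P', hP, hP', ⟨e⟩⟩ := h
  let swap (A D P : FGModuleCat.{u} R) : ((A × P) × D) ≃ₗ[R] ((A × D) × P) :=
    (LinearEquiv.prodAssoc R A P D).trans <|
      ((LinearEquiv.refl R A).prodCongr (LinearEquiv.prodComm R P D)).trans
        (LinearEquiv.prodAssoc R A D P).symm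
  exact ⟨P, P', hP, hP', StratSys.cancel (A := dsum A P) (B := dsum B P')
    ((swap A D P).trans (e.trans (swap B D P').symm))⟩

instance : IsCancelAdd (StableClass R) :=
  have : IsRightCancelAdd (StableClass R) := ⟨by
    rintro ⟨D⟩ ⟨A⟩ ⟨B⟩ h
    exact stableClass_eq_iff.2 (StabEq.cancel (stableClass_eq_iff.1 h))⟩
  AddCommMagma.IsRightCancelAdd.toIsCancelAdd _

/-- The defining relations of `𝒦` hold in the Grothendieck group of the monoid of stable classes,
and that monoid embeds in its Grothendieck group because it is cancellative. -/
theorem stabEq_of_kClass_eq {A B : FGModuleCat.{u} R} (h : kClass A = kClass B) : StabEq A B := by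
  let F : FreeAbelianGroup (FGModuleCat.{u} R) →+
      Algebra.GrothendieckAddGroup (StableClass R) :=
    FreeAbelianGroup.lift fun M => Algebra.GrothendieckAddGroup.of (stableClass M)
  have hF : AddSubgroup.closure (kRel R) ≤ F.ker := by
    rw [AddSubgroup.closure_le]
    rintro x (⟨A, B, C, ⟨e⟩, rfl⟩ | ⟨P, hP, rfl⟩)
    · have h1 : stableClass C = stableClass A + stableClass B :=
        stableClass_eq_iff.2 (StabEq.of_equiv (B := dsum A B) e)
      simp [F, h1]
    · simp [F, stableClass_projective hP]
  have h1 : FreeAbelianGroup.of A - FreeAbelianGroup.of B ∈ AddSubgroup.closure (kRel R) := by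
    rw [← QuotientAddGroup.eq_zero_iff, QuotientAddGroup.mk_sub, sub_eq_zero]
    exact h
  have h2 : F (FreeAbelianGroup.of A - FreeAbelianGroup.of B) = 0 := hF h1
  rw [map_sub, sub_eq_zero] at h2
  simp only [F, FreeAbelianGroup.lift_apply_of] at h2
  exact stableClass_eq_iff.1 (Algebra.GrothendieckAddGroup.of_injective h2)

end StableMonoid

/-! ### The stable additive closure of a module -/

section StableAdd

variable {R : Type u} [Ring R]

/-- Every indecomposable summand of `A` is projective or a summand of `N`: up to projective
summands, `A` belongs to the additive closure of `N`. -/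
def InStableAdd (N A : FGModuleCat.{u} R) : Prop :=
  ∀ X : FGModuleCat.{u} R, IsIndecomposable R X → IsSummand X A →
    Module.Projective R X ∨ IsSummand X N

theorem InStableAdd.self (N : FGModuleCat.{u} R) : InStableAdd N N := fun _ _ h => Or.inr h

theorem InStableAdd.of_projective {N P : FGModuleCat.{u} R} (hP : Module.Projective R P) :
    InStableAdd N P := fun _ _ h => Or.inl (h.projective hP)

theorem InStableAdd.trans {N N' A : FGModuleCat.{u} R} (h : InStableAdd N A)
    (h' : InStableAdd N' N) : InStableAdd N' A := fun X hX hXA =>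
  (h X hX hXA).elim Or.inl (h' X hX)

variable [IsArtinianRing R] {N A B : FGModuleCat.{u} R}

theorem InStableAdd.of_summand (h : IsSummand A N) : InStableAdd N A :=
  fun _ _ hX => Or.inr (hX.trans h)

theorem InStableAdd.summand (h : InStableAdd N A) (hB : IsSummand B A) : InStableAdd N B :=
  fun X hX hXB => h X hX (hXB.trans hB)

theorem InStableAdd.dsum (hA : InStableAdd N A) (hB : InStableAdd N B) :
    InStableAdd N (dsum A B) := fun X hX h =>
  (hX.summand_prod (LinearEquiv.refl R (A × B)) h).elim (hA X hX) (hB X hX)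

theorem InStableAdd.congr (hA : InStableAdd N A) (h : StabEq A B) : InStableAdd N B := by
  obtain ⟨P, P', hP, hP', ⟨e⟩⟩ := h
  exact ((hA.dsum (.of_projective hP)).summand
    (IsSummand.of_equiv (M := StratSys.dsum A P) (X := StratSys.dsum B P') e)).summand
    (isSummand_dsum_left B P')

theorem IsSummand.inStableAdd_syz (h : IsSummand A N) : InStableAdd (syz N) (syz A) := by
  obtain ⟨Y, ⟨e⟩⟩ := h
  have h1 : StabEq (StratSys.syz N) (dsum (StratSys.syz A) (StratSys.syz Y)) :=
    (StabEq.of_equiv (B := StratSys.dsum A Y) e).syz.trans (stabEq_syz_dsum A Y)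
  exact ((InStableAdd.self _).congr h1).summand (isSummand_dsum_left _ _)

theorem InStableAdd.syz (h : InStableAdd N A) : InStableAdd (syz N) (syz A) := by
  induction A using indecomposable_induction with
  | zero A hA => exact .of_projective (syz_projective inferInstance)
  | indecomposable A hA =>
    rcases h A hA (.refl A) with h | h
    · exact .of_projective (syz_projective h)
    · exact h.inStableAdd_syz
  | prod A₁ A₂ A e h₁ h₂ =>
    have hA : IsSummand (StratSys.dsum A₁ A₂) A := .of_equiv e
    have h1 := h₁ (h.summand ((isSummand_dsum_left A₁ A₂).trans hA))
    have h2 := h₂ (h.summand ((isSummand_dsum_right A₁ A₂).trans hA))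
    exact (h1.dsum h2).congr ((stabEq_syz_dsum A₁ A₂).symm.trans
      (StabEq.of_equiv (A := StratSys.dsum A₁ A₂) e.symm).syz)

theorem InStableAdd.Syz (h : InStableAdd N A) (n : ℕ) : InStableAdd (Syz n N) (Syz n A) := by
  induction n with
  | zero => exact h
  | succ n ih => simp only [Syz_succ]; exact ih.syz

theorem InStableAdd.kClass_mem (h : InStableAdd N A) : kClass A ∈ span N := by
  induction A using indecomposable_induction with
  | zero A hA =>
    rw [kClass_of_projective A inferInstance]
    exact zero_mem _
  | indecomposable A hA =>
    rcases h A hA (.refl A) with h | h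
    · rw [kClass_of_projective A h]
      exact zero_mem _
    · exact AddSubgroup.subset_closure ⟨A, hA, h, rfl⟩
  | prod A₁ A₂ A e h₁ h₂ =>
    have hA : IsSummand (StratSys.dsum A₁ A₂) A := .of_equiv e
    rw [kClass_of_equiv_prod e]
    exact add_mem (h₁ (h.summand ((isSummand_dsum_left A₁ A₂).trans hA)))
      (h₂ (h.summand ((isSummand_dsum_right A₁ A₂).trans hA)))

/-- A bound over the indecomposable summands of `N` suffices, since the projective dimension of a
direct sum is the larger of the two. -/
theorem InStableAdd.pd_le {b : ℕ}
    (hb : ∀ X : FGModuleCat.{u} R, IsIndecomposable R X → IsSummand X N → pd R X < ⊤ → pd R X ≤ b)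
    (h : InStableAdd N A) (hA : pd R A < ⊤) : pd R A ≤ b := by
  induction A using indecomposable_induction with
  | zero A hA => exact pd_le_of_le (pd_le_zero_iff.2 inferInstance) b.zero_le
  | indecomposable A hA' =>
    rcases h A hA' (.refl A) with h | h
    · exact pd_le_of_le (pd_le_zero_iff.2 h) b.zero_le
    · exact hb A hA' h hA
  | prod A₁ A₂ A e h₁ h₂ =>
    have hA' : IsSummand (StratSys.dsum A₁ A₂) A := .of_equiv e
    have l₁ := (isSummand_dsum_left A₁ A₂).trans hA'
    have l₂ := (isSummand_dsum_right A₁ A₂).trans hA'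
    exact pd_le_of_equiv e (pd_prod_le (h₁ (h.summand l₁) (l₁.pd_lt_top hA))
      (h₂ (h.summand l₂) (l₂.pd_lt_top hA)))

theorem exists_indecomposable_summands (N : FGModuleCat.{u} R) :
    ∃ L : List (FGModuleCat.{u} R), ∀ X : FGModuleCat.{u} R, IsIndecomposable R X →
      IsSummand X N → ∃ Y ∈ L, Nonempty (Y ≃ₗ[R] X) := by
  induction N using indecomposable_induction with
  | zero N hN =>
    refine ⟨[], fun X hX h => ?_⟩
    have := hX.1
    exact (not_subsingleton X h.subsingleton).elim
  | indecomposable N hN =>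
    refine ⟨[N], fun X hX h => ⟨N, by simp, ?_⟩⟩
    have := hX.1
    exact hN.equiv_of_summand h
  | prod A B N e h₁ h₂ =>
    obtain ⟨L₁, h₁⟩ := h₁
    obtain ⟨L₂, h₂⟩ := h₂
    refine ⟨L₁ ++ L₂, fun X hX h => ?_⟩
    rcases hX.summand_prod e h with h | h
    · obtain ⟨Y, hY, h⟩ := h₁ X hX h
      exact ⟨Y, by simp [hY], h⟩
    · obtain ⟨Y, hY, h⟩ := h₂ X hX h
      exact ⟨Y, by simp [hY], h⟩

/-- Up to isomorphism `N` has finitely many indecomposable summands. Finiteness matters because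
`Psi` uses `toNat`, which would turn an infinite value into `0`. -/
theorem pfd_summands_lt_top (N : FGModuleCat.{u} R) : pfd R {X | IsSummand X N} < ⊤ := by
  obtain ⟨L, hL⟩ := exists_indecomposable_summands N
  let b : ℕ := (L.map fun Y : FGModuleCat.{u} R => (pd R Y).toNat).sum
  have hb : ∀ X : FGModuleCat.{u} R, IsIndecomposable R X → IsSummand X N →
      pd R X < ⊤ → pd R X ≤ b := by
    intro X hX h hlt
    obtain ⟨Y, hY, ⟨e⟩⟩ := hL X hX h
    have hYt : pd R Y < ⊤ := (IsSummand.of_equiv e.symm).pd_lt_top hlt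
    have h1 : (pd R Y).toNat ≤ b := List.single_le_sum (by simp) _ (List.mem_map_of_mem hY)
    refine (IsSummand.of_equiv e).pd_le ?_
    rw [← ENat.natCast_toNat hYt.ne]
    exact_mod_cast h1
  refine lt_of_le_of_lt (b := (b : ℕ∞)) ?_ (ENat.natCast_lt_top b)
  refine iSup₂_le fun X hX => ?_
  exact (InStableAdd.of_summand hX.1).pd_le hb hX.2

theorem le_pfd_toNat {N X : FGModuleCat.{u} R} (h : IsSummand X N) (hX : pd R X < ⊤) :
    pd R X ≤ ((pfd R {X | IsSummand X N}).toNat : ℕ) := by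
  rw [ENat.natCast_toNat (pfd_summands_lt_top N).ne]
  exact le_iSup₂ (f := fun (M : FGModuleCat.{u} R)
    (_ : M ∈ {M : FGModuleCat.{u} R | M ∈ {X | IsSummand X N} ∧ pd R M < ⊤}) => pd R M) X ⟨h, hX⟩

theorem span_fg (N : FGModuleCat.{u} R) : (span N).FG := by
  obtain ⟨L, hL⟩ := exists_indecomposable_summands N
  have hfin : {x | ∃ X : FGModuleCat.{u} R, IsIndecomposable R X ∧ IsSummand X N ∧
      x = kClass X}.Finite := by
    refine (L.map kClass).finite_toSet.subset ?_
    rintro _ ⟨X, hX, h, rfl⟩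
    obtain ⟨Y, hY, ⟨e⟩⟩ := hL X hX h
    rw [← (StabEq.of_equiv e).kClass_eq]
    exact List.mem_map_of_mem hY
  exact (AddSubgroup.fg_iff _).2 ⟨_, rfl, hfin⟩

theorem mem_syzSpan_iff {m : ℕ} {N : FGModuleCat.{u} R} {y : K R} :
    y ∈ syzSpan m N ↔ ∃ x ∈ span N, kSyz^[m] x = y := by
  induction m generalizing y with
  | zero => simp [syzSpan]
  | succ m ih =>
    rw [syzSpan, Function.iterate_succ_apply']
    change y ∈ AddSubgroup.map kSyz (syzSpan m N) ↔ _
    simp only [AddSubgroup.mem_map, ih, Function.iterate_succ_apply']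
    constructor
    · rintro ⟨_, ⟨x, hx, rfl⟩, rfl⟩; exact ⟨x, hx, rfl⟩
    · rintro ⟨x, hx, rfl⟩; exact ⟨_, ⟨x, hx, rfl⟩, rfl⟩

theorem iterate_kSyz_kClass (n : ℕ) (A : FGModuleCat.{u} R) :
    kSyz^[n] (kClass A) = kClass (Syz n A) := by
  induction n with
  | zero => rfl
  | succ n ih => rw [Function.iterate_succ_apply', ih, kSyz_kClass, Syz_succ]

/-- The infimum defining `Phi` is attained: `⟨N⟩` is a finitely generated abelian group, hence
Noetherian, so the kernels of the powers of `Ω` on it stabilise. From then on `Ω` is injective on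
the images `Ωᵐ⟨N⟩`; surjectivity is automatic. -/
theorem bijOn_kSyz_of_ge_Phi (N : FGModuleCat.{u} R) : ∀ m ≥ Phi N,
    Set.BijOn kSyz (syzSpan m N : Set (K R)) (syzSpan (m + 1) N : Set (K R)) := by
  refine Nat.sInf_mem (s := {n : ℕ | ∀ m ≥ n,
    Set.BijOn kSyz (syzSpan m N : Set (K R)) (syzSpan (m + 1) N : Set (K R))}) ?_
  have hS : IsNoetherian ℤ (AddSubgroup.toIntSubmodule (span N)) := by
    refine isNoetherian_of_fg_of_noetherian _ ?_
    exact (Submodule.fg_iff_addSubgroup_fg _).2 (span_fg N)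
  let σ : AddMonoid.End (K R) := kSyz
  let H : ℕ →o Submodule ℤ (AddSubgroup.toIntSubmodule (span N)) :=
    { toFun := fun m => (AddSubgroup.toIntSubmodule
        (AddMonoidHom.ker (σ ^ m))).comap
          (AddSubgroup.toIntSubmodule (span N)).subtype
      monotone' := monotone_nat_of_le_succ fun m x hx => by
        change (σ ^ (m + 1)) x.1 = 0
        have hx' : (σ ^ m) x.1 = 0 := hx
        rw [pow_succ']
        change σ ((σ ^ m) x.1) = 0
        rw [hx', map_zero] }
  have hH : ∀ m x, x ∈ H m ↔ kSyz^[m] x.1 = 0 := fun m x => by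
    change (σ ^ m) x.1 = 0 ↔ σ^[m] x.1 = 0
    rw [AddMonoid.End.coe_pow]
  obtain ⟨n, hn⟩ := monotone_stabilizes_iff_noetherian.2 hS H
  refine ⟨n, fun m hm => ⟨?_, ?_, ?_⟩⟩
  · intro y hy
    obtain ⟨x, hx, rfl⟩ := mem_syzSpan_iff.1 hy
    exact mem_syzSpan_iff.2 ⟨x, hx, Function.iterate_succ_apply' _ _ _⟩
  · intro y hy z hz hyz
    have hyz' : y - z ∈ syzSpan m N := sub_mem hy hz
    obtain ⟨x, hx, hx'⟩ := mem_syzSpan_iff.1 hyz'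
    have h1 : (⟨x, hx⟩ : AddSubgroup.toIntSubmodule (span N)) ∈ H (m + 1) := by
      rw [hH, Function.iterate_succ_apply', hx', map_sub, hyz, sub_self]
    rw [← hn (m + 1) (by omega), hn m hm, hH, hx'] at h1
    exact sub_eq_zero.1 h1
  · intro y hy
    obtain ⟨x, hx, rfl⟩ := mem_syzSpan_iff.1 hy
    exact ⟨_, mem_syzSpan_iff.2 ⟨x, hx, rfl⟩, (Function.iterate_succ_apply' _ _ _).symm⟩

theorem iterate_kSyz_eq_zero {x : K R} (hx : x ∈ span N) {m : ℕ} (h : kSyz^[Phi N + m] x = 0) :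
    kSyz^[Phi N] x = 0 := by
  induction m with
  | zero => exact h
  | succ m ih =>
    apply ih
    have h1 := (bijOn_kSyz_of_ge_Phi N (Phi N + m) (Nat.le_add_right _ _)).injOn
    refine h1 (mem_syzSpan_iff.2 ⟨x, hx, rfl⟩) (zero_mem _) ?_
    rw [map_zero, ← Function.iterate_succ_apply' kSyz]
    exact h

end StableAdd

/-! ### The Igusa–Todorov inequality -/

section IgusaTodorovInequality

variable {R : Type u} [Ring R] [IsArtinianRing R]

/-- If the cokernel `C` of a monomorphism `X → X ⨿ P` with `P` projective has finite projective
dimension, then `pd C` exceeds by at most one the projective dimension of some summand of `X`. -/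
theorem exists_summand_pd_le {X P C : FGModuleCat.{u} R} (h : SES X (dsum X P) C)
    (hP : Module.Projective R P) (hC : pd R C < ⊤) :
    ∃ Z : FGModuleCat.{u} R, IsSummand Z X ∧ pd R Z < ⊤ ∧
      ∀ b : ℕ, pd R Z ≤ b → pd R C ≤ (b + 1 : ℕ) := by
  obtain ⟨f, g, h⟩ := h
  let φ : Module.End R X := LinearMap.fst R X P ∘ₗ f
  let ψ : X →ₗ[R] P := LinearMap.snd R X P ∘ₗ f
  have hf : ∀ x, f x = (φ x, ψ x) := fun x => rfl
  -- Choose the exponent so that the Fitting decomposition of `φ` holds and the kernels of its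
  -- powers are already stable. The sequence will then restrict to the nilpotent part `Z`.
  obtain ⟨m, hm⟩ := Filter.eventually_atTop.1
    ((LinearMap.eventually_isCompl_ker_pow_range_pow φ).and
      (LinearMap.eventually_iSup_ker_pow_eq φ))
  obtain ⟨hc, hker⟩ := hm (m + 1) m.le_succ
  have hker' := (hm (m + 2) (by omega)).2
  rw [hker] at hker'
  let Z := LinearMap.ker (φ ^ (m + 1))
  have hZ : ∀ x, φ x ∈ Z → x ∈ Z := by
    intro x hx
    change x ∈ LinearMap.ker (φ ^ (m + 1))
    rw [hker', LinearMap.mem_ker, pow_succ, Module.End.mul_apply]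
    exact hx
  have hZ' : ∀ x ∈ Z, φ x ∈ Z := by
    intro x hx
    rw [LinearMap.mem_ker, ← Module.End.mul_apply, ← pow_succ, pow_succ', Module.End.mul_apply,
      LinearMap.mem_ker.1 hx, map_zero]
  let f' : Z →ₗ[R] Z × P := (φ.restrict hZ').prod (ψ ∘ₗ Z.subtype)
  let g' : (Z × P) →ₗ[R] C := g ∘ₗ (Z.subtype.prodMap LinearMap.id)
  have h' : IsSES f' g' := by
    refine ⟨fun x y hxy => ?_, fun x => ⟨fun hx => ?_, ?_⟩, fun c => ?_⟩
    · refine Subtype.ext (h.inj ?_)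
      rw [hf, hf]
      exact Prod.ext (congrArg (fun z : Z × P => (z.1 : X)) hxy)
        (congrArg (fun z : Z × P => z.2) hxy)
    · obtain ⟨⟨z, hz⟩, p⟩ := x
      obtain ⟨x, hx'⟩ := (h.exact (z, p)).1 hx
      rw [hf] at hx'
      have h1 : φ x = z := congrArg Prod.fst hx'
      have h2 : ψ x = p := congrArg Prod.snd hx'
      exact ⟨⟨x, hZ x (h1 ▸ hz)⟩, Prod.ext (Subtype.ext h1) h2⟩
    · rintro ⟨z, rfl⟩
      exact h.apply_apply_eq_zero z.1
    · obtain ⟨⟨x, p⟩, rfl⟩ := h.surj c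
      have hx : x ∈ Z ⊔ LinearMap.range (φ ^ (m + 1)) := by
        rw [hc.sup_eq_top]; trivial
      obtain ⟨z, hz, _, ⟨w, rfl⟩, rfl⟩ := Submodule.mem_sup.1 hx
      -- The component of `x` in the range of `φ ^ (m + 1)` is removed by subtracting `f ((φ ^ m)
      -- w)`, which `g` kills.
      refine ⟨(⟨z, hz⟩, p - ψ ((φ ^ m) w)), ?_⟩
      change g (z, p - ψ ((φ ^ m) w)) = g (z + (φ ^ (m + 1)) w, p)
      rw [← sub_eq_zero, ← map_sub, ← neg_eq_zero, ← map_neg,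
        ← h.apply_apply_eq_zero ((φ ^ m) w), hf, ← Module.End.mul_apply, ← pow_succ']
      congr 1
      ext <;> simp
  refine ⟨FGModuleCat.of R Z, ⟨FGModuleCat.of R (LinearMap.range (φ ^ (m + 1))),
    ⟨(Submodule.prodEquivOfIsCompl _ _ hc).symm⟩⟩, ?_, fun b hb => ?_⟩
  · refine pd_lt_top_of_nilpotent h' hP hC ⟨m + 1, ?_⟩
    have h1 : LinearMap.fst R Z P ∘ₗ f' = φ.restrict hZ' := rfl
    rw [h1, Module.End.pow_restrict]
    ext x
    exact LinearMap.mem_ker.1 x.2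
  · exact h'.pd_right_le hb (pd_prod_le (pd_le_of_le hb (Nat.le_succ b))
      (pd_le_of_le (pd_le_zero_iff.2 hP) (Nat.zero_le _)))

/-- The Igusa–Todorov inequality: `pd C ≤ Ψ(N) + 1` for an exact sequence `0 → A → B → C → 0`, up
to stable equivalence, with `A` and `B` in the additive closure of `N` and `pd C < ∞`. -/
theorem StabSES.pd_le_Psi {A B C N : FGModuleCat.{u} R} (h : StabSES A B C)
    (hA : InStableAdd N A) (hB : InStableAdd N B) (hC : pd R C < ⊤) :
    pd R C ≤ (Psi N + 1 : ℕ) := by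
  obtain ⟨n, hn⟩ := pd_lt_top_iff.1 hC
  have hspan : kClass A - kClass B ∈ span N := sub_mem hA.kClass_mem hB.kClass_mem
  have hiter : ∀ m, kSyz^[m] (kClass A - kClass B) = kClass (StratSys.Syz m A) - kClass (StratSys.Syz m B) :=
    fun m => by rw [iterate_map_sub, iterate_kSyz_kClass, iterate_kSyz_kClass]
  -- Beyond `pd C` the sequence of syzygies has projective cokernel, so the syzygies of `A` and `B`
  -- are stably equal. Injectivity of `Ω` then brings this equality back to level `Φ(N)`.
  have h0 := iterate_kSyz_eq_zero (m := n) hspan (by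
    rw [hiter, (h.stabEq_Syz_left (pd_le_of_le hn (Nat.le_add_left n _))).kClass_eq, sub_self])
  rw [hiter, sub_eq_zero] at h0
  have hAB := stabEq_of_kClass_eq h0
  obtain ⟨A', B', C', hA', hB', hC', h'⟩ := h.Syz (Phi N)
  obtain ⟨P, P', hP, hP', ⟨e⟩⟩ := hA'.symm.trans (hAB.trans hB')
  have hX : StabEq (StratSys.Syz (Phi N) A) (dsum A' P) := hA'.trans (stabEq_dsum_projective A' hP).symm
  -- Adding the trivial sequences `P → P → 0` and `0 → P' → P'` turns the stable isomorphism into an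
  -- honest one, giving a monomorphism `X → X ⨿ P` with `X = A' ⨿ P`.
  have hseq : SES (dsum A' P) (dsum (dsum A' P) P) (dsum C' P') := by
    let O : FGModuleCat.{u} R := FGModuleCat.of R PUnit.{u + 1}
    have h1 : SES P P O := ses_of_equiv_of_subsingleton_right (LinearEquiv.refl R P)
    have h2 : SES O P' P' := ses_of_equiv_of_subsingleton (LinearEquiv.refl R P')
    have e' : ((B' × P) × P') ≃ₗ[R] ((A' × P) × P) :=
      (LinearEquiv.prodAssoc R B' P P').trans <|
        ((LinearEquiv.refl R B').prodCongr (LinearEquiv.prodComm R P P')).trans <|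
        (LinearEquiv.prodAssoc R B' P' P).symm.trans (e.symm.prodCongr (LinearEquiv.refl R P))
    exact ((h'.prod h1).prod h2).congr (LinearEquiv.prodUnique (R := R) (M₂ := PUnit.{u + 1})) e'
      ((LinearEquiv.prodUnique (R := R) (M₂ := PUnit.{u + 1})).prodCongr (LinearEquiv.refl R P'))
  have hC'' : StabEq (StratSys.Syz (Phi N) C) (dsum C' P') :=
    hC'.trans (stabEq_dsum_projective C' hP').symm
  have hCt : pd R (dsum C' P') < ⊤ := pd_lt_top_iff.2
    ⟨n, hC''.pd_le (pd_Syz_le_iff.2 (pd_le_of_le hn (Nat.le_add_right _ _)))⟩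
  obtain ⟨Z, hZ, hZt, hZb⟩ := exists_summand_pd_le hseq hP hCt
  have hZle := InStableAdd.pd_le (fun X _ hX hXt => le_pfd_toNat hX hXt)
    (((hA.Syz (Phi N)).congr hX).summand hZ) hZt
  have h2 := pd_Syz_le_iff.1 (hC''.symm.pd_le (hZb _ hZle))
  refine pd_le_of_le h2 ?_
  rw [Psi]
  omega

end IgusaTodorovInequality

/-! ### Filtrations recorded by the list of their factors -/

section Sequences

variable {R : Type u} [Ring R]

theorem IsSES.desc {A B C Z : Type u} [AddCommGroup A] [Module R A] [AddCommGroup B] [Module R B]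
    [AddCommGroup C] [Module R C] [AddCommGroup Z] [Module R Z] {f : A →ₗ[R] B} {g : B →ₗ[R] C}
    (h : IsSES f g) (k : B →ₗ[R] Z) (hk : k ∘ₗ f = 0) : ∃ k' : C →ₗ[R] Z, k' ∘ₗ g = k := by
  refine ⟨(LinearMap.ker g).liftQ k ?_ ∘ₗ (g.quotKerEquivOfSurjective h.surj).symm.toLinearMap, ?_⟩
  · intro x hx
    obtain ⟨a, rfl⟩ := (h.exact x).1 hx
    exact LinearMap.congr_fun hk a
  · ext x
    have h1 : (g.quotKerEquivOfSurjective h.surj).symm (g x) = (LinearMap.ker g).mkQ x := by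
      rw [LinearEquiv.symm_apply_eq]; rfl
    simp [h1]

theorem IsSES.factor {A B C Z : Type u} [AddCommGroup A] [Module R A] [AddCommGroup B] [Module R B]
    [AddCommGroup C] [Module R C] [AddCommGroup Z] [Module R Z] {f : A →ₗ[R] B} {g : B →ₗ[R] C}
    (h : IsSES f g) (k : Z →ₗ[R] B) (hk : g ∘ₗ k = 0) : ∃ k' : Z →ₗ[R] A, f ∘ₗ k' = k := by
  have hk' : ∀ z, k z ∈ LinearMap.range f := fun z =>
    (h.exact _).1 (LinearMap.congr_fun hk z)
  refine ⟨(LinearEquiv.ofInjective f h.inj).symm.toLinearMap ∘ₗ k.codRestrict _ hk', ?_⟩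
  ext z
  have h1 := LinearEquiv.apply_symm_apply (LinearEquiv.ofInjective f h.inj) ⟨k z, hk' z⟩
  exact congrArg Subtype.val h1

theorem SES.equiv_of_subsingleton {A B C : FGModuleCat.{u} R} (h : SES A B C) [Subsingleton C] :
    Nonempty (A ≃ₗ[R] B) := by
  obtain ⟨f, g, h⟩ := h
  exact ⟨LinearEquiv.ofBijective f ⟨h.inj, fun b => (h.exact b).1 (Subsingleton.elim _ _)⟩⟩

theorem ses_dsum' (A B : FGModuleCat.{u} R) : SES B (dsum A B) A :=
  (ses_dsum B A).congr (LinearEquiv.refl R B) (LinearEquiv.prodComm R B A) (LinearEquiv.refl R A)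

theorem SES.quotient {A B C A' D : FGModuleCat.{u} R} (h : SES A B C) (h' : SES A' A D) :
    ∃ E : FGModuleCat.{u} R, SES D E C ∧ SES A' B E := by
  obtain ⟨f, g, h⟩ := h
  obtain ⟨f', g', h'⟩ := h'
  let p : Submodule R B := LinearMap.range (f ∘ₗ f')
  let E := FGModuleCat.of R (B ⧸ p)
  have h₂ : IsSES (f ∘ₗ f') p.mkQ := ⟨h.inj.comp h'.inj, fun x => by
    rw [← LinearMap.mem_ker, Submodule.ker_mkQ]; rfl, p.mkQ_surjective⟩
  obtain ⟨i, hi⟩ := h'.desc (p.mkQ ∘ₗ f) (by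
    ext a; exact h₂.apply_apply_eq_zero a)
  obtain ⟨q, hq⟩ := h₂.desc g (by
    ext a; exact h.apply_apply_eq_zero _)
  have hi' : ∀ a, i (g' a) = p.mkQ (f a) := fun a => LinearMap.congr_fun hi a
  have hq' : ∀ b, q (p.mkQ b) = g b := fun b => LinearMap.congr_fun hq b
  refine ⟨E, IsSES.ses (f := i) (g := q) ⟨?_, fun x => ⟨fun hx => ?_, ?_⟩, fun c => ?_⟩, h₂.ses⟩
  · rw [← LinearMap.ker_eq_bot, LinearMap.ker_eq_bot']
    intro d hd
    obtain ⟨a, rfl⟩ := h'.surj d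
    rw [hi'] at hd
    obtain ⟨a', ha'⟩ := (h₂.exact _).1 hd
    rw [← h.inj ha', h'.apply_apply_eq_zero]
  · obtain ⟨b, rfl⟩ := p.mkQ_surjective x
    rw [hq'] at hx
    obtain ⟨a, rfl⟩ := (h.exact b).1 hx
    exact ⟨g' a, hi' a⟩
  · rintro ⟨d, rfl⟩
    obtain ⟨a, rfl⟩ := h'.surj d
    rw [hi', hq', h.apply_apply_eq_zero]
  · obtain ⟨b, rfl⟩ := h.surj c
    exact ⟨p.mkQ b, hq' b⟩

variable [IsArtinianRing R]

theorem SES.preimage {A B C C' D : FGModuleCat.{u} R} (h : SES A B C) (h' : SES C' C D) :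
    ∃ B' : FGModuleCat.{u} R, SES A B' C' ∧ SES B' B D := by
  obtain ⟨f, g, h⟩ := h
  obtain ⟨f', g', h'⟩ := h'
  let B' := FGModuleCat.of R (LinearMap.ker (g' ∘ₗ g))
  refine ⟨B', ?_, ses_of_surjective (h'.surj.comp h.surj)⟩
  obtain ⟨q, hq⟩ := h'.factor (g ∘ₗ (LinearMap.ker (g' ∘ₗ g)).subtype) (by
    ext x; exact x.2)
  have hq' : ∀ x : B', f' (q x) = g x.1 := fun x => LinearMap.congr_fun hq x
  let i : A →ₗ[R] B' := f.codRestrict (LinearMap.ker (g' ∘ₗ g)) fun a => by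
    simp [h.apply_apply_eq_zero]
  refine IsSES.ses (f := i) (g := q) ⟨fun a b hab => h.inj (congrArg Subtype.val hab),
    fun x => ⟨fun hx => ?_, ?_⟩, fun c => ?_⟩
  · obtain ⟨a, ha⟩ := (h.exact x.1).1 (by rw [← hq', hx, map_zero])
    exact ⟨a, Subtype.ext ha⟩
  · rintro ⟨a, rfl⟩
    apply h'.inj
    rw [hq', map_zero]
    exact h.apply_apply_eq_zero a
  · obtain ⟨b, hb⟩ := h.surj (f' c)
    refine ⟨⟨b, ?_⟩, ?_⟩
    · rw [LinearMap.mem_ker, LinearMap.comp_apply, hb, h'.apply_apply_eq_zero]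
    · apply h'.inj
      rw [hq', hb]

end Sequences

/-! ### Sorting factors, independence of the support, closure under summands -/

section ListFiltration

variable {R : Type u} [Ring R] {t : ℕ}

/-- `M` has a filtration whose factors, from the top to the bottom, are the `θ i` for `i` in the
given list. -/
def ListFiltered (θ : Fin t → FGModuleCat.{u} R) : List (Fin t) → FGModuleCat.{u} R → Prop
  | [], M => Subsingleton M
  | i :: l, M => ∃ M' : FGModuleCat.{u} R, ListFiltered θ l M' ∧ SES M' M (θ i)

variable {θ : Fin t → FGModuleCat.{u} R}

theorem ListFiltered.congr {l : List (Fin t)} {M M' : FGModuleCat.{u} R}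
    (h : ListFiltered θ l M) (e : M ≃ₗ[R] M') : ListFiltered θ l M' := by
  cases l with
  | nil =>
    have : Subsingleton M := h
    exact e.symm.toEquiv.subsingleton
  | cons i l =>
    obtain ⟨N, hN, hs⟩ := h
    exact ⟨N, hN, hs.congr (LinearEquiv.refl R N) e (LinearEquiv.refl R _)⟩

theorem listFiltered_singleton (i : Fin t) : ListFiltered θ [i] (θ i) :=
  ⟨FGModuleCat.of R PUnit, inferInstanceAs (Subsingleton PUnit),
    ses_of_equiv_of_subsingleton (LinearEquiv.refl R _)⟩

theorem ListFiltered.extOneVanishes {l : List (Fin t)} {X Y : FGModuleCat.{u} R}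
    (hY : ListFiltered θ l Y) (h : ∀ i ∈ l, ExtOneVanishes X (θ i)) : ExtOneVanishes X Y := by
  induction l generalizing Y with
  | nil =>
    have : Subsingleton Y := hY
    exact .of_subsingleton
  | cons i l ih =>
    obtain ⟨Y', hY', f, g, hs⟩ := hY
    exact hs.extOneVanishes_covariant (ih hY' fun j hj => h j (by simp [hj])) (h i (by simp))

theorem ListFiltered.hom_eq_zero_right {l : List (Fin t)} {X Y : FGModuleCat.{u} R}
    (hY : ListFiltered θ l Y) (h : ∀ i ∈ l, ∀ φ : X →ₗ[R] θ i, φ = 0) (φ : X →ₗ[R] Y) :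
    φ = 0 := by
  induction l generalizing Y with
  | nil =>
    have : Subsingleton Y := hY
    ext x; exact Subsingleton.elim _ _
  | cons i l ih =>
    obtain ⟨Y', hY', f, g, hs⟩ := hY
    obtain ⟨k, rfl⟩ := hs.factor φ (h i (by simp) _)
    rw [ih hY' (fun j hj => h j (by simp [hj])) k, LinearMap.comp_zero]

theorem ListFiltered.hom_eq_zero_left {l : List (Fin t)} {X Y : FGModuleCat.{u} R}
    (hX : ListFiltered θ l X) (h : ∀ i ∈ l, ∀ φ : θ i →ₗ[R] Y, φ = 0) (φ : X →ₗ[R] Y) :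
    φ = 0 := by
  induction l generalizing X with
  | nil =>
    have : Subsingleton X := hX
    ext x; rw [Subsingleton.elim x 0, map_zero, map_zero]
  | cons i l ih =>
    obtain ⟨X', hX', f, g, hs⟩ := hX
    obtain ⟨k, rfl⟩ := hs.desc φ (ih hX' (fun j hj => h j (by simp [hj])) _)
    rw [h i (by simp) k, LinearMap.zero_comp]

theorem ListFiltered.eq_nil_of_subsingleton {l : List (Fin t)} {M : FGModuleCat.{u} R}
    (hθ : IsStratifyingSystem θ) (h : ListFiltered θ l M) [Subsingleton M] : l = [] := by
  cases l with
  | nil => rfl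
  | cons i l =>
    obtain ⟨M', hM', f, g, hs⟩ := h
    have := (hθ.indecomposable i).1
    exact (not_subsingleton (θ i) hs.surj.subsingleton).elim

theorem ListFiltered.hom_eq_zero {l l' : List (Fin t)} {X Y : FGModuleCat.{u} R}
    (hθ : IsStratifyingSystem θ) (hX : ListFiltered θ l X) (hY : ListFiltered θ l' Y)
    (h : ∀ i ∈ l, ∀ j ∈ l', j < i) (φ : X →ₗ[R] Y) : φ = 0 :=
  hX.hom_eq_zero_left (fun i hi => hY.hom_eq_zero_right fun j hj =>
    hθ.hom_zero j i (h i hi j hj)) φ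

/-- The vanishing conditions make each submodule factor through the other inside `M`. -/
theorem SES.equiv_of_hom_eq_zero {A M B A' B' : FGModuleCat.{u} R} (h : SES A M B)
    (h' : SES A' M B') (h0 : ∀ φ : A →ₗ[R] B', φ = 0) (h0' : ∀ φ : A' →ₗ[R] B, φ = 0) :
    Nonempty (A ≃ₗ[R] A') := by
  obtain ⟨f, g, h⟩ := h
  obtain ⟨f', g', h'⟩ := h'
  obtain ⟨a, ha⟩ := h'.factor f (h0 _)
  obtain ⟨b, hb⟩ := h.factor f' (h0' _)
  refine ⟨LinearEquiv.ofLinearMap a b ?_ ?_⟩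
  · refine LinearMap.ext fun x => h'.inj ?_
    have h1 := LinearMap.congr_fun ha (b x)
    have h2 := LinearMap.congr_fun hb x
    exact h1.trans h2
  · refine LinearMap.ext fun x => h.inj ?_
    have h1 := LinearMap.congr_fun ha x
    have h2 := LinearMap.congr_fun hb (a x)
    exact h2.trans h1

variable [IsArtinianRing R]

theorem ListFiltered.append {l l' : List (Fin t)} {A B C : FGModuleCat.{u} R}
    (hC : ListFiltered θ l C) (hA : ListFiltered θ l' A) (h : SES A B C) :
    ListFiltered θ (l ++ l') B := by
  induction l generalizing B C with
  | nil =>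
    have : Subsingleton C := hC
    obtain ⟨e⟩ := h.equiv_of_subsingleton
    exact hA.congr e
  | cons i l ih =>
    obtain ⟨C', hC', hs⟩ := hC
    obtain ⟨B', h1, h2⟩ := h.preimage hs
    exact ⟨B', ih hC' h1, h2⟩

theorem ListFiltered.dsum {l l' : List (Fin t)} {A B : FGModuleCat.{u} R}
    (hA : ListFiltered θ l A) (hB : ListFiltered θ l' B) : ListFiltered θ (l ++ l') (dsum A B) :=
  hA.append hB (ses_dsum' A B)

/-- Work upwards from the bottom. A top factor satisfying `p` joins the quotient `B`; otherwise
`Ext¹(θ i, B) = 0` splits it from `B`, and it can be moved down into the submodule. -/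
theorem ListFiltered.split {l : List (Fin t)} {M : FGModuleCat.{u} R} (p : Fin t → Prop)
    [DecidablePred p] (h : ListFiltered θ l M)
    (hp : ∀ i j, ¬ p i → p j → ExtOneVanishes (θ i) (θ j)) :
    ∃ A B : FGModuleCat.{u} R, SES A M B ∧ ListFiltered θ (l.filter fun i => ¬ p i) A ∧
      ListFiltered θ (l.filter fun i => p i) B := by
  induction l generalizing M with
  | nil =>
    have : Subsingleton M := h
    exact ⟨M, M, ses_of_equiv_of_subsingleton (LinearEquiv.refl R M), h, h⟩
  | cons i l ih =>
    obtain ⟨M', hM', hs⟩ := h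
    obtain ⟨A, B, hAB, hA, hB⟩ := ih hM'
    obtain ⟨E, hE, hE'⟩ := hs.quotient hAB
    by_cases hi : p i
    · refine ⟨A, E, hE', ?_, ?_⟩
      · simpa [List.filter_cons, hi] using hA
      · simp only [List.filter_cons, hi, decide_true, if_true]
        exact ⟨B, hB, hE⟩
    · have hext : ExtOneVanishes (θ i) B := hB.extOneVanishes fun j hj =>
        hp i j hi (by simpa using (List.mem_filter.1 hj).2)
      obtain ⟨e⟩ := hE.split_of_extOneVanishes hext
      obtain ⟨A', h1, h2⟩ := hE'.preimage ((ses_dsum' B (θ i)).congr (LinearEquiv.refl R _) e.symm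
        (LinearEquiv.refl R _))
      refine ⟨A', B, h2, ?_, ?_⟩
      · simp only [List.filter_cons, hi, not_false_eq_true, decide_true, if_true]
        exact ⟨A, hA, h1⟩
      · simpa [List.filter_cons, hi] using hB

/-- Splitting off the factors of small index as a quotient. -/
theorem ListFiltered.split_lt {l : List (Fin t)} {M : FGModuleCat.{u} R}
    (hθ : IsStratifyingSystem θ) (h : ListFiltered θ l M) (c : ℕ) :
    ∃ A B : FGModuleCat.{u} R, SES A M B ∧
      ListFiltered θ (l.filter fun i : Fin t => ¬ (i : ℕ) < c) A ∧
      ListFiltered θ (l.filter fun i : Fin t => (i : ℕ) < c) B :=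
  h.split (fun i : Fin t => (i : ℕ) < c) fun i j hi hj => hθ.ext_zero j i (Fin.le_def.2 (by omega))

/-- The set of indices occurring in a filtration does not depend on the filtration. -/
theorem ListFiltered.mem_of_mem {l l' : List (Fin t)} {M : FGModuleCat.{u} R}
    (hθ : IsStratifyingSystem θ) (h : ListFiltered θ l M) (h' : ListFiltered θ l' M)
    {c : Fin t} (hc : c ∈ l) : c ∈ l' := by
  by_contra hc'
  obtain ⟨A, B, hs, hA, hB⟩ := h.split_lt hθ c
  obtain ⟨A', B', hs', hA', hB'⟩ := h'.split_lt hθ c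
  have hlt : ∀ l₁ l₂ : List (Fin t), ∀ i ∈ l₁.filter fun i : Fin t => ¬ (i : ℕ) < c,
      ∀ j ∈ l₂.filter fun i : Fin t => (i : ℕ) < c, j < i := by
    intro l₁ l₂ i hi j hj
    simp only [List.mem_filter, decide_eq_true_eq] at hi hj
    exact Fin.lt_def.2 (by omega)
  -- The part with indices at least `c` is determined by `M`, as there are no maps from larger to
  -- smaller indices. So both filtrations yield the same submodule up to isomorphism.
  obtain ⟨e⟩ := hs.equiv_of_hom_eq_zero hs' (hA.hom_eq_zero hθ hB' (hlt _ _))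
    (hA'.hom_eq_zero hθ hB (hlt _ _))
  obtain ⟨A₂, G, ⟨f, g, hG⟩, -, hGl⟩ := hA.split_lt hθ (c + 1)
  -- Every factor of `G` has index `c`, whereas all those of `A'` have index above `c` since `c ∉
  -- l'`. Hence `G = 0`, although `c` occurs in its list.
  have hg : g = 0 := (hA'.congr e.symm).hom_eq_zero hθ hGl (by
    intro i hi j hj
    simp only [List.mem_filter, decide_eq_true_eq] at hi hj
    have h1 : i ≠ c := by rintro rfl; exact hc' hi.1
    have h2 := Fin.val_ne_of_ne h1
    exact Fin.lt_def.2 (by omega)) g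
  have hsub : Subsingleton G := by
    refine ⟨fun x y => ?_⟩
    obtain ⟨x, rfl⟩ := hG.surj x
    obtain ⟨y, rfl⟩ := hG.surj y
    rw [hg]; rfl
  have h1 := hGl.eq_nil_of_subsingleton hθ
  have h2 : c ∈ (l.filter fun i : Fin t => ¬ (i : ℕ) < c).filter fun i : Fin t => (i : ℕ) < c + 1 := by
    simp [hc]
  rw [h1] at h2
  simp at h2

/-- As `θ c` has no self-extensions, `M` is a direct sum of copies of `θ c`, and the exchange
property applies. -/
theorem ListFiltered.indecomposable_summand {l : List (Fin t)} {M X : FGModuleCat.{u} R}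
    (hθ : IsStratifyingSystem θ) (h : ListFiltered θ l M) {c : Fin t} (hl : ∀ i ∈ l, i = c)
    (hX : IsIndecomposable R X) (hXM : IsSummand X M) :
    c ∈ l ∧ Nonempty (θ c ≃ₗ[R] X) := by
  have := hX.1
  induction l generalizing M with
  | nil =>
    have : Subsingleton M := h
    exact (not_subsingleton X hXM.subsingleton).elim
  | cons i l ih =>
    obtain rfl : i = c := hl i (by simp)
    have hl' : ∀ j ∈ l, j = i := fun j hj => hl j (by simp [hj])
    obtain ⟨M', hM', hs⟩ := h
    obtain ⟨e⟩ := hs.split_of_extOneVanishes (hM'.extOneVanishes fun j hj => by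
      rw [hl' j hj]; exact hθ.ext_zero i i le_rfl)
    refine ⟨by simp, ?_⟩
    rcases hX.summand_prod e hXM with h1 | h1
    · exact (ih hM' hl' h1).2
    · exact (hθ.indecomposable i).equiv_of_summand h1

/-- Since `Hom(T, N) = 0`, the idempotent of `M` with image `X` preserves `T`, so it splits both `T`
and `N`. The submodule `X₁` is the image of `T` in `X`. -/
theorem SES.summand {X T M N : FGModuleCat.{u} R} (h : SES T M N) (hX : IsSummand X M)
    (h0 : ∀ φ : T →ₗ[R] N, φ = 0) :
    ∃ X₁ X₂ : FGModuleCat.{u} R, SES X₁ X X₂ ∧ IsSummand X₁ T ∧ IsSummand X₂ N := by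
  obtain ⟨f, g, h⟩ := h
  obtain ⟨i, p, hp⟩ := hX.exists_retract
  have hp' : ∀ x, p (i x) = x := fun x => LinearMap.congr_fun hp x
  let X₁ : Submodule R X := LinearMap.range (p ∘ₗ f)
  have hgi : ∀ x ∈ X₁, g (i x) = 0 := by
    rintro _ ⟨y, rfl⟩
    exact LinearMap.congr_fun (h0 (g ∘ₗ i ∘ₗ p ∘ₗ f)) y
  obtain ⟨a, ha⟩ := h.factor (i ∘ₗ X₁.subtype) (by ext x; exact hgi x.1 x.2)
  obtain ⟨b, hb⟩ := h.desc (X₁.mkQ ∘ₗ p) (by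
    ext x
    rw [LinearMap.comp_apply, LinearMap.comp_apply, Submodule.mkQ_apply, LinearMap.zero_apply,
      Submodule.Quotient.mk_eq_zero]
    exact ⟨x, rfl⟩)
  have ha' : ∀ x, f (a x) = i x.1 := fun x => LinearMap.congr_fun ha x
  have hb' : ∀ m, b (g m) = X₁.mkQ (p m) := fun x => LinearMap.congr_fun hb x
  refine ⟨FGModuleCat.of R X₁, FGModuleCat.of R (X ⧸ X₁), (IsSES.mkQ X₁).ses, ?_, ?_⟩
  · refine IsSummand.of_retract a ((p ∘ₗ f).codRestrict X₁ fun y => ⟨y, rfl⟩) ?_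
    refine LinearMap.ext fun x => Subtype.ext ?_
    change p (f (a x)) = x.1
    rw [ha', hp']
  · refine IsSummand.of_retract (X₁.liftQ (g ∘ₗ i) fun x hx => hgi x hx) b ?_
    refine LinearMap.ext fun x => ?_
    obtain ⟨x, rfl⟩ := X₁.mkQ_surjective x
    change b (g (i x)) = X₁.mkQ x
    rw [hb', hp']

/-- `ℱ(θ)` is closed under direct summands. -/
theorem ListFiltered.summand {l : List (Fin t)} {M X : FGModuleCat.{u} R}
    (hθ : IsStratifyingSystem θ) (h : ListFiltered θ l M) (hX : IsSummand X M) :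
    ∃ l', l' ⊆ l ∧ ListFiltered θ l' X := by
  obtain ⟨c, hc⟩ : ∃ c : ℕ, ∀ i ∈ l, (i : ℕ) < c := ⟨t, fun i _ => i.2⟩
  induction c generalizing l M X with
  | zero =>
    obtain rfl : l = [] := List.eq_nil_iff_forall_not_mem.2 fun i hi => absurd (hc i hi) (by omega)
    have : Subsingleton M := h
    exact ⟨[], by simp, hX.subsingleton⟩
  | succ c ih =>
    obtain ⟨T, N, hs, hT, hN⟩ := h.split_lt hθ c
    obtain ⟨X₁, X₂, hs', h₁, h₂⟩ := hs.summand hX (hT.hom_eq_zero hθ hN (by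
      intro i hi j hj
      simp only [List.mem_filter, decide_eq_true_eq] at hi hj
      exact Fin.lt_def.2 (by omega)))
    obtain ⟨l₂, hl₂, hX₂⟩ := ih hN h₂ (by simp)
    -- All factors of `T` have the largest admissible index, so `T` is a sum of copies of a single
    -- `θ d`, and summands can be treated through their indecomposable pieces.
    have hX₁ : ∃ l₁ ⊆ l.filter fun i : Fin t => ¬ (i : ℕ) < c, ListFiltered θ l₁ X₁ := by
      have key : ∀ Y : FGModuleCat.{u} R, IsSummand Y T →
          ∃ l₁ ⊆ l.filter fun i : Fin t => ¬ (i : ℕ) < c, ListFiltered θ l₁ Y := by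
        intro Y hY
        induction Y using indecomposable_induction with
        | zero Y hY' => exact ⟨[], by simp, hY'⟩
        | indecomposable Y hY' =>
          have hne : (l.filter fun i : Fin t => ¬ (i : ℕ) < c) ≠ [] := by
            intro h0
            rw [h0] at hT
            have hT' : Subsingleton T := hT
            have := hY'.1
            exact not_subsingleton Y hY.subsingleton
          obtain ⟨d, hd⟩ := List.exists_mem_of_ne_nil _ hne
          have hall : ∀ i ∈ l.filter (fun i : Fin t => ¬ (i : ℕ) < c), i = d := by
            intro i hi
            simp only [List.mem_filter, decide_eq_true_eq] at hi hd
            have h1 := hc i hi.1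
            have h2 := hc d hd.1
            exact Fin.ext (by omega)
          obtain ⟨h1, ⟨e⟩⟩ := hT.indecomposable_summand hθ hall hY' hY
          exact ⟨[d], by simpa using h1, (listFiltered_singleton d).congr e⟩
        | prod A B Y e hA hB =>
          have hY' : IsSummand (StratSys.dsum A B) Y := .of_equiv e
          obtain ⟨l₁, hl₁, h1⟩ := hA (((isSummand_dsum_left A B).trans hY').trans hY)
          obtain ⟨l₂, hl₂, h2⟩ := hB (((isSummand_dsum_right A B).trans hY').trans hY)
          exact ⟨l₁ ++ l₂, List.append_subset.2 ⟨hl₁, hl₂⟩, (h1.dsum h2).congr e.symm⟩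
      exact key X₁ h₁
    obtain ⟨l₁, hl₁, hX₁⟩ := hX₁
    refine ⟨l₂ ++ l₁, List.append_subset.2 ⟨List.Subset.trans hl₂ List.filter_sublist.subset,
      List.Subset.trans hl₁ List.filter_sublist.subset⟩, hX₂.append hX₁ hs'⟩

end ListFiltration

/-! ### Comparison with chains of submodules -/

section Comparison

variable {R : Type u} [Ring R] {t : ℕ} {θ : Fin t → FGModuleCat.{u} R}

theorem isSES_inclusion {M N : Type u} [AddCommGroup M] [Module R M] [AddCommGroup N] [Module R N]
    {p q : Submodule R M} (h : p ≤ q) (e : (q ⧸ p.submoduleOf q) ≃ₗ[R] N) :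
    IsSES (Submodule.inclusion h) (e.toLinearMap ∘ₗ (p.submoduleOf q).mkQ) := by
  refine ⟨Submodule.inclusion_injective h, fun x => ?_,
    e.surjective.comp (Submodule.mkQ_surjective _)⟩
  have h1 : (e.toLinearMap ∘ₗ (p.submoduleOf q).mkQ) x = 0 ↔ x.1 ∈ p := by
    rw [LinearMap.comp_apply, LinearEquiv.coe_coe, map_eq_zero_iff e e.injective,
      Submodule.mkQ_apply, Submodule.Quotient.mk_eq_zero]
    rfl
  rw [h1]
  exact ⟨fun hx => ⟨⟨x.1, hx⟩, rfl⟩, by rintro ⟨y, rfl⟩; exact y.2⟩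

/-- A chain from `⊥` to `N` with factors among the `θ i`. -/
theorem ListFiltered.exists_chain {M : Type u} [AddCommGroup M] [Module R M]
    {l : List (Fin t)} {N : FGModuleCat.{u} R} (h : ListFiltered θ l N) (f : N →ₗ[R] M)
    (hf : Function.Injective f) :
    ∃ (n : ℕ) (c : ℕ → Submodule R M), c 0 = ⊥ ∧ c n = LinearMap.range f ∧
      ∀ j < n, c j ≤ c (j + 1) ∧
        ∃ i, Nonempty ((c (j + 1) ⧸ (c j).submoduleOf (c (j + 1))) ≃ₗ[R] θ i) := by
  induction l generalizing N with
  | nil =>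
    have : Subsingleton N := h
    refine ⟨0, fun _ => ⊥, rfl, ?_, by simp⟩
    rw [eq_comm, LinearMap.range_eq_bot]
    ext x
    rw [Subsingleton.elim x 0, map_zero, map_zero]
  | cons i l ih =>
    obtain ⟨N', hN', f', g, hs⟩ := h
    obtain ⟨n, c, h0, hn, hc⟩ := ih hN' (f ∘ₗ f') (hf.comp hs.inj)
    obtain ⟨d, hd, hd'⟩ : ∃ d : ℕ → Submodule R M, (∀ j ≤ n, d j = c j) ∧
        d (n + 1) = LinearMap.range f :=
      ⟨fun j => if j ≤ n then c j else LinearMap.range f, fun j hj => if_pos hj,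
        if_neg (by omega)⟩
    refine ⟨n + 1, d, by rw [hd 0 n.zero_le, h0], hd', fun j hj => ?_⟩
    rcases Nat.lt_succ_iff_lt_or_eq.1 hj with hj | rfl
    · rw [hd j hj.le, hd (j + 1) hj]
      exact hc j hj
    · rw [hd j le_rfl, hd', hn]
      refine ⟨LinearMap.range_comp_le_range _ _, i, ⟨?_⟩⟩
      let e := LinearEquiv.ofInjective f hf
      refine (Submodule.Quotient.equiv _ (LinearMap.ker g) e.symm ?_).trans
        (g.quotKerEquivOfSurjective hs.surj)
      ext x
      simp only [Submodule.mem_map]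
      constructor
      · rintro ⟨y, ⟨z, hz⟩, rfl⟩
        have h1 : e (f' z) = y := Subtype.ext hz
        rw [← h1]
        simpa using hs.apply_apply_eq_zero z
      · intro hx
        obtain ⟨z, rfl⟩ := (hs.exact x).1 hx
        exact ⟨e (f' z), ⟨z, rfl⟩, by simp⟩

theorem ListFiltered.nonempty_filtration {l : List (Fin t)} {M : FGModuleCat.{u} R}
    (h : ListFiltered θ l M) : Nonempty (Filtration θ M) := by
  obtain ⟨n, c, h0, hn, hc⟩ := h.exists_chain (M := M) LinearMap.id Function.injective_id
  choose hle i hi using hc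
  exact ⟨{
    length := n
    chain := fun j => c j
    idx := fun j => i j j.2
    bot := h0
    top := by simpa using hn
    le := fun j => hle j j.2
    factor := fun j => hi j j.2 }⟩

variable [IsArtinianRing R]

theorem Filtration.exists_list {M : FGModuleCat.{u} R} (F : Filtration θ M) :
    ∃ l, ListFiltered θ l M ∧ ∀ i, i ∈ l ↔ F.count i ≠ 0 := by
  have key : ∀ (n : ℕ) (hn : n < F.length + 1), ∃ l,
      ListFiltered θ l (FGModuleCat.of R (F.chain ⟨n, hn⟩)) ∧
      ∀ i, i ∈ l ↔ ∃ j : Fin F.length, (j : ℕ) < n ∧ F.idx j = i := by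
    intro n
    induction n with
    | zero =>
      intro hn
      refine ⟨[], ?_, by simp⟩
      have h0 : F.chain ⟨0, hn⟩ = ⊥ := F.bot
      change Subsingleton (F.chain ⟨0, hn⟩)
      rw [h0]
      infer_instance
    | succ n ih =>
      intro hn
      obtain ⟨l, hl, hl'⟩ := ih (by omega)
      let j : Fin F.length := ⟨n, by omega⟩
      obtain ⟨e⟩ := F.factor j
      refine ⟨F.idx j :: l, ⟨_, hl, (isSES_inclusion (F.le j) e).ses⟩, fun i => ?_⟩
      rw [List.mem_cons, hl']
      constructor
      · rintro (rfl | ⟨j', hj', rfl⟩)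
        · exact ⟨j, n.lt_succ_self, rfl⟩
        · exact ⟨j', by omega, rfl⟩
      · rintro ⟨j', hj', rfl⟩
        rcases Nat.lt_succ_iff_lt_or_eq.1 hj' with h | h
        · exact Or.inr ⟨j', h, rfl⟩
        · exact Or.inl (congrArg F.idx (Fin.ext h))
  obtain ⟨l, hl, hl'⟩ := key F.length F.length.lt_succ_self
  refine ⟨l, hl.congr ((LinearEquiv.ofEq _ _ F.top).trans Submodule.topEquiv), fun i => ?_⟩
  rw [hl', Filtration.count, Finset.card_ne_zero, Finset.filter_nonempty_iff]
  exact ⟨fun ⟨j, _, h⟩ => ⟨j, Finset.mem_univ _, h⟩, fun ⟨j, _, h⟩ => ⟨j, j.2, h⟩⟩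

theorem mem_filtered_iff {M : FGModuleCat.{u} R} :
    M ∈ filtered θ ↔ ∃ l, ListFiltered θ l M :=
  ⟨fun ⟨F⟩ => F.exists_list.imp fun _ h => h.1, fun ⟨_, h⟩ => h.nonempty_filtration⟩

/-- `supp` is read off one chosen filtration; independence of the occurring indices makes any list
equally good. -/
theorem ListFiltered.mem_supp_iff (hθ : IsStratifyingSystem θ) {l : List (Fin t)}
    {M : FGModuleCat.{u} R} (h : ListFiltered θ l M) (i : Fin t) : i ∈ supp θ M ↔ i ∈ l := by
  have hne := h.nonempty_filtration
  obtain ⟨l', hl', hmem⟩ := hne.some.exists_list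
  have h1 : mult θ M i = hne.some.count i := dif_pos hne
  rw [supp, Set.mem_ofPred_eq, h1, ← hmem]
  exact ⟨fun hi => hl'.mem_of_mem hθ h hi, fun hi => h.mem_of_mem hθ hl' hi⟩

/-- Filter the product by the families that vanish at all indices from `c` on; evaluation at `c`
identifies the next factor with `θ c`. -/
theorem exists_listFiltered_pi (θ : Fin t → FGModuleCat.{u} R) :
    ∃ l, ListFiltered θ l (FGModuleCat.of R (∀ i, θ i)) := by
  let P : ℕ → Submodule R (∀ i, θ i) := fun c =>
    { carrier := {x | ∀ i : Fin t, c ≤ i → x i = 0}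
      add_mem' := fun hx hy i hi => by
        rw [Pi.add_apply, hx i hi, hy i hi, add_zero]
      zero_mem' := fun _ _ => rfl
      smul_mem' := fun r x hx i hi => by rw [Pi.smul_apply, hx i hi, smul_zero] }
  have hP : ∀ c x, x ∈ P c ↔ ∀ i : Fin t, c ≤ i → x i = 0 := fun c x => Iff.rfl
  have key : ∀ c ≤ t, ∃ l, ListFiltered θ l (FGModuleCat.of R (P c)) := by
    intro c
    induction c with
    | zero =>
      intro _
      exact ⟨[], ⟨fun x y => Subtype.ext (funext fun i =>
        (x.2 i (Nat.zero_le _)).trans (y.2 i (Nat.zero_le _)).symm)⟩⟩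
    | succ c ih =>
      intro hc
      obtain ⟨l, hl⟩ := ih (by omega)
      let j : Fin t := ⟨c, hc⟩
      have hle : P c ≤ P (c + 1) := fun x hx i hi => hx i (by omega)
      refine ⟨j :: l, _, hl, IsSES.ses (f := Submodule.inclusion hle)
        (g := LinearMap.proj j ∘ₗ (P (c + 1)).subtype)
        ⟨Submodule.inclusion_injective hle, fun x => ⟨fun hx => ?_, ?_⟩, fun y => ?_⟩⟩
      · refine ⟨⟨x.1, fun i hi => ?_⟩, rfl⟩
        rcases Nat.eq_or_lt_of_le hi with h | h
        · obtain rfl : j = i := Fin.ext h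
          exact hx
        · exact x.2 i h
      · rintro ⟨y, rfl⟩
        exact y.2 j le_rfl
      · refine ⟨⟨Pi.single (M := fun i => (θ i : Type u)) j y, fun i hi => ?_⟩, ?_⟩
        · refine Pi.single_eq_of_ne (M := fun i => (θ i : Type u)) (fun h => ?_) y
          subst h
          exact absurd hi (Nat.not_succ_le_self c)
        · exact Pi.single_eq_same (M := fun i => (θ i : Type u)) j y
  obtain ⟨l, hl⟩ := key t le_rfl
  have htop : P t = ⊤ := eq_top_iff.2 fun x _ i hi => absurd i.2 (by omega)
  exact ⟨l, hl.congr ((LinearEquiv.ofEq _ _ htop).trans Submodule.topEquiv)⟩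

end Comparison

/-! ### `Ext`-projective covers -/

section Covers

theorem ListFiltered.extOneVanishes_left {R : Type u} [Ring R] {t : ℕ}
    {θ : Fin t → FGModuleCat.{u} R} {l : List (Fin t)} {X Y : FGModuleCat.{u} R}
    (hX : ListFiltered θ l X) (h : ∀ i ∈ l, ExtOneVanishes (θ i) Y) : ExtOneVanishes X Y := by
  induction l generalizing X with
  | nil =>
    have : Subsingleton X := hX
    exact .of_projective inferInstance
  | cons i l ih =>
    obtain ⟨X', hX', f, g, hs⟩ := hX
    exact hs.extOneVanishes_middle (ih hX' fun j hj => h j (by simp [hj])) (h i (by simp))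

/-- For finitely generated modules `K`, `Y` over a finite-dimensional algebra, finitely many
homomorphisms generate `Hom(K, Y)` as an `End(Y)`-module. -/
theorem exists_finset_generating_hom (k : Type v) [Field k] {R : Type u} [Ring R] [Algebra k R]
    [Module.Finite k R] (K Y : FGModuleCat.{u} R) :
    ∃ S : Finset (K →ₗ[R] Y), ∀ (W : FGModuleCat.{u} R) (F : K →ₗ[R] W),
      (∀ a ∈ S, ∃ b : W →ₗ[R] Y, b ∘ₗ F = a) → ∀ a : K →ₗ[R] Y, ∃ b : W →ₗ[R] Y, b ∘ₗ F = a := by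
  let : Module k K := Module.compHom K (algebraMap k R)
  let : Module k Y := Module.compHom Y (algebraMap k R)
  have : IsScalarTower k R K := IsScalarTower.of_algebraMap_smul fun _ _ => rfl
  have : IsScalarTower k R Y := IsScalarTower.of_algebraMap_smul fun _ _ => rfl
  have : SMulCommClass R k Y := ⟨fun r c y => by
    rw [← algebraMap_smul R c y, ← algebraMap_smul R c (r • y), ← mul_smul, ← mul_smul,
      Algebra.commutes]⟩
  have : Module.Finite k K := Module.Finite.trans R K
  have : Module.Finite k Y := Module.Finite.trans R Y
  let ι : (K →ₗ[R] Y) →ₗ[k] (K →ₗ[k] Y) :=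
    { toFun := fun f => f.restrictScalars k
      map_add' := fun _ _ => rfl
      map_smul' := fun _ _ => rfl }
  have hι : Function.Injective ι := LinearMap.restrictScalars_injective k
  have : Module.Finite k (K →ₗ[R] Y) := Module.Finite.of_injective ι hι
  -- A finite spanning set over `k` is enough: the maps that extend along a given `F` form a
  -- `k`-subspace.
  obtain ⟨S, hS⟩ := Module.Finite.fg_top (R := k) (M := K →ₗ[R] Y)
  refine ⟨S, fun W F h a => ?_⟩
  have ha : a ∈ Submodule.span k (S : Set (K →ₗ[R] Y)) := by rw [hS]; trivial
  induction ha using Submodule.span_induction with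
  | mem a ha => exact h a ha
  | zero => exact ⟨0, LinearMap.zero_comp _⟩
  | add a a' _ _ h h' =>
    obtain ⟨b, rfl⟩ := h
    obtain ⟨b', rfl⟩ := h'
    exact ⟨b + b', LinearMap.add_comp _ _ _⟩
  | smul c a _ h =>
    obtain ⟨b, rfl⟩ := h
    exact ⟨c • b, LinearMap.smul_comp _ _ _⟩

variable {R : Type u} [Ring R] [IsArtinianRing R] {t : ℕ} {θ : Fin t → FGModuleCat.{u} R}

theorem exists_joint_hom (j : Fin t) {K : FGModuleCat.{u} R} (S : Finset (K →ₗ[R] θ j)) :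
    ∃ (W : FGModuleCat.{u} R) (F : K →ₗ[R] W) (l : List (Fin t)), ListFiltered θ l W ∧
      (∀ i ∈ l, i = j) ∧ ∀ a ∈ S, ∃ b : W →ₗ[R] θ j, b ∘ₗ F = a := by
  classical
  induction S using Finset.induction_on with
  | empty =>
    exact ⟨FGModuleCat.of R PUnit, 0, [], inferInstanceAs (Subsingleton PUnit), by simp, by simp⟩
  | insert a S _ ih =>
    obtain ⟨W, F, l, hW, hl, hS⟩ := ih
    refine ⟨dsum (θ j) W, a.prod F, [j] ++ l, (listFiltered_singleton j).dsum hW, by simpa using hl,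
      fun a' ha' => ?_⟩
    rcases Finset.mem_insert.1 ha' with rfl | ha'
    · exact ⟨LinearMap.fst R _ _, LinearMap.fst_prod _ _⟩
    · obtain ⟨b, rfl⟩ := hS a' ha'
      exact ⟨b ∘ₗ LinearMap.snd R _ _, by rw [LinearMap.comp_assoc, LinearMap.snd_prod]⟩

/-- The universal extension of `X` by copies of `θ j`. -/
theorem exists_universal_extension (k : Type v) [Field k] [Algebra k R] [Module.Finite k R]
    (hθ : IsStratifyingSystem θ) (j : Fin t) (X : FGModuleCat.{u} R) :
    ∃ (W X' : FGModuleCat.{u} R) (l : List (Fin t)), ListFiltered θ l W ∧ (∀ i ∈ l, i = j) ∧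
      SES W X' X ∧ ExtOneVanishes X' (θ j) := by
  obtain ⟨f, g, h⟩ := ses_syz X
  have hP := (isProjCover_coverMap X).projective
  obtain ⟨S, hS⟩ := exists_finset_generating_hom k (syz X) (θ j)
  obtain ⟨W, F, l, hW, hl, hF⟩ := exists_joint_hom j S
  have hF' := hS W F hF
  -- Pushout of the projective presentation of `X` along `F`. By the choice of `F`, every map `syz X
  -- → θ j` extends to `coverObj X × W`, which kills `Ext¹(X', θ j)`.
  let φ : syz X →ₗ[R] coverObj X × W := f.prod F
  let X' := FGModuleCat.of R ((coverObj X × W) ⧸ LinearMap.range φ)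
  let q : coverObj X × W →ₗ[R] X' := (LinearMap.range φ).mkQ
  have h₁ : IsSES (B := dsum (coverObj X) W) φ q :=
    ⟨fun x y hxy => h.inj (congrArg Prod.fst hxy), fun x => by
      rw [← LinearMap.mem_ker, Submodule.ker_mkQ]; rfl, Submodule.mkQ_surjective _⟩
  have hWj : ExtOneVanishes W (θ j) := hW.extOneVanishes_left fun i hi => by
    rw [hl i hi]; exact hθ.ext_zero j j le_rfl
  have hext : ExtOneVanishes X' (θ j) := by
    refine IsSES.extOneVanishes_right (B := dsum (coverObj X) W) h₁
      ((IsSES.inl_snd (coverObj X) W).extOneVanishes_middle (B := dsum (coverObj X) W)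
        (.of_projective hP) hWj) fun a => ?_
    obtain ⟨b, rfl⟩ := hF' a
    exact ⟨b ∘ₗ LinearMap.snd R _ _, by rw [LinearMap.comp_assoc, LinearMap.snd_prod]⟩
  obtain ⟨p, hp⟩ := h₁.desc (Z := X) (g ∘ₗ LinearMap.fst R (coverObj X) W) (by
    ext x; exact h.apply_apply_eq_zero x)
  have hp' : ∀ x, p (q x) = g x.1 := fun x => LinearMap.congr_fun hp x
  refine ⟨W, X', l, hW, hl, IsSES.ses (f := q ∘ₗ LinearMap.inr R (coverObj X) W) (g := p)
    ⟨?_, fun x => ⟨fun hx => ?_, ?_⟩, fun x => ?_⟩, hext⟩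
  · rw [← LinearMap.ker_eq_bot, LinearMap.ker_eq_bot']
    intro w hw
    obtain ⟨y, hy⟩ := (h₁.exact _).1 hw
    have h1 : f y = 0 := congrArg Prod.fst hy
    have h2 : F y = w := congrArg Prod.snd hy
    rw [← h2, (map_eq_zero_iff f h.inj).1 h1, map_zero]
  · obtain ⟨⟨a, w⟩, rfl⟩ := h₁.surj x
    rw [hp'] at hx
    obtain ⟨y, hy⟩ := (h.exact a).1 hx
    refine ⟨w - F y, ?_⟩
    change q (0, w - F y) = q (a, w)
    rw [← sub_eq_zero, ← map_sub, ← neg_eq_zero, ← map_neg, ← h₁.apply_apply_eq_zero y]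
    congr 1
    refine Prod.ext ?_ ?_
    · simp [φ, hy]
    · simp [φ]
  · rintro ⟨w, rfl⟩
    rw [LinearMap.comp_apply, hp']
    exact map_zero g
  · obtain ⟨a, rfl⟩ := h.surj x
    exact ⟨q (a, 0), hp' _⟩

/-- A `θ`-projective module mapping onto `θ i` with kernel filtered by `θ j`, `j > i`. -/
theorem exists_thetaProjective_onto (k : Type v) [Field k] [Algebra k R] [Module.Finite k R]
    (hθ : IsStratifyingSystem θ) (i : Fin t) :
    ∃ (Q K : FGModuleCat.{u} R) (l : List (Fin t)), SES K Q (θ i) ∧ ListFiltered θ l K ∧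
      (∀ j ∈ l, i < j) ∧ ∀ j, ExtOneVanishes Q (θ j) := by
  have key : ∀ c : ℕ, i < c → c ≤ t → ∃ (Q K : FGModuleCat.{u} R) (l : List (Fin t)),
      SES K Q (θ i) ∧ ListFiltered θ l K ∧ (∀ j ∈ l, i < j) ∧
      ∀ j : Fin t, (j : ℕ) < c → ExtOneVanishes Q (θ j) := by
    intro c hc
    induction c, hc using Nat.le_induction with
    | base =>
      intro _
      exact ⟨θ i, FGModuleCat.of R PUnit, [], ses_of_equiv_of_subsingleton (LinearEquiv.refl R _),
        inferInstanceAs (Subsingleton PUnit), by simp,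
        fun j hj => hθ.ext_zero j i (Fin.le_def.2 (by omega))⟩
    | succ c hc ih =>
      intro hct
      obtain ⟨Q, K, l, hs, hK, hl, hQ⟩ := ih (by omega)
      let j : Fin t := ⟨c, hct⟩
      obtain ⟨W, Q', l', hW, hl', hs', hQ'⟩ := exists_universal_extension k hθ j Q
      obtain ⟨K', h1, h2⟩ := hs'.preimage hs
      refine ⟨Q', K', l ++ l', h2, hK.append hW h1, fun m hm => ?_, fun m hm => ?_⟩
      · rcases List.mem_append.1 hm with hm | hm
        · exact hl m hm
        · rw [hl' m hm]
          exact Fin.lt_def.2 hc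
      · rcases Nat.lt_succ_iff_lt_or_eq.1 hm with hm | hm
        -- Extending by copies of `θ j` preserves the vanishing obtained earlier, since `Ext¹(θ j, θ
        -- m) = 0` for `m < j`.
        · obtain ⟨f, g, hs'⟩ := hs'
          refine hs'.extOneVanishes_middle (hW.extOneVanishes_left fun a ha => ?_) (hQ m hm)
          rw [hl' a ha]
          exact hθ.ext_zero m j (Fin.le_def.2 hm.le)
        · obtain rfl : m = j := Fin.ext hm
          exact hQ'
  obtain ⟨Q, K, l, hs, hK, hl, hQ⟩ := key t i.2 le_rfl
  exact ⟨Q, K, l, hs, hK, hl, fun j => hQ j j.2⟩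

/-- Gluing `θ`-projective modules mapping onto the factors of a filtration. -/
theorem ListFiltered.exists_approximation {P : FGModuleCat.{u} R → Prop} {S : Fin t → Prop}
    (zero : ∀ M : FGModuleCat.{u} R, Subsingleton M → P M)
    (prod : ∀ A B : FGModuleCat.{u} R, P A → P B → P (StratSys.dsum A B))
    {l : List (Fin t)} {M : FGModuleCat.{u} R} (h : ListFiltered θ l M)
    (hl : ∀ i ∈ l, ∃ (Q K : FGModuleCat.{u} R) (l' : List (Fin t)), SES K Q (θ i) ∧ P Q ∧
      (∀ j, ExtOneVanishes Q (θ j)) ∧ ListFiltered θ l' K ∧ ∀ j ∈ l', S j) :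
    ∃ (Q K : FGModuleCat.{u} R) (l' : List (Fin t)), SES K Q M ∧ P Q ∧
      (∀ j, ExtOneVanishes Q (θ j)) ∧ ListFiltered θ l' K ∧ ∀ j ∈ l', S j := by
  induction l generalizing M with
  | nil =>
    have : Subsingleton M := h
    exact ⟨M, M, [], ses_of_equiv_of_subsingleton (LinearEquiv.refl R M), zero M this,
      fun _ => .of_projective inferInstance, h, by simp⟩
  | cons i l ih =>
    obtain ⟨M', hM', f, g, hs⟩ := h
    obtain ⟨Q₁, K₁, l₁, ⟨f₁, g₁, h₁⟩, hP₁, hQ₁, hK₁, hl₁⟩ := ih hM' fun j hj => hl j (by simp [hj])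
    obtain ⟨Q₂, K₂, l₂, ⟨f₂, g₂, h₂⟩, hP₂, hQ₂, hK₂, hl₂⟩ := hl i (by simp)
    -- `Ext¹(Q₂, M') = 0`, so the map onto the top factor lifts to `M`, as the horseshoe
    -- construction requires.
    obtain ⟨s, hs'⟩ := hs.lift (hM'.extOneVanishes fun j _ => hQ₂ j) g₂
    obtain ⟨K, hK, hK'⟩ := hs.horseshoe h₁ h₂ hs'
    refine ⟨StratSys.dsum Q₁ Q₂, K, l₂ ++ l₁, hK', prod _ _ hP₁ hP₂, fun j => ?_, hK₂.append hK₁ hK, ?_⟩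
    · exact (IsSES.inl_snd Q₁ Q₂).extOneVanishes_middle (B := StratSys.dsum Q₁ Q₂) (hQ₁ j) (hQ₂ j)
    · intro j hj
      exact (List.mem_append.1 hj).elim (hl₂ j) (hl₁ j)

theorem mem_thetaProjective {Q : FGModuleCat.{u} R} (h : ∀ j, ExtOneVanishes Q (θ j)) :
    Q ∈ thetaProjective θ := fun _ hY => by
  obtain ⟨l, hl⟩ := mem_filtered_iff.1 hY
  exact hl.extOneVanishes fun j _ => h j

/-- A short exact sequence in `ℱ(θ)` with `θ`-projective middle term contains an `Ext`-projective
cover as a direct summand. -/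
theorem exists_isExtProjCover (hθ : IsStratifyingSystem θ) {K Q M : FGModuleCat.{u} R}
    (h : SES K Q M) (hM : M ∈ filtered θ) (hK : K ∈ filtered θ) (hQ : Q ∈ filtered θ)
    (hQ' : Q ∈ thetaProjective θ) :
    ∃ (Q₀ : FGModuleCat.{u} R) (ε : Q₀ →ₗ[R] M), IsExtProjCover θ ε ∧ IsSummand Q₀ Q ∧
      IsSummand (FGModuleCat.of R (LinearMap.ker ε)) K ∧
      SES (FGModuleCat.of R (LinearMap.ker ε)) Q₀ M := by
  have hsummand : ∀ {X Y : FGModuleCat.{u} R}, IsSummand X Y → Y ∈ filtered θ →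
      X ∈ filtered θ := by
    intro X Y hX hY
    obtain ⟨l, hl⟩ := mem_filtered_iff.1 hY
    obtain ⟨l', -, hl'⟩ := hl.summand hθ hX
    exact mem_filtered_iff.2 ⟨l', hl'⟩
  obtain ⟨i, f, h⟩ := h
  -- Right minimality comes from an endomorphism over `M` with minimal image: an endomorphism of
  -- that image over `M` cannot shrink it further, so it is surjective and therefore bijective.
  let S : Set (Submodule R Q) := {N | ∃ e : Module.End R Q, f ∘ₗ e = f ∧ LinearMap.range e = N}
  obtain ⟨N, ⟨e, hfe, rfl⟩, hmin⟩ := WellFounded.has_min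
    (wellFounded_lt (α := Submodule R Q)) S ⟨_, LinearMap.id, LinearMap.comp_id f, rfl⟩
  have hmin' : ∀ e' : Module.End R Q, f ∘ₗ e' = f → LinearMap.range e' ≤ LinearMap.range e →
      LinearMap.range e' = LinearMap.range e := fun e' he' hle => by
    by_contra hne
    exact hmin _ ⟨e', he', rfl⟩ (lt_of_le_of_ne hle hne)
  have hfe' : ∀ x, f (e x) = f x := fun x => LinearMap.congr_fun hfe x
  let Q₀ := FGModuleCat.of R (LinearMap.range e)
  let ι : Q₀ →ₗ[R] Q := (LinearMap.range e).subtype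
  let ε : Q₀ →ₗ[R] M := f ∘ₗ ι
  let ρ : Q →ₗ[R] Q₀ := e.rangeRestrict
  have hερ : ∀ x, ε (ρ x) = f x := fun x => hfe' x
  have hminimal : ∀ k : Q₀ →ₗ[R] Q₀, ε ∘ₗ k = ε → Function.Bijective k := by
    intro k hk
    have hk' : ∀ x, ε (k x) = ε x := fun x => LinearMap.congr_fun hk x
    refine IsNoetherian.bijective_of_surjective_endomorphism k fun x => ?_
    have h1 := hmin' (ι ∘ₗ k ∘ₗ ρ) (by
      ext x
      exact (hk' (ρ x)).trans (hερ x)) (by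
      rintro _ ⟨x, rfl⟩
      exact (k (ρ x)).2)
    have h2 : (x : Q) ∈ LinearMap.range (ι ∘ₗ k ∘ₗ ρ) := by rw [h1]; exact x.2
    obtain ⟨y, hy⟩ := h2
    exact ⟨ρ y, Subtype.ext hy⟩
  -- Minimality makes `e` invertible on its own image, which exhibits `Q₀` as a summand of `Q`, and
  -- `ker ε` as a summand of `K`.
  have hbij := hminimal (ρ ∘ₗ ι) (by ext x; exact hερ (ι x))
  let σ : Q₀ ≃ₗ[R] Q₀ := LinearEquiv.ofBijective (ρ ∘ₗ ι) hbij
  have hσ : ∀ x, σ x = ρ (ι x) := fun _ => rfl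
  have hεσ : ∀ x, ε (σ.symm x) = ε x := fun x => by
    conv_rhs => rw [← σ.apply_symm_apply x, hσ, hερ]
    rfl
  have hQ₀ : IsSummand Q₀ Q := by
    refine .of_retract ι (σ.symm.toLinearMap ∘ₗ ρ) ?_
    ext x
    rw [LinearMap.comp_apply, LinearMap.comp_apply, ← hσ, LinearEquiv.coe_coe,
      LinearEquiv.symm_apply_apply]
    rfl
  have hεsurj : Function.Surjective ε := fun m => by
    obtain ⟨x, rfl⟩ := h.surj m
    exact ⟨ρ x, hερ x⟩
  have hker : IsSummand (FGModuleCat.of R (LinearMap.ker ε)) K := by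
    obtain ⟨a, ha⟩ := h.factor (ι ∘ₗ (LinearMap.ker ε).subtype) (by ext x; exact x.2)
    have ha' : ∀ x, i (a x) = ι x.1 := fun x => LinearMap.congr_fun ha x
    refine .of_retract a ((σ.symm.toLinearMap ∘ₗ ρ ∘ₗ i).codRestrict (LinearMap.ker ε)
      fun x => ?_) ?_
    · change ε (σ.symm (ρ (i x))) = 0
      rw [hεσ, hερ, h.apply_apply_eq_zero]
    · refine LinearMap.ext fun x => Subtype.ext ?_
      change σ.symm (ρ (i (a x))) = x.1
      rw [ha', ← hσ, σ.symm_apply_apply]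
  have hses : SES (FGModuleCat.of R (LinearMap.ker ε)) Q₀ M := ses_of_surjective hεsurj
  refine ⟨Q₀, ε, ⟨hM, hsummand hQ₀ hQ, ?_, ?_, hminimal, hsummand hker hK⟩, hQ₀, hker, hses⟩
  · intro Y hY
    obtain ⟨i', p, hp⟩ := hQ₀.exists_retract
    exact .of_retract i' p hp (hQ' Y hY)
  · intro X hX g
    obtain ⟨b, hb⟩ := h.lift (hX K hK) g
    refine ⟨ρ ∘ₗ b, ?_⟩
    rw [← hb]
    ext x
    exact hερ (b x)

end Covers

/-! ### Bounds for the projective dimension of filtered modules -/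

section Bounds

variable {R : Type u} [Ring R] {t : ℕ} {θ : Fin t → FGModuleCat.{u} R}

theorem pd_le_finPd {j : Fin t} (hj : j ∉ inftySet θ) : pd R (θ j) ≤ finPd θ := by
  classical
  rw [← ENat.natCast_toNat (n := pd R (θ j)) hj]
  have h1 : (pd R (θ j)).toNat ≤ finPd θ := by
    unfold finPd
    exact Finset.le_sup (f := fun j => (pd R (θ j)).toNat)
      (Finset.mem_filter.2 ⟨Finset.mem_univ j, hj⟩)
  exact_mod_cast h1

/-- At most one infinite index remains in `l`. When there is none, `i₂` serves vacuously. -/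
theorem forall_mem_or_forall_mem {i₀ i₁ i₂ : Fin t} (hinf : inftySet θ = {i₀, i₁, i₂})
    {l : List (Fin t)} (hl : ∀ i ∈ l, (i₀ : ℕ) < i) (h : ¬ (i₁ ∈ l ∧ i₂ ∈ l)) :
    ∃ b, (b = i₁ ∨ b = i₂) ∧ ∀ i ∈ l, i ∈ inftySet θ → i = b := by
  have h1 : ∀ i ∈ l, i ∈ inftySet θ → i = i₁ ∨ i = i₂ := fun i hi hi' => by
    rw [hinf] at hi'
    rcases hi' with rfl | hi'
    · exact absurd (hl i hi) (lt_irrefl _)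
    · exact hi'
  by_cases hi : i₁ ∈ l
  · exact ⟨i₁, Or.inl rfl, fun i hi' hi'' => (h1 i hi' hi'').resolve_right
      (by rintro rfl; exact h ⟨hi, hi'⟩)⟩
  · exact ⟨i₂, Or.inr rfl, fun i hi' hi'' => (h1 i hi' hi'').resolve_left
      (by rintro rfl; exact hi hi')⟩

theorem ListFiltered.pd_le_finPd {l : List (Fin t)} {M : FGModuleCat.{u} R}
    (h : ListFiltered θ l M) (hl : ∀ i ∈ l, i ∉ inftySet θ) : pd R M ≤ finPd θ := by
  induction l generalizing M with
  | nil =>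
    have : Subsingleton M := h
    exact pd_le_of_le (pd_le_zero_iff.2 inferInstance) (Nat.zero_le _)
  | cons i l ih =>
    obtain ⟨M', hM', f, g, hs⟩ := h
    exact hs.pd_middle_le (ih hM' fun j hj => hl j (by simp [hj]))
      (StratSys.pd_le_finPd (hl i (by simp)))

variable [IsArtinianRing R]

/-- Each `θ i` is covered by a `θ`-projective module whose kernel has indices above `i`, and gluing
keeps them above `c`. Passing to the minimal cover replaces the kernel by a direct summand, which
introduces no new index. -/
theorem exists_cover (k : Type v) [Field k] [Algebra k R] [Module.Finite k R]
    (hθ : IsStratifyingSystem θ) {l : List (Fin t)} {M : FGModuleCat.{u} R}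
    (hM : ListFiltered θ l M) {c : ℕ} (hc : ∀ i ∈ l, c ≤ i) :
    ∃ (Q : FGModuleCat.{u} R) (ε : Q →ₗ[R] M) (l' : List (Fin t)), IsExtProjCover θ ε ∧
      SES (FGModuleCat.of R (LinearMap.ker ε)) Q M ∧
      ListFiltered θ l' (FGModuleCat.of R (LinearMap.ker ε)) ∧ ∀ i ∈ l', c < i := by
  obtain ⟨Q, K, l₁, hs, hQ, hQ', hK, hl₁⟩ := hM.exists_approximation (P := (· ∈ filtered θ))
    (S := fun i => c < i) (fun X hX => mem_filtered_iff.2 ⟨[], hX⟩) (fun A B hA hB => by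
      obtain ⟨lA, hA⟩ := mem_filtered_iff.1 hA
      obtain ⟨lB, hB⟩ := mem_filtered_iff.1 hB
      exact mem_filtered_iff.2 ⟨_, hA.dsum hB⟩) (fun i hi => by
      obtain ⟨Q, K, l', hs, hK, hl', hQ⟩ := exists_thetaProjective_onto k hθ i
      exact ⟨Q, K, l', hs, mem_filtered_iff.2 ⟨_, (listFiltered_singleton i).append hK hs⟩, hQ, hK,
        fun j hj => (hc i hi).trans_lt (Fin.lt_def.1 (hl' j hj))⟩)
  obtain ⟨Q₀, ε, hε, -, hker, hses⟩ := exists_isExtProjCover hθ hs (mem_filtered_iff.2 ⟨l, hM⟩)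
    (mem_filtered_iff.2 ⟨l₁, hK⟩) hQ (mem_thetaProjective hQ')
  obtain ⟨l', hl', hK'⟩ := hK.summand hθ hker
  exact ⟨Q₀, ε, l', hε, hses, hK', fun i hi => hl₁ i (hl' hi)⟩

/-- A `θ`-projective module in `ℱ(θ)` belongs to the additive closure of the `Ext`-projective cover
of `∐ θ(i)`. -/
theorem IsExtProjCover.inStableAdd (k : Type v) [Field k] [Algebra k R] [Module.Finite k R]
    (hθ : IsStratifyingSystem θ) {Q : FGModuleCat.{u} R}
    {π : Q →ₗ[R] FGModuleCat.of R (∀ i, θ i)} (hπ : IsExtProjCover θ π) {X : FGModuleCat.{u} R}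
    (hX : X ∈ filtered θ) (hX' : X ∈ thetaProjective θ) : InStableAdd Q X := by
  obtain ⟨l, hl⟩ := exists_listFiltered_pi θ
  -- The definition of an Ext-projective cover does not ask for surjectivity. It follows because a
  -- surjective cover from a `θ`-projective module factors through `π`.
  have hsurj : Function.Surjective π := by
    obtain ⟨Q', ε, -, hε, ⟨f, g, hs⟩, -⟩ := exists_cover k hθ hl (c := 0) (by simp)
    obtain ⟨h, rfl⟩ := hπ.approximation Q' hε.projective g
    exact Function.Surjective.of_comp (g := h) hs.surj
  have hker : FGModuleCat.of R (LinearMap.ker π) ∈ filtered θ := hπ.ker_mem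
  obtain ⟨lK, hlK⟩ := mem_filtered_iff.1 hker
  -- The composite `Q → ∐ θ → θ i` has filtered kernel: it is an extension of the complement of `θ
  -- i`, a summand of a filtered module, by `ker π`.
  have key : ∀ i : Fin t, ∃ (K : FGModuleCat.{u} R) (l' : List (Fin t)), SES K Q (θ i) ∧
      ListFiltered θ l' K := by
    intro i
    let pr : FGModuleCat.of R (∀ i, θ i) →ₗ[R] θ i := LinearMap.proj i
    let sg : θ i →ₗ[R] FGModuleCat.of R (∀ i, θ i) :=
      LinearMap.single R (fun i => (θ i : Type u)) i
    have hps : ∀ y, pr (sg y) = y := fun y =>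
      Pi.single_eq_same (M := fun i => (θ i : Type u)) i y
    have hs : SES (FGModuleCat.of R (LinearMap.ker pr)) (FGModuleCat.of R (∀ i, θ i)) (θ i) :=
      ses_of_surjective fun y => ⟨sg y, hps y⟩
    have hsum : IsSummand (FGModuleCat.of R (LinearMap.ker pr))
        (FGModuleCat.of R (∀ i, θ i)) := by
      let p₀ : FGModuleCat.of R (∀ i, θ i) →ₗ[R] FGModuleCat.of R (LinearMap.ker pr) :=
        (LinearMap.id - sg ∘ₗ pr).codRestrict (LinearMap.ker pr) fun x => by
          change pr (x - sg (pr x)) = 0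
          rw [map_sub, hps, sub_self]
      refine IsSummand.of_retract (LinearMap.ker pr).subtype p₀ ?_
      refine LinearMap.ext fun x => Subtype.ext ?_
      have hx : pr x.1 = 0 := x.2
      change x.1 - sg (pr x.1) = x.1
      rw [hx, map_zero, sub_zero]
    obtain ⟨l', -, hl'⟩ := hl.summand hθ hsum
    obtain ⟨B, h1, h2⟩ := (ses_of_surjective hsurj).preimage hs
    exact ⟨B, _, h2, hl'.append hlK h1⟩
  obtain ⟨lX, hlX⟩ := mem_filtered_iff.1 hX
  obtain ⟨Q', K, l', hs, hQ', -, hK, -⟩ := hlX.exists_approximation (P := InStableAdd Q)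
    (S := fun _ => True) (fun X hX => .of_projective inferInstance) (fun A B hA hB => hA.dsum hB)
    (fun i _ => by
      obtain ⟨K, l', hs, hK⟩ := key i
      exact ⟨Q, K, l', hs, .self Q,
        fun j => hπ.projective _ (mem_filtered_iff.2 ⟨_, listFiltered_singleton j⟩), hK, by simp⟩)
  -- `Q'` is glued from copies of `Q` and maps onto `X` with kernel in `ℱ(θ)`. As `X` is
  -- `θ`-projective this splits, so `X` is a summand of `Q'`.
  obtain ⟨e⟩ := hs.split_of_extOneVanishes (hX' K (mem_filtered_iff.2 ⟨l', hK⟩))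
  exact hQ'.summand ((isSummand_dsum_right K X).trans
    (.of_equiv (M := Q') (X := dsum K X) e))

/-- High syzygies of a filtered module with a single factor `θ b` of infinite projective dimension,
up to multiplicity, belong to the additive closure of the syzygy of `θ b`. -/
theorem ListFiltered.inStableAdd_Syz (hθ : IsStratifyingSystem θ) {l : List (Fin t)}
    {M : FGModuleCat.{u} R} (h : ListFiltered θ l M) {b : Fin t}
    (hl : ∀ i ∈ l, i ∈ inftySet θ → i = b) {n : ℕ} (hn : finPd θ + 1 ≤ n) :
    InStableAdd (Syz n (θ b)) (Syz n M) := by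
  -- Sort the factors as `A` above `b`, `C` at `b`, `D` below `b`. Discarding the quotient `D` takes
  -- `s` syzygies, but discarding the submodule `A` takes `s + 1`.
  obtain ⟨n, rfl⟩ : ∃ m, n = m + 1 := ⟨n - 1, by omega⟩
  obtain ⟨A, B, hs, hA, hB⟩ := h.split_lt hθ (b + 1)
  obtain ⟨C, D, hs', hC, hD⟩ := hB.split_lt hθ b
  have hpA : pd R A ≤ n := pd_le_of_le (hA.pd_le_finPd fun i hi hi' => by
    simp only [List.mem_filter, decide_eq_true_eq] at hi
    rw [hl i hi.1 hi'] at hi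
    omega) (by omega)
  have hpD : pd R D ≤ (n + 1 : ℕ) := pd_le_of_le (hD.pd_le_finPd fun i hi hi' => by
    simp only [List.mem_filter, decide_eq_true_eq] at hi
    rw [hl i hi.1.1 hi'] at hi
    omega) (by omega)
  have hCb : InStableAdd (θ b) C := fun X hX hXC => by
    obtain ⟨-, ⟨e⟩⟩ := hC.indecomposable_summand hθ (c := b) (fun i hi => by
      simp only [List.mem_filter, decide_eq_true_eq] at hi
      exact Fin.ext (by omega)) hX hXC
    exact Or.inr (.of_equiv e)
  exact (hCb.Syz (n + 1)).congr ((hs'.stab.stabEq_Syz_left hpD).trans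
    (hs.stab.stabEq_Syz_right hpA))

theorem pd_lt_top_Syz {M : FGModuleCat.{u} R} (h : pd R M < ⊤) (n : ℕ) : pd R (Syz n M) < ⊤ := by
  obtain ⟨m, hm⟩ := pd_lt_top_iff.1 h
  exact pd_lt_top_iff.2 ⟨m, pd_Syz_le_iff.2 (pd_le_of_le hm (Nat.le_add_right m n))⟩

theorem SES.pd_le_add_Psi {A B C N : FGModuleCat.{u} R} (h : SES A B C) {n : ℕ}
    (hA : InStableAdd N (Syz n A)) (hB : InStableAdd N (Syz n B)) (hC : pd R C < ⊤) :
    pd R C ≤ (n + 1 + Psi N : ℕ) :=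
  pd_le_of_le (pd_Syz_le_iff.1 ((h.stab.Syz n).pd_le_Psi hA hB (pd_lt_top_Syz hC n))) (by omega)

/-- The bound for filtered modules with at most two factors of infinite projective dimension, up to
multiplicity. -/
theorem ListFiltered.pd_le_add_Psi (hθ : IsStratifyingSystem θ) {l : List (Fin t)}
    {M N : FGModuleCat.{u} R} (h : ListFiltered θ l M) {a b : Fin t} (hab : a < b)
    (hl : ∀ i ∈ l, i ∈ inftySet θ → i = a ∨ i = b) {n : ℕ} (hn : finPd θ + 1 ≤ n)
    (hb : InStableAdd N (Syz n (θ b))) (ha : InStableAdd N (Syz (n + 1) (θ a)))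
    (hM : pd R M < ⊤) : pd R M ≤ (n + 1 + Psi N : ℕ) := by
  obtain ⟨A, B, hs, hA, hB⟩ := h.split_lt hθ b
  have hAb := hA.inStableAdd_Syz hθ (b := b) (fun i hi hi' => by
    simp only [List.mem_filter, decide_eq_true_eq] at hi
    refine (hl i hi.1 hi').resolve_left ?_
    rintro rfl
    exact hi.2 hab) hn
  have hBa := hB.inStableAdd_Syz hθ (b := a) (fun i hi hi' => by
    simp only [List.mem_filter, decide_eq_true_eq] at hi
    refine (hl i hi.1 hi').resolve_right ?_
    rintro rfl
    exact absurd hi.2 (lt_irrefl _)) (n := n + 1) (by omega)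
  -- Rotation makes `Ωⁿ M` the cokernel of `Ωⁿ⁺¹ B → Ωⁿ A`, which explains why `θ a` enters with one
  -- syzygy more than `θ b`.
  have h1 := (hs.stab.Syz n).rotate
  rw [← Syz_succ] at h1
  exact pd_le_of_le (pd_Syz_le_iff.1 (h1.pd_le_Psi (hBa.trans ha) (hAb.trans hb)
    (pd_lt_top_Syz hM n))) (by omega)

/-- To bound `pfd ℱ(θ)` one may discard the factors below all indices of infinite projective
dimension. -/
theorem pfd_filtered_le (hθ : IsStratifyingSystem θ) {c : ℕ} (hc : ∀ i ∈ inftySet θ, c ≤ i)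
    {b : ℕ} (hb : finPd θ ≤ b)
    (H : ∀ (l : List (Fin t)) (M : FGModuleCat.{u} R), ListFiltered θ l M → (∀ i ∈ l, c ≤ i) →
      pd R M < ⊤ → pd R M ≤ b) : pfd R (filtered θ) ≤ b := by
  refine iSup₂_le fun M hM => ?_
  obtain ⟨l, hl⟩ := mem_filtered_iff.1 hM.1
  obtain ⟨A, B, hs, hA, hB⟩ := hl.split_lt hθ c
  have hpB : pd R B ≤ finPd θ := hB.pd_le_finPd fun i hi hi' => by
    simp only [List.mem_filter, decide_eq_true_eq] at hi
    exact absurd (hc i hi') (by omega)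
  have hpA : pd R A < ⊤ := hs.stab.pd_left_lt_top hM.2 (pd_lt_top_iff.2 ⟨_, hpB⟩)
  refine hs.stab.pd_middle_le (H _ A hA (fun i hi => ?_) hpA) (pd_le_of_le hpB hb)
  simp only [List.mem_filter, decide_eq_true_eq] at hi
  omega

/-- The inequality is applied to `Ωⁿ` of `K → Q₀ → M`, with `n = s + ε₀ + 3` large enough that `Ωⁿ
K` is controlled whether or not both `i₁` and `i₂` occur in `K`. -/
theorem pfd_le_of_threeFinitistic (k : Type v) [Field k] [Algebra k R] [Module.Finite k R]
    (hθ : IsStratifyingSystem θ) {i₀ i₁ i₂ : Fin t} (h₀₁ : i₀ < i₁) (h₁₂ : i₁ < i₂)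
    (hinf : inftySet θ = {i₀, i₁, i₂}) (h3 : ThreeFinitistic θ i₁ i₂) {Q : FGModuleCat.{u} R}
    {π : Q →ₗ[R] FGModuleCat.of R (∀ i, θ i)} (hπ : IsExtProjCover θ π) {ε₀ : ℕ}
    (hε₀ : Psi (dsum (Syz (finPd θ + 1) (θ i₂)) (Syz (finPd θ + 2) (θ i₁))) = ε₀) :
    pfd R (filtered θ) ≤ ((finPd θ + 4 + ε₀ +
      Psi (dsum (Syz (finPd θ + ε₀ + 3) (dsum (dsum (θ i₁) (θ i₂)) Q))
        (Syz (finPd θ + ε₀ + 4) (dsum (θ i₀) (θ i₁)))) : ℕ) : ℕ∞) := by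
  set s := finPd θ with hs
  set n := s + ε₀ + 3 with hn
  set N := dsum (Syz n (dsum (dsum (θ i₁) (θ i₂)) Q)) (Syz (s + ε₀ + 4) (dsum (θ i₀) (θ i₁)))
    with hN
  have hNl : InStableAdd N (Syz n (dsum (dsum (θ i₁) (θ i₂)) Q)) :=
    .of_summand (isSummand_dsum_left _ _)
  have h12 : IsSummand (dsum (θ i₁) (θ i₂)) (dsum (dsum (θ i₁) (θ i₂)) Q) :=
    isSummand_dsum_left _ _
  have hi : ∀ b, b = i₁ ∨ b = i₂ → InStableAdd N (Syz n (θ b)) := by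
    rintro b (rfl | rfl)
    · exact ((InStableAdd.of_summand ((isSummand_dsum_left _ _).trans h12)).Syz n).trans hNl
    · exact ((InStableAdd.of_summand ((isSummand_dsum_right _ _).trans h12)).Syz n).trans hNl
  have hQ : ∀ X, InStableAdd Q X → InStableAdd N (Syz n X) := fun X hX =>
    ((hX.trans (.of_summand (isSummand_dsum_right _ _))).Syz n).trans hNl
  have hc : ∀ i ∈ inftySet θ, (i₀ : ℕ) ≤ i := by
    rw [hinf]
    rintro i (rfl | rfl | rfl)
    · exact le_rfl
    · exact h₀₁.le
    · exact (h₀₁.trans h₁₂).le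
  refine pfd_filtered_le hθ hc (by omega) fun l M hM hl hpM => ?_
  obtain ⟨Q₀, ε, lK, hε, hses, hK, hlK⟩ := exists_cover k hθ hM hl
  have hQ₀ : InStableAdd N (Syz n Q₀) :=
    hQ _ (hπ.inStableAdd k hθ hε.source_mem hε.projective)
  have hKN : InStableAdd N (Syz n (FGModuleCat.of R (LinearMap.ker ε))) := by
    by_cases hmem : i₁ ∈ lK ∧ i₂ ∈ lK
    · have hpK := h3 M Q₀ ε hε ((hK.mem_supp_iff hθ i₁).2 hmem.1)
        ((hK.mem_supp_iff hθ i₂).2 hmem.2) hpM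
      -- The two-index bound at level `s + 1` gives `pd K ≤ s + 2 + ε₀`, which is below `n`.
      refine .of_projective (Syz_projective (pd_le_of_le (hK.pd_le_add_Psi hθ h₁₂ (fun i hil hii => ?_)
        le_rfl (.of_summand (isSummand_dsum_left _ _))
        (.of_summand (isSummand_dsum_right _ _)) hpK) (by rw [hε₀]; omega)))
      rw [hinf] at hii
      rcases hii with rfl | hii
      · exact absurd (hlK _ hil) (lt_irrefl _)
      · exact hii
    · obtain ⟨b, hb, hb'⟩ := forall_mem_or_forall_mem hinf hlK hmem
      exact (hK.inStableAdd_Syz hθ hb' (by omega)).trans (hi b hb)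
  exact pd_le_of_le (hses.pd_le_add_Psi hKN hQ₀ hpM) (by omega)

/-- The hypothesis only concerns modules whose infinite support is exactly `{i₀, i₁}`, so it is
applied to the quotient of `M` formed by the factors below `i₂`, and the resulting cover is then
transported to `M` by a pullback. -/
theorem pfd_le_of_threeCardinal (k : Type v) [Field k] [Algebra k R] [Module.Finite k R]
    (hθ : IsStratifyingSystem θ) {i₀ i₁ i₂ : Fin t} (h₀₁ : i₀ < i₁) (h₁₂ : i₁ < i₂)
    (hinf : inftySet θ = {i₀, i₁, i₂}) (h3 : ThreeCardinal θ i₀ i₁) {Q : FGModuleCat.{u} R}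
    {π : Q →ₗ[R] FGModuleCat.of R (∀ i, θ i)} (hπ : IsExtProjCover θ π) :
    pfd R (filtered θ) ≤ ((finPd θ + 2 +
      Psi (dsum (Syz (finPd θ + 1) (dsum (dsum (θ i₁) (θ i₂)) Q))
        (Syz (finPd θ + 2) (dsum (θ i₀) (θ i₁)))) : ℕ) : ℕ∞) := by
  set s := finPd θ with hs
  set N := dsum (Syz (s + 1) (dsum (dsum (θ i₁) (θ i₂)) Q)) (Syz (s + 2) (dsum (θ i₀) (θ i₁)))
    with hN
  have hNl : InStableAdd N (Syz (s + 1) (dsum (dsum (θ i₁) (θ i₂)) Q)) :=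
    .of_summand (isSummand_dsum_left _ _)
  have hNr : InStableAdd N (Syz (s + 2) (dsum (θ i₀) (θ i₁))) :=
    .of_summand (isSummand_dsum_right _ _)
  have h12 : IsSummand (dsum (θ i₁) (θ i₂)) (dsum (dsum (θ i₁) (θ i₂)) Q) :=
    isSummand_dsum_left _ _
  have hi : ∀ b, b = i₁ ∨ b = i₂ → InStableAdd N (Syz (s + 1) (θ b)) := by
    rintro b (rfl | rfl)
    · exact ((InStableAdd.of_summand ((isSummand_dsum_left _ _).trans h12)).Syz _).trans hNl
    · exact ((InStableAdd.of_summand ((isSummand_dsum_right _ _).trans h12)).Syz _).trans hNl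
  have hi' : ∀ a, a = i₀ ∨ a = i₁ → InStableAdd N (Syz (s + 2) (θ a)) := by
    rintro b (rfl | rfl)
    · exact ((InStableAdd.of_summand (isSummand_dsum_left _ _)).Syz _).trans hNr
    · exact ((InStableAdd.of_summand (isSummand_dsum_right _ _)).Syz _).trans hNr
  have hQ : ∀ X, InStableAdd Q X → InStableAdd N (Syz (s + 1) X) := fun X hX =>
    ((hX.trans (.of_summand (isSummand_dsum_right _ _))).Syz _).trans hNl
  have hc : ∀ i ∈ inftySet θ, (i₀ : ℕ) ≤ i := by
    rw [hinf]
    rintro i (rfl | rfl | rfl)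
    · exact le_rfl
    · exact h₀₁.le
    · exact (h₀₁.trans h₁₂).le
  refine pfd_filtered_le hθ hc (by omega) fun l M hM hl hpM => ?_
  -- If `i₀` or `i₁` is absent, at most two infinite indices remain, and the two-index bound at
  -- level `s + 1` is already `s + 2 + Ψ(N)`.
  by_cases hm₀ : i₀ ∈ l
  swap
  · refine pd_le_of_le (hM.pd_le_add_Psi hθ h₁₂ (fun i hil hii => ?_) le_rfl (hi _ (Or.inr rfl))
      (hi' _ (Or.inr rfl)) hpM) (by omega)
    rw [hinf] at hii
    rcases hii with rfl | hii
    · exact absurd hil hm₀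
    · exact hii
  by_cases hm₁ : i₁ ∈ l
  swap
  · refine pd_le_of_le (hM.pd_le_add_Psi hθ (h₀₁.trans h₁₂) (fun i hil hii => ?_) le_rfl
      (hi _ (Or.inr rfl)) (hi' _ (Or.inl rfl)) hpM) (by omega)
    rw [hinf] at hii
    rcases hii with hii | rfl | hii
    · exact Or.inl hii
    · exact absurd hil hm₁
    · exact Or.inr hii
  obtain ⟨A, B, hAB, hA, hB⟩ := hM.split_lt hθ i₂
  obtain ⟨Q₀, ε, lK, hε, hses, hK, hlK⟩ := exists_cover k hθ hB (c := i₀) (fun i hil =>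
    hl i (List.mem_filter.1 hil).1)
  have hcard := h3 B Q₀ ε hε (by
    ext i
    rw [Set.mem_inter_iff, hB.mem_supp_iff hθ, hinf]
    simp only [List.mem_filter, decide_eq_true_eq, Set.mem_insert_iff, Set.mem_singleton_iff]
    constructor
    · rintro ⟨⟨-, h⟩, h1 | h1 | h1⟩
      · exact Or.inl h1
      · exact Or.inr h1
      · rw [h1] at h; omega
    · rintro (rfl | rfl)
      · exact ⟨⟨hm₀, h₀₁.trans h₁₂⟩, Or.inl rfl⟩
      · exact ⟨⟨hm₁, h₁₂⟩, Or.inr (Or.inl rfl)⟩)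
  have hmem : ¬ (i₁ ∈ lK ∧ i₂ ∈ lK) := fun ⟨h1, h2⟩ => by
    have h := (Set.ncard_le_one (Set.toFinite _)).1 hcard i₁
      ⟨(hK.mem_supp_iff hθ i₁).2 h1, by rw [hinf]; simp⟩ i₂
      ⟨(hK.mem_supp_iff hθ i₂).2 h2, by rw [hinf]; simp⟩
    exact h₁₂.ne h
  obtain ⟨b, hb, hb'⟩ := forall_mem_or_forall_mem hinf hlK hmem
  -- The pullback `Z` of `M → B ← Q₀` is an extension of the `θ`-projective `Q₀` by `A`, so `Z ≃ A ⨿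
  -- Q₀`. It also maps onto `M` with kernel `K`.
  obtain ⟨Z, hZ, hZ'⟩ := hAB.pullback hses
  obtain ⟨e⟩ := hZ.split_of_extOneVanishes
    (hε.projective A (mem_filtered_iff.2 ⟨_, hA⟩))
  have hKN := (hK.inStableAdd_Syz hθ hb' le_rfl).trans (hi b hb)
  have hAN : InStableAdd N (Syz (s + 1) A) :=
    (hA.inStableAdd_Syz hθ (b := i₂) (fun i hil hii => by
      simp only [List.mem_filter, decide_eq_true_eq] at hil
      rw [hinf] at hii
      rcases hii with rfl | rfl | hii
      · exact absurd (h₀₁.trans h₁₂) hil.2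
      · exact absurd h₁₂ hil.2
      · exact hii) le_rfl).trans (hi _ (Or.inr rfl))
  have hQN : InStableAdd N (Syz (s + 1) Q₀) :=
    hQ _ (hπ.inStableAdd k hθ hε.source_mem hε.projective)
  have hZN : InStableAdd N (Syz (s + 1) Z) :=
    (hAN.dsum hQN).congr ((stabEq_Syz_dsum _ A Q₀).symm.trans
      ((StabEq.of_equiv (A := dsum A Q₀) e.symm).Syz _))
  exact pd_le_of_le (hZ'.pd_le_add_Psi hKN hZN hpM) (by omega)

end Bounds

end StratSys

/-! ### The main theorem -/

open StratSys
theorem theorem4p9 {k : Type v} [Field k] [IsAlgClosed k] {R : Type u} [Ring R] [Algebra k R]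
    [Module.Finite k R] {t : ℕ} (θ : Fin t → FGModuleCat.{u} R) (hθ : IsStratifyingSystem θ)
    (i₀ i₁ i₂ : Fin t) (h₀₁ : i₀ < i₁) (h₁₂ : i₁ < i₂) (hinf : inftySet θ = {i₀, i₁, i₂}) :
    haveI : IsArtinianRing R := IsArtinianRing.of_finite k R
    let s : ℕ := finPd θ
    let ε₀ : ℕ := Psi (dsum (Syz (s + 1) (θ i₂)) (Syz (s + 2) (θ i₁)))
    let θ₁₂ := dsum (θ i₁) (θ i₂)
    let θ₀₁ := dsum (θ i₀) (θ i₁)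
    (ThreeFinitistic θ i₁ i₂ →
      pfd R (filtered θ) < ⊤ ∧
      ∀ (Q : FGModuleCat.{u} R) (π : Q →ₗ[R] FGModuleCat.of R (∀ i, θ i)), IsExtProjCover θ π →
        pfd R (filtered θ) ≤ ((s + 4 + ε₀ +
          Psi (dsum (Syz (s + ε₀ + 3) (dsum θ₁₂ Q)) (Syz (s + ε₀ + 4) θ₀₁)) : ℕ) : ℕ∞)) ∧
    (ThreeCardinal θ i₀ i₁ →
      pfd R (filtered θ) < ⊤ ∧
      ∀ (Q : FGModuleCat.{u} R) (π : Q →ₗ[R] FGModuleCat.of R (∀ i, θ i)), IsExtProjCover θ π →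
        pfd R (filtered θ) ≤ ((s + 2 +
          max (Psi (dsum (Syz (s + 1) (θ i₂)) (Syz (s + 2) Q)))
            (Psi (dsum (Syz (s + 1) (dsum θ₁₂ Q)) (Syz (s + 2) θ₀₁))) : ℕ) : ℕ∞)) := by
  have hR : IsArtinianRing R := IsArtinianRing.of_finite k R
  intro s ε₀ θ₁₂ θ₀₁
  obtain ⟨l, hl⟩ := exists_listFiltered_pi θ
  -- Finiteness of `pfd ℱ(θ)` is asserted without a given cover of `∐ θ(i)`, so one is constructed
  -- here.
  obtain ⟨Q', π', -, hπ', -⟩ := exists_cover k hθ hl (c := 0) (by simp)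
  refine ⟨fun h3 => ⟨?_, fun Q π hπ => ?_⟩, fun h3 => ⟨?_, fun Q π hπ => ?_⟩⟩
  · exact (pfd_le_of_threeFinitistic k hθ h₀₁ h₁₂ hinf h3 hπ' rfl).trans_lt
      (ENat.natCast_lt_top _)
  · exact pfd_le_of_threeFinitistic k hθ h₀₁ h₁₂ hinf h3 hπ rfl
  · exact (pfd_le_of_threeCardinal k hθ h₀₁ h₁₂ hinf h3 hπ').trans_lt (ENat.natCast_lt_top _)
  -- The bound is proved with the second entry of the maximum alone.
  · refine (pfd_le_of_threeCardinal k hθ h₀₁ h₁₂ hinf h3 hπ).trans ?_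
    exact_mod_cast Nat.add_le_add_left (le_max_right _ _) _
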